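/- **Conventions.** Links are unoriented links in $\mathbb R^3=\mathbb C\times\mathbb R$ (horizontal plane times height); two links are equivalent if some ambient isotopy of $\mathbb R^3$ carries the components of one bijectively onto the components of the other. A sublink of a link is a union of some of its components. A Hamiltonian path in a graph is a path that visits each vertex precisely once (for a graph with one vertex, the trivial path is one). Graphs may have loops and multiple edges. **The string of trefoils** with $m$ components ($m$ odd) consists of trefoils and unknots arranged alternately in a line, with trefoils at both ends, each unknot clasping the two trefoils next to it. All trefoils, here and below, have the same (fixed) handedness. **The link $L(\Gamma)$.** Let $\Gamma$ be a graph with finitely many vertices. Remove all loops, and replace the edges joining any given pair of vertices by a single edge; call the resulting simple graph $\Gamma_-$. Place the vertices of $\Gamma_-$ at distinct points of the unit circle in the plane, realise each edge as a straight diagonal, and move the diagonals vertically off one another, leaving them unchanged near the vertices, so that $\Gamma_-$ is embedded in $\mathbb R^3$: each edge becomes the graph of a continuous height function over its diagonal that vanishes near the ends, and the heights of two edges differ wherever their diagonals cross. Replace each vertex by a small trefoil near this vertex, with a planar diagram with three crossings. Replace each edge by an unknot whose projection is the boundary of a thin rectangle about the diagonal: it runs along the edge, turns round inside the outer lobe that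 the trefoil at one endpoint turns towards the centre of the circle, runs back along the edge, and turns round in the same way at the other endpoint. At each of its endpoints it crosses the trefoil there exactly twice, one of its two strands passing over the trefoil and the other one under it (which strand passes over may be chosen for each edge and each endpoint), so that it clasps this trefoil. Let $L_\delta(\Gamma)$ be the resulting link with one component for each vertex and one for each edge of $\Gamma_-$, where the trefoils have size of order $\delta$ and the rectangles have width of order $\delta^2$. **Proposition 4.1.** Let $\Gamma$ be a graph with $n\ge 1$ vertices. The choices in this construction (positions of the vertices, heights of the edges, clasps) can be made, and however they are made, for all sufficiently small $\delta>0$ the following holds: $\Gamma$ contains a Hamiltonian path if and only if $L_\delta(\Gamma)$ contains as a sublink a link equivalent to the string of trefoils with $2n-1$ components. -/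

import Mathlib

open scoped Topology

/-! ### Links in `ℝ³` and their equivalence

`ℝ³` is modelled as `ℂ × ℝ`: the first factor is the horizontal plane of the diagrams, the second
factor is the height. A link is handled through the family of its components, each component being
a subset of space. Links are unoriented, as sets are. -/

/-- Three-dimensional space, as horizontal plane times height. -/
abbrev Space : Type := ℂ × ℝ

/-- Two links, given by the families of their components, are equivalent: some ambient isotopy of
`ℝ³` carries the components of the first bijectively onto the components of the second. -/
def LinkEquivalent {ι κ : Type*} (L : ι → Set Space) (M : κ → Set Space) : Prop :=
  ∃ H : unitInterval → (Space ≃ₜ Space),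
    Continuous (fun p : unitInterval × Space => H p.1 p.2) ∧
    (∀ x, H 0 x = x) ∧
    ∃ σ : ι ≃ κ, ∀ i, H 1 '' L i = M (σ i)

/-- The sublink of `L` formed by the components with index in `S`. -/
def sublink {ι : Type*} (L : ι → Set Space) (S : Set ι) : S → Set Space :=
  fun i => L i

/-- `L` contains a link equivalent to `M` as a sublink. -/
def ContainsAsSublink {ι κ : Type*} (L : ι → Set Space) (M : κ → Set Space) : Prop :=
  ∃ S : Set ι, LinkEquivalent (sublink L S) M

/-! ### The building blocks: a small trefoil and a clasping unknot -/

/-- The closed polygon through the points `P 0, P 1, …, P (m - 1), P 0`. -/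
def closedPolygon {m : ℕ} [NeZero m] (P : Fin m → Space) : Set Space :=
  ⋃ i, segment ℝ (P i) (P (i + 1))

/-- The vertices of a polygonal trefoil. Its projection to the plane has exactly three crossings,
at `-1 + 2i`, `-1 - 2i` and `-3`, and they alternate along the knot. The origin lies in the
bounded region between the first two of these crossings (a lobe of the diagram); the outer side of
this lobe consists of three sides of the square `[-2, 2] × [-2, 2]`, at height `0`. -/
noncomputable def trefoilVertex : Fin 8 → Space :=
  ![(⟨2, -2⟩, 0), (⟨2, 2⟩, 0), (⟨-2, 2⟩, 0), (⟨-4, -2⟩, -1),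
    (⟨-1, -3⟩, 1), (⟨-1, 3⟩, -1), (⟨-4, 2⟩, 1), (⟨-2, -2⟩, 0)]

/-- The trefoil of size `δ` at the point `p` of the plane, turned (by the rotation of the plane
that takes `1` to the unit vector `d`) so that its distinguished lobe faces direction `d`. -/
noncomputable def trefoil (p d : ℂ) (δ : ℝ) : Set Space :=
  closedPolygon fun i => (p + δ * d * (trefoilVertex i).1, δ * (trefoilVertex i).2)

/-- The point at parameter `t` of the left (`ε = 1`) or right (`ε = -1`) strand of the unknot
running along the arc `t ↦ (p + t (q - p), h t)` from `p` to `q`. The left strand is moved to the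
left by `δ² |q - p|`. Its height exceeds `h` by `δ` times a number that goes linearly from `a` at
`p` to `-b` at `q`; the right strand is lower than `h` by the same amount. -/
noncomputable def strand (p q : ℂ) (h : ℝ → ℝ) (a b : ℤˣ) (δ ε t : ℝ) : Space :=
  (p + t * (q - p) + ε * δ ^ 2 * Complex.I * (q - p),
    h t + ε * δ * ((1 - t) * ((a : ℤ) : ℝ) - t * ((b : ℤ) : ℝ)))

/-- The unknot that runs along the arc `t ↦ (p + t (q - p), h t)`, turns round near `q`, runs back
along the arc and turns round near `p`. It projects to the boundary of a thin rectangle. The sign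
`a` says which strand is the higher one near `p`: the one on the left, as seen from `p` looking
towards `q`, if `a = 1`, and the one on the right if `a = -1`. The sign `b` does the same for the
end `q`, as seen from `q` looking towards `p`. -/
noncomputable def claspingUnknot (p q : ℂ) (h : ℝ → ℝ) (a b : ℤˣ) (δ : ℝ) : Set Space :=
  strand p q h a b δ 1 '' Set.Icc (δ / 2) (1 - δ / 2) ∪
  strand p q h a b δ (-1) '' Set.Icc (δ / 2) (1 - δ / 2) ∪
  segment ℝ (strand p q h a b δ 1 (δ / 2)) (strand p q h a b δ (-1) (δ / 2)) ∪
  segment ℝ (strand p q h a b δ 1 (1 - δ / 2)) (strand p q h a b δ (-1) (1 - δ / 2))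

/-! ### The string of trefoils -/

/-- The string of trefoils with `m` components, for odd `m`: trefoils and unknots alternate along
a line, with trefoils at both ends, and each unknot clasps the two trefoils next to it. The
components are numbered from `0` along the line. The trefoils, of size `1/10`, are at the even
integers of the real axis, and each unknot runs from one even integer to the next. -/
noncomputable def stringOfTrefoils (m : ℕ) : Fin m → Set Space := fun j =>
  if Even (j : ℕ) then trefoil (j : ℕ) Complex.I (1 / 10)
  else claspingUnknot ((j : ℕ) - 1) ((j : ℕ) + 1) (fun _ => 0) 1 1 (1 / 10)

/-! ### Graphs -/

/-- The multigraph `Γ` contains a Hamiltonian path: a path that visits each vertex precisely once.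
It is given by the list of its successive vertices. -/
def Graph.HasHamiltonianPath {α β : Type*} (Γ : Graph α β) : Prop :=
  ∃ p : List α, p ≠ [] ∧ p.Nodup ∧ (∀ x, x ∈ p ↔ x ∈ Γ.vertexSet) ∧ p.IsChain Γ.Adj

/-- The simple graph obtained from a multigraph by removing edge loops and replacing the edges
that join a given pair of vertices by a single edge. -/
def Graph.simplification {α β : Type*} (Γ : Graph α β) : SimpleGraph Γ.vertexSet where
  Adj x y := x ≠ y ∧ Γ.Adj x y
  symm := ⟨fun _ _ h => ⟨h.1.symm, h.2.symm⟩⟩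
  loopless := ⟨fun _ h => h.1 rfl⟩

/-! ### The link of a graph -/

/-- The choices made in drawing a simple graph `G`: its vertices are placed on a circle in the
plane, its edges are realised as diagonals, and these are moved vertically off one another, away
from the vertices, so that `G` is embedded in `ℝ³`. The heights of the edges record which of two
crossing diagonals passes over the other. The last field chooses, for each edge and each of its
ends, how the unknot along the edge clasps the trefoil at this end. -/
structure Drawing {V : Type*} (G : SimpleGraph V) where
  /-- The position of a vertex on the unit circle. -/
  pos : V → Circle
  pos_injective : Function.Injective pos
  /-- `height u v t` is the height of the edge `uv` over the point `(1 - t) u + t v`. -/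
  height : V → V → ℝ → ℝ
  height_continuous : ∀ u v, Continuous (height u v)
  height_symm : ∀ u v t, height v u t = height u v (1 - t)
  /-- Near the vertices, the edges stay in the plane. -/
  height_eq_zero : ∀ u v, ∀ᶠ t in 𝓝 (0 : ℝ), height u v t = 0
  /-- Where two diagonals cross, one of the two edges is above the other. -/
  height_ne : ∀ u v u' v', G.Adj u v → G.Adj u' v' → s(u, v) ≠ s(u', v') →
    ∀ t ∈ Set.Ioo (0 : ℝ) 1, ∀ t' ∈ Set.Ioo (0 : ℝ) 1,
      (pos u + t * (pos v - pos u) : ℂ) = pos u' + t' * (pos v' - pos u') →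
      height u v t ≠ height u' v' t'
  /-- `clasp u v = 1` if, seen from `u` looking towards `v`, the left strand of the unknot along
  `uv` passes over the trefoil at `u` and the right strand under it; `clasp u v = -1` if it is the
  other way round. -/
  clasp : V → V → ℤˣ

/-- The link `L(Γ)` built from a drawing, with trefoils of size `δ`. Each vertex becomes a small
trefoil, turned so that its distinguished lobe faces the centre of the circle, and each edge
becomes an unknot that runs along the edge and clasps the trefoils at its two ends. (The unknots
obtained from `(u, v)` and from `(v, u)` are the same.) -/
noncomputable def Drawing.link {V : Type*} {G : SimpleGraph V} (D : Drawing G) (δ : ℝ) :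
    V ⊕ G.edgeSet → Set Space
  | Sum.inl v => trefoil (D.pos v) (-(D.pos v : ℂ)) δ
  | Sum.inr e => ⋃ (u : V) (v : V) (_ : s(u, v) = (e : Sym2 V)),
      claspingUnknot (D.pos u) (D.pos v) (D.height u v) (D.clasp u v) (D.clasp v u) δ

/-! ### Homeomorphisms of space that are isotopic to the identity -/

/-! A Hamiltonian path gives a chain of trefoils and unknots in the link, and the proof shows that
any two such chains of equal length are ambient isotopic, whatever the positions, heights and clasps
(`ChainData.Good.exists_isotopy`). Conversely, pairwise linking alone recovers a path in the graph
from a sublink equivalent to the string.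

The isotopy is built one component at a time. Suppose that a homeomorphism already matches the
earlier components of the two chains. The next component lies in a ball which the earlier components
meet only in a straight line. A new unknot bounds a plate that is pierced once, along an axis, by
the previous trefoil. A new trefoil lies in a ball through which the previous unknot runs as a
vertical axis. Such a ball can be squeezed along the line into an arbitrarily small neighbourhood of
its centre, carried over by the given homeomorphism, and expanded again. So only germs at one point
have to be matched, and there the charts differ by a linear map that preserves the line and is
joined to the identity through such maps (`exists_extend_germ`, `RealizableAlong`). Isotopies come
for free: a homeomorphism that is the identity near a point is isotopic to the identity by zooming
in at that point (`isotopicToId_of_eventually`). The signs of the clasps do not matter because the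
trefoil is invariant under a half turn, which the induction tracks by a sign.

The charts have to show a round trefoil and straight unknots at the same time, although an edge may
leave its vertex in any direction of a half plane. The trefoil is therefore flattened into a ring
(`thinning`), and space is rotated above, below, inside and outside this ring but not on it
(`twist`).

For the converse, `Linked A B` says that some nonvanishing function off `B` has no continuous
logarithm on `A`. Homeomorphisms preserve this relation. It fails when `A` lies in a suitable cell
that misses `B`, and it holds for a trefoil and an unknot that clasps it (`EdgeGoodAt.linked`).
Hence the components of a sublink equivalent to the string form an induced path with `2n - 1` nodes
in the incidence graph of vertices and edges. Such a path yields `n` distinct vertices, consecutive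
ones adjacent, even if it starts with an edge (`SimpleGraph.exists_path_of_incident`). No knot type
has to be distinguished.

For small `δ` all pieces are well separated (`Drawing.eventually_separated`): the bands have width
of order `δ²` but start at distance of order `δ` from the vertices. -/

/-- `f` is the final homeomorphism of an ambient isotopy. -/
def IsotopicToId (f : Space ≃ₜ Space) : Prop :=
  ∃ H : unitInterval → (Space ≃ₜ Space),
    Continuous (fun p : unitInterval × Space => H p.1 p.2) ∧ (∀ x, H 0 x = x) ∧ H 1 = f

theorem IsotopicToId.trans {f g : Space ≃ₜ Space} (hf : IsotopicToId f) (hg : IsotopicToId g) :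
    IsotopicToId (f.trans g) := by
  obtain ⟨H, hH, h0, h1⟩ := hf
  obtain ⟨K, hK, k0, k1⟩ := hg
  refine ⟨fun t => (H t).trans (K t), hK.comp (continuous_fst.prodMk hH), fun x => ?_, ?_⟩
  · simp [h0, k0]
  · simp [h1, k1]

theorem IsotopicToId.symm {f : Space ≃ₜ Space} (hf : IsotopicToId f) : IsotopicToId f.symm := by
  obtain ⟨H, hH, h0, h1⟩ := hf
  refine ⟨fun t => f.symm.trans (H (unitInterval.symm t)), ?_, fun x => ?_, ?_⟩
  · exact hH.comp ((unitInterval.continuous_symm.comp continuous_fst).prodMk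
      (f.symm.continuous.comp continuous_snd))
  · simp [h1]
  · ext1 x
    simp [h0]

/-- A homeomorphism that is the identity near some point is isotopic to the identity. -/
theorem isotopicToId_of_eventually {f : Space ≃ₜ Space} {x₀ : Space}
    (hf : ∀ᶠ x in 𝓝 x₀, f x = x) : IsotopicToId f := by
  let D : ∀ t : unitInterval, (t : ℝ) ≠ 0 → (Space ≃ₜ Space) := fun t ht =>
    (Homeomorph.addRight (-x₀)).trans ((Homeomorph.smulOfNeZero (t : ℝ) ht).trans
      (Homeomorph.addRight x₀))
  let H : unitInterval → (Space ≃ₜ Space) := fun t =>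
    if ht : (t : ℝ) = 0 then Homeomorph.refl _ else (D t ht).trans (f.trans (D t ht).symm)
  have hH : ∀ (t : unitInterval) (x : Space), (t : ℝ) ≠ 0 →
      H t x = (t : ℝ)⁻¹ • (f ((t : ℝ) • (x + -x₀) + x₀) + -x₀) + x₀ := by
    intro t x ht
    simp only [H, D, dif_neg ht]
    change (t : ℝ)⁻¹ • (f ((t : ℝ) • (x + -x₀) + x₀) + -x₀) + - -x₀ = _
    rw [neg_neg]
  have hc : Continuous fun q : unitInterval × Space => (q.1 : ℝ) • (q.2 + -x₀) + x₀ := by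
    fun_prop
  refine ⟨H, ?_, fun x => by simp [H], ?_⟩
  · rw [continuous_iff_continuousAt]
    rintro ⟨t, x⟩
    by_cases ht : (t : ℝ) = 0
    · have h1 : ∀ᶠ q : unitInterval × Space in 𝓝 (t, x),
          f ((q.1 : ℝ) • (q.2 + -x₀) + x₀) = (q.1 : ℝ) • (q.2 + -x₀) + x₀ := by
        have h2 : Filter.Tendsto (fun q : unitInterval × Space => (q.1 : ℝ) • (q.2 + -x₀) + x₀)
            (𝓝 (t, x)) (𝓝 x₀) := by
          simpa [ht] using hc.tendsto (t, x)
        exact h2.eventually hf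
      refine ContinuousAt.congr (f := fun q : unitInterval × Space => q.2) continuousAt_snd ?_
      filter_upwards [h1] with q hq
      by_cases hq0 : (q.1 : ℝ) = 0
      · simp only [H, dif_pos hq0]
        rfl
      · rw [hH _ _ hq0, hq, add_neg_cancel_right, inv_smul_smul₀ hq0]
        simp
    · have h1 : ∀ᶠ q : unitInterval × Space in 𝓝 (t, x), (q.1 : ℝ) ≠ 0 :=
        (continuous_subtype_val.comp continuous_fst).continuousAt.eventually_ne ht
      refine ContinuousAt.congr (f := fun q : unitInterval × Space =>
        (q.1 : ℝ)⁻¹ • (f ((q.1 : ℝ) • (q.2 + -x₀) + x₀) + -x₀) + x₀) ?_ ?_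
      · have h2 : ContinuousAt (fun q : unitInterval × Space => (q.1 : ℝ)⁻¹) (t, x) :=
          (continuous_subtype_val.comp continuous_fst).continuousAt.inv₀ ht
        exact (h2.smul ((f.continuous.comp hc).add continuous_const).continuousAt).add
          continuousAt_const
      · filter_upwards [h1] with q hq
        rw [hH _ _ hq]
  · ext1 x
    rw [hH 1 x (by simp)]
    simp

/-- The similarity of space that moves the origin to `p`, turns the plane by the argument of `d`
and scales by `δ` (and the plane by `|d|` in addition). -/
@[simps]
noncomputable def sim (p d : ℂ) (δ : ℝ) (hd : d ≠ 0) (hδ : δ ≠ 0) : Space ≃ₜ Space where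
  toFun x := (p + δ * d * x.1, δ * x.2)
  invFun x := ((x.1 - p) / (δ * d), x.2 / δ)
  left_inv x := by
    have : (δ : ℂ) ≠ 0 := by exact_mod_cast hδ
    ext1
    · simp only []
      field_simp
      ring
    · simp only []
      field_simp
  right_inv x := by
    have : (δ : ℂ) ≠ 0 := by exact_mod_cast hδ
    ext1
    · simp only []
      field_simp
      ring
    · simp only []
      field_simp
  continuous_toFun := by fun_prop
  continuous_invFun := by
    simp only [div_eq_mul_inv]
    fun_prop

/-- The parameters are moved along `t p`, `exp (t log d)` and `exp (t log δ)`, which never vanish in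
the last two places. -/
theorem isotopicToId_sim (p d : ℂ) (δ : ℝ) (hd : d ≠ 0) (hδ : 0 < δ) :
    IsotopicToId (sim p d δ hd hδ.ne') := by
  refine ⟨fun t => sim (t * p) (Complex.exp (t * Complex.log d)) (Real.exp (t * Real.log δ))
    (Complex.exp_ne_zero _) (Real.exp_pos _).ne', ?_, fun x => ?_, ?_⟩
  · simp only [sim_apply]
    fun_prop
  · simp
  · ext1 x
    simp [Complex.exp_log hd, Real.exp_log hδ]

/-! ### Homeomorphisms moving the fibres of a product -/

section Fiber

variable {E F : Type*} [TopologicalSpace E] [NormedAddCommGroup F] [NormedSpace ℝ F]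
  [CompleteSpace F]

theorem bijective_add_of_lipschitz (f : F → F) (K : ℝ) (hK : K < 1)
    (hf : ∀ v w, ‖f v - f w‖ ≤ K * ‖v - w‖) : Function.Bijective fun v => v + f v := by
  rcases subsingleton_or_nontrivial F with hF | hF
  · exact ⟨fun _ _ _ => Subsingleton.elim _ _, fun y => ⟨y, Subsingleton.elim _ _⟩⟩
  obtain ⟨v₀, w₀, hvw⟩ := exists_pair_ne F
  have hK0 : 0 ≤ K := by
    have h := (norm_nonneg _).trans (hf v₀ w₀)
    exact nonneg_of_mul_nonneg_left h (norm_sub_pos_iff.2 hvw)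
  have h : ApproximatesLinearOn (fun v => v + f v)
      ((ContinuousLinearEquiv.refl ℝ F : F ≃L[ℝ] F) : F →L[ℝ] F) Set.univ ⟨K, hK0⟩ := by
    intro v _ w _
    refine le_trans (le_of_eq ?_) (hf v w)
    congr 1
    simp only [ContinuousLinearEquiv.coe_refl, ContinuousLinearMap.id_apply]
    abel
  have hlt : (⟨K, hK0⟩ : NNReal) <
      ‖((ContinuousLinearEquiv.refl ℝ F).symm : F →L[ℝ] F)‖₊⁻¹ := by
    have : ‖((ContinuousLinearEquiv.refl ℝ F).symm : F →L[ℝ] F)‖₊ = 1 := by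
      ext
      exact ContinuousLinearMap.norm_id
    rw [this, inv_one]
    exact hK
  have := (h.toHomeomorph _ (Or.inr hlt)).bijective
  exact this

/-- A homeomorphism of a product that moves the points of each fibre `{x} × F` by a contraction. -/
theorem exists_fiberHomeo {f : E × F → F} (hf : Continuous f) (K : ℝ) (hK : K < 1)
    (hL : ∀ x v w, ‖f (x, v) - f (x, w)‖ ≤ K * ‖v - w‖) :
    ∃ Φ : E × F ≃ₜ E × F, ∀ x, Φ x = (x.1, x.2 + f x) := by
  have hb : ∀ x, Function.Bijective fun v => v + f (x, v) := fun x =>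
    bijective_add_of_lipschitz (fun v => f (x, v)) K hK (hL x)
  let g : E × F → E × F := fun x => (x.1, x.2 + f x)
  have hg : Function.Bijective g := by
    constructor
    · rintro ⟨x, v⟩ ⟨y, w⟩ h
      obtain ⟨h1, h2⟩ := Prod.ext_iff.1 h
      simp only [g] at h1 h2
      subst h1
      rw [(hb x).1 h2]
    · rintro ⟨x, w⟩
      obtain ⟨v, hv⟩ := (hb x).2 w
      exact ⟨(x, v), Prod.ext rfl hv⟩
  let e := Equiv.ofBijective g hg
  have he : ∀ x, e x = g x := fun _ => rfl
  -- Each fibre map expands distances by at least `1 - K`. Continuity of the inverse follows by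
  -- comparing the preimage of a nearby point with the fixed preimage of `y`, placed in the nearby
  -- fibre.
  have key : ∀ x v w, (1 - K) * ‖v - w‖ ≤ ‖v + f (x, v) - (w + f (x, w))‖ := by
    intro x v w
    have h1 : v - w = (v + f (x, v) - (w + f (x, w))) - (f (x, v) - f (x, w)) := by abel
    have h2 := norm_sub_le (v + f (x, v) - (w + f (x, w))) (f (x, v) - f (x, w))
    rw [← h1] at h2
    linarith [hL x v w]
  have hfst : ∀ y, (e.symm y).1 = y.1 := by
    intro y
    have := congrArg Prod.fst (e.apply_symm_apply y)
    exact this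
  have hsnd : ∀ y, (e.symm y).2 + f (y.1, (e.symm y).2) = y.2 := by
    intro y
    have := congrArg Prod.snd (e.apply_symm_apply y)
    rw [← hfst y]
    exact this
  have hcont : Continuous e.symm := by
    have h2 : Continuous fun y => (e.symm y).2 := by
      rw [continuous_iff_continuousAt]
      intro y
      rw [ContinuousAt, tendsto_iff_norm_sub_tendsto_zero]
      have hlim : Filter.Tendsto
          (fun y' : E × F => (1 - K)⁻¹ * ‖y'.2 - ((e.symm y).2 + f (y'.1, (e.symm y).2))‖)
          (𝓝 y) (𝓝 0) := by
        have hc : Continuous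
            (fun y' : E × F => (1 - K)⁻¹ * ‖y'.2 - ((e.symm y).2 + f (y'.1, (e.symm y).2))‖) := by
          fun_prop
        have := hc.tendsto y
        rwa [hsnd y, sub_self, norm_zero, mul_zero] at this
      refine squeeze_zero (fun _ => norm_nonneg _) (fun y' => ?_) hlim
      have hk := key y'.1 (e.symm y').2 (e.symm y).2
      rw [hsnd y'] at hk
      rwa [← div_eq_inv_mul, le_div_iff₀' (by linarith)]
    have h1 : Continuous fun y => (e.symm y).1 := by
      simp only [hfst]
      exact continuous_fst
    exact h1.prodMk h2
  have hcg : Continuous e := continuous_fst.prodMk (continuous_snd.add hf)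
  exact ⟨⟨e, hcg, hcont⟩, fun x => rfl⟩

end Fiber

/-! ### Squeezing along a line -/

section Squeeze

set_option linter.unusedSectionVars false

variable {E : Type*} [NormedAddCommGroup E] [NormedSpace ℝ E] [FiniteDimensional ℝ E]

theorem abs_clamp_sub_le (s t : ℝ) : |max 0 (min 1 s) - max 0 (min 1 t)| ≤ |s - t| := by
  have h1 := abs_max_sub_max_le_abs (min 1 s) (min 1 t) 0
  have h2 := abs_min_sub_min_le_max 1 s 1 t
  rw [max_comm 0, max_comm 0]
  refine h1.trans (h2.trans ?_)
  simp

/-- A small linear perturbation of the identity, cut off away from the origin. -/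
theorem exists_cutoff_linear (B : E →L[ℝ] E) {a b : ℝ} (ha : 0 < a) (hab : a < b)
    (hB : ‖B‖ * (1 + b / (b - a)) < 1) (ℓ : Submodule ℝ E) (hℓ : ∀ x ∈ ℓ, B x ∈ ℓ) :
    ∃ γ : E ≃ₜ E, (∀ x, ‖x‖ ≤ a → γ x = x + B x) ∧ (∀ x, b ≤ ‖x‖ → γ x = x) ∧
      ∀ x, γ x ∈ ℓ ↔ x ∈ ℓ := by
  have hba : 0 < b - a := sub_pos.2 hab
  have hb : 0 < b := ha.trans hab
  let c : E → ℝ := fun x => max 0 (min 1 ((b - ‖x‖) / (b - a)))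
  have hc0 : ∀ x, 0 ≤ c x := fun x => le_max_left _ _
  have hc1 : ∀ x, c x ≤ 1 := fun x => max_le zero_le_one (min_le_left _ _)
  have hcb : ∀ x, b ≤ ‖x‖ → c x = 0 := fun x hx =>
    max_eq_left ((min_le_right _ _).trans (div_nonpos_of_nonpos_of_nonneg (by linarith) hba.le))
  have hca : ∀ x, ‖x‖ ≤ a → c x = 1 := by
    intro x hx
    have : 1 ≤ (b - ‖x‖) / (b - a) := (one_le_div hba).2 (by linarith)
    simp only [c, min_eq_left this]
    simp
  have hcl : ∀ x y, |c x - c y| * (b - a) ≤ ‖x - y‖ := by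
    intro x y
    have h := abs_clamp_sub_le ((b - ‖x‖) / (b - a)) ((b - ‖y‖) / (b - a))
    rw [← sub_div, abs_div, abs_of_pos hba, le_div_iff₀ hba] at h
    refine h.trans ?_
    rw [show b - ‖x‖ - (b - ‖y‖) = -(‖x‖ - ‖y‖) by ring, abs_neg]
    exact abs_norm_sub_norm_le x y
  -- The difference is split so that the increment of the cutoff multiplies the shorter vector:
  -- either this vector has length at most `b`, or both cutoffs vanish.
  have key : ∀ x y, ‖y‖ ≤ ‖x‖ →
      ‖c x • B x - c y • B y‖ ≤ ‖B‖ * (1 + b / (b - a)) * ‖x - y‖ := by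
    intro x y hxy
    have h1 : c x • B x - c y • B y = c x • B (x - y) + (c x - c y) • B y := by
      rw [map_sub, smul_sub, sub_smul]
      abel
    have h2 : ‖c x • B (x - y)‖ ≤ ‖B‖ * ‖x - y‖ := by
      rw [norm_smul, Real.norm_of_nonneg (hc0 x)]
      exact (mul_le_of_le_one_left (norm_nonneg _) (hc1 x)).trans (B.le_opNorm _)
    have h3 : ‖(c x - c y) • B y‖ ≤ ‖B‖ * (b / (b - a)) * ‖x - y‖ := by
      rw [norm_smul, Real.norm_eq_abs]
      rcases le_total b ‖y‖ with hy | hy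
      · rw [hcb y hy, hcb x (hy.trans hxy), sub_zero, abs_zero, zero_mul]
        positivity
      · have h4 : |c x - c y| ≤ ‖x - y‖ / (b - a) := (le_div_iff₀ hba).2 (hcl x y)
        calc |c x - c y| * ‖B y‖ ≤ ‖x - y‖ / (b - a) * (‖B‖ * b) := by
              refine mul_le_mul h4 ((B.le_opNorm y).trans ?_) (norm_nonneg _) (by positivity)
              exact mul_le_mul_of_nonneg_left hy (norm_nonneg _)
          _ = _ := by ring
    rw [h1]
    refine (norm_add_le _ _).trans ((add_le_add h2 h3).trans (le_of_eq ?_))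
    ring
  have hLip : ∀ x y, ‖c x • B x - c y • B y‖ ≤ ‖B‖ * (1 + b / (b - a)) * ‖x - y‖ := by
    intro x y
    rcases le_total ‖y‖ ‖x‖ with h | h
    · exact key x y h
    · rw [norm_sub_rev, norm_sub_rev x]
      exact key y x h
  have : CompleteSpace E := FiniteDimensional.complete ℝ E
  have hcc : Continuous c := by fun_prop
  obtain ⟨Φ, hΦ⟩ := exists_fiberHomeo (E := Unit) (f := fun z : Unit × E => c z.2 • B z.2)
    (by fun_prop) _ hB (fun _ v w => hLip v w)
  let γ : E ≃ₜ E := ((Homeomorph.punitProd E).symm.trans Φ).trans (Homeomorph.punitProd E)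
  have hγ : ∀ x, γ x = x + c x • B x := fun x => by
    change (Φ ((), x)).2 = _
    rw [hΦ]
  refine ⟨γ, fun x hx => ?_, fun x hx => ?_, fun x => ⟨fun hx => ?_, fun hx => ?_⟩⟩
  · rw [hγ, hca x hx, one_smul]
  · rw [hγ, hcb x hx, zero_smul, add_zero]
  · rw [hγ] at hx
    have hB1 : ‖B‖ < 1 := by
      refine lt_of_le_of_lt ?_ hB
      refine le_mul_of_one_le_right (norm_nonneg _) ?_
      have : 0 < b / (b - a) := by positivity
      linarith
    -- The value `c x` is frozen. The linear map `v ↦ v + c x • B v` is injective on `E` and maps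
    -- `ℓ` onto `ℓ`, so `γ x ∈ ℓ` forces `x ∈ ℓ`.
    have hest : ∀ v w : E, ‖c x • B v - c x • B w‖ ≤ ‖B‖ * ‖v - w‖ := by
      intro v w
      rw [← smul_sub, ← map_sub, norm_smul, Real.norm_of_nonneg (hc0 x)]
      exact (mul_le_of_le_one_left (norm_nonneg _) (hc1 x)).trans (B.le_opNorm _)
    have : CompleteSpace ℓ := FiniteDimensional.complete ℝ ℓ
    obtain ⟨y, hy⟩ := (bijective_add_of_lipschitz
      (fun v : ℓ => c x • (⟨B v, hℓ v v.2⟩ : ℓ)) ‖B‖ hB1 (fun v w => hest v w)).2 ⟨_, hx⟩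
    have hy' : (y : E) + c x • B y = x + c x • B x := congrArg Subtype.val hy
    have := (bijective_add_of_lipschitz (fun v : E => c x • B v) ‖B‖ hB1 hest).1 hy'
    rw [← this]
    exact y.2
  · rw [hγ]
    exact ℓ.add_mem hx (ℓ.smul_mem _ (hℓ x hx))

/-- Near the origin, the linear map `A` agrees with a homeomorphism that preserves `ℓ` and moves
only points near the origin. -/
def RealizableAlong (ℓ : Submodule ℝ E) (A : E →L[ℝ] E) : Prop :=
  ∀ r > 0, ∃ γ : E ≃ₜ E, (∀ x, r ≤ ‖x‖ → γ x = x) ∧ (∀ x, γ x ∈ ℓ ↔ x ∈ ℓ) ∧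
    ∀ᶠ x in 𝓝 0, γ x = A x

theorem RealizableAlong.mul {ℓ : Submodule ℝ E} {A B : E →L[ℝ] E} (hA : RealizableAlong ℓ A)
    (hB : RealizableAlong ℓ B) : RealizableAlong ℓ (A * B) := by
  intro r hr
  obtain ⟨γ, h1, h2, h3⟩ := hA r hr
  obtain ⟨η, k1, k2, k3⟩ := hB r hr
  refine ⟨η.trans γ, fun x hx => ?_, fun x => ?_, ?_⟩
  · simp [k1 x hx, h1 x hx]
  · simp [h2, k2]
  · have : Filter.Tendsto B (𝓝 0) (𝓝 0) := by simpa using B.continuous.tendsto 0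
    filter_upwards [k3, this.eventually h3] with x hx hx'
    simp [hx, hx']

/-- Cutting off between the radii `r / 2` and `r` multiplies the Lipschitz constant by `1 + 2 = 3`,
whence the bound `1 / 3`. -/
theorem realizableAlong_of_norm_lt {ℓ : Submodule ℝ E} {B : E →L[ℝ] E} (hB : ‖B‖ < 1 / 3)
    (hℓ : ∀ x ∈ ℓ, B x ∈ ℓ) : RealizableAlong ℓ (1 + B) := by
  intro r hr
  obtain ⟨γ, h1, h2, h3⟩ := exists_cutoff_linear B (a := r / 2) (b := r) (by linarith)
    (by linarith) (by rw [show r / (r - r / 2) = 2 by field_simp; ring]; linarith) ℓ hℓ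
  refine ⟨γ, h2, h3, ?_⟩
  filter_upwards [Metric.ball_mem_nhds (0 : E) (half_pos hr)] with x hx
  rw [h1 x (by simpa using (mem_ball_zero_iff.1 hx).le)]
  simp

/-- A linear map that is joined to the identity by a segment of invertible maps preserving `ℓ`. -/
theorem realizableAlong_of_segment {ℓ : Submodule ℝ E} {X : E →L[ℝ] E}
    (hX : ∀ t ∈ Set.Icc (0 : ℝ) 1, IsUnit (1 + t • X)) (hℓ : ∀ x ∈ ℓ, X x ∈ ℓ) :
    RealizableAlong ℓ (1 + X) := by
  have hc : ContinuousOn (fun t : ℝ => Ring.inverse (1 + t • X)) (Set.Icc 0 1) := by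
    intro t ht
    obtain ⟨u, hu⟩ := hX t ht
    have : CompleteSpace E := FiniteDimensional.complete ℝ E
    have h1 := NormedRing.inverse_continuousAt u
    rw [hu] at h1
    have h2 : ContinuousAt (fun t : ℝ => 1 + t • X) t := by fun_prop
    exact (ContinuousAt.comp_of_eq (g := Ring.inverse) (f := fun t : ℝ => 1 + t • X) h1 h2
      rfl).continuousWithinAt
  obtain ⟨C, hC⟩ := isCompact_Icc.exists_bound_of_continuousOn hc
  -- The segment is cut into `N` steps. As `C` bounds the inverses along it, consecutive maps differ
  -- by a factor `1 + B` with `‖B‖ < 1 / 3`.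
  obtain ⟨N, hN⟩ := exists_nat_gt (3 * (‖X‖ * C))
  have hC0 : 0 ≤ C := (norm_nonneg _).trans (hC 0 (by simp))
  have hN0 : (0 : ℝ) < N := lt_of_le_of_lt (by positivity) hN
  have hk : ∀ k : ℕ, k ≤ N → RealizableAlong ℓ (1 + ((k : ℝ) / N) • X) := by
    intro k
    induction k with
    | zero =>
      intro _
      simpa using realizableAlong_of_norm_lt (ℓ := ℓ) (B := 0) (by norm_num) (by simp)
    | succ k ih =>
      intro hkN
      have ht : (k : ℝ) / N ∈ Set.Icc (0 : ℝ) 1 :=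
        ⟨by positivity, (div_le_one hN0).2 (by exact_mod_cast (Nat.le_of_succ_le hkN))⟩
      set t : ℝ := (k : ℝ) / N with htdef
      set J := Ring.inverse (1 + t • X) with hJ
      have hJ1 : J * (1 + t • X) = 1 := Ring.inverse_mul_cancel _ (hX t ht)
      have hJ2 : (1 + t • X) * J = 1 := Ring.mul_inverse_cancel _ (hX t ht)
      have hsplit : (1 + (((k + 1 : ℕ) : ℝ) / N) • X) =
          (1 + ((1 / (N : ℝ)) • X) * J) * (1 + t • X) := by
        rw [add_mul, one_mul, mul_assoc, hJ1, mul_one, add_assoc, ← add_smul]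
        congr 2
        rw [htdef]
        push_cast
        ring
      -- An injective map of the finite-dimensional space `ℓ` into itself is onto, so the inverse
      -- preserves `ℓ` as well.
      have hJℓ : ∀ x ∈ ℓ, J x ∈ ℓ := by
        intro x hx
        let T : ℓ →ₗ[ℝ] ℓ := (((1 + t • X : E →L[ℝ] E) : E →ₗ[ℝ] E)).restrict
          (fun y hy => by simpa using ℓ.add_mem hy (ℓ.smul_mem t (hℓ y hy)))
        have hinj : Function.Injective T := by
          intro y z hyz
          have h1 : (1 + t • X : E →L[ℝ] E) (y : E) = (1 + t • X : E →L[ℝ] E) (z : E) :=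
            congrArg Subtype.val hyz
          have h2 := congrArg J h1
          rw [← mul_apply_eq_comp, ← mul_apply_eq_comp, hJ1] at h2
          exact Subtype.ext h2
        obtain ⟨y, hy⟩ := LinearMap.injective_iff_surjective.1 hinj ⟨x, hx⟩
        have h1 : (1 + t • X : E →L[ℝ] E) (y : E) = x := congrArg Subtype.val hy
        rw [← h1, ← mul_apply_eq_comp, hJ1]
        exact y.2
      rw [hsplit]
      refine RealizableAlong.mul (realizableAlong_of_norm_lt ?_ ?_) (ih (Nat.le_of_succ_le hkN))
      · refine lt_of_le_of_lt (norm_mul_le _ _) ?_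
        rw [norm_smul, Real.norm_of_nonneg (by positivity)]
        have := hC t ht
        calc 1 / (N : ℝ) * ‖X‖ * ‖J‖ ≤ 1 / (N : ℝ) * ‖X‖ * C := by gcongr
          _ = (‖X‖ * C) / N := by ring
          _ < 1 / 3 := by rw [div_lt_iff₀ hN0]; linarith
      · intro x hx
        simpa using ℓ.smul_mem _ (hℓ _ (hJℓ x hx))
  have := hk N le_rfl
  rwa [div_self hN0.ne', one_smul] at this

/-- The homothety with ratio `1 - ε`, cut off between `R₁` and `R₂`, is iterated: the support never
grows, while the ball of radius `R₁` shrinks geometrically. -/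
theorem exists_squeeze (ℓ : Submodule ℝ E) {R₁ R₂ η : ℝ} (h1 : 0 < R₁) (h12 : R₁ < R₂)
    (hη : 0 < η) :
    ∃ s : E ≃ₜ E, (∀ x, R₂ ≤ ‖x‖ → s x = x) ∧ (∀ x, ‖x‖ ≤ R₁ → ‖s x‖ < η) ∧
      ∀ x, s x ∈ ℓ ↔ x ∈ ℓ := by
  have hK : 0 < 1 + R₂ / (R₂ - R₁) := by
    have := sub_pos.2 h12
    have := h1.trans h12
    positivity
  obtain ⟨ε, hε0, hε⟩ : ∃ ε : ℝ, 0 < ε ∧ ε < min 1 (1 / (1 + R₂ / (R₂ - R₁))) :=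
    exists_between (by positivity)
  have hε1 : ε < 1 := hε.trans_le (min_le_left _ _)
  have hε2 : ε * (1 + R₂ / (R₂ - R₁)) < 1 := by
    have := hε.trans_le (min_le_right _ _)
    rwa [lt_div_iff₀ hK] at this
  obtain ⟨c, hc1, hc2, hc3⟩ := exists_cutoff_linear (-ε • (1 : E →L[ℝ] E)) h1 h12
    (by
      refine lt_of_le_of_lt ?_ hε2
      refine mul_le_mul_of_nonneg_right ?_ hK.le
      rw [norm_smul, norm_neg, Real.norm_of_nonneg hε0.le]
      exact mul_le_of_le_one_right hε0.le ContinuousLinearMap.norm_id_le) ℓ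
    (fun x hx => by simpa using ℓ.smul_mem ε hx)
  have hstep : ∀ x, ‖x‖ ≤ R₁ → ‖c x‖ = (1 - ε) * ‖x‖ := by
    intro x hx
    rw [hc1 x hx]
    have : x + (-ε • (1 : E →L[ℝ] E)) x = (1 - ε) • x := by
      rw [sub_smul, one_smul]
      simp [sub_eq_add_neg]
    rw [this, norm_smul, Real.norm_of_nonneg (by linarith)]
  have hiter : ∀ N : ℕ, ∃ s : E ≃ₜ E, (∀ x, R₂ ≤ ‖x‖ → s x = x) ∧
      (∀ x, ‖x‖ ≤ R₁ → ‖s x‖ ≤ (1 - ε) ^ N * ‖x‖) ∧ ∀ x, s x ∈ ℓ ↔ x ∈ ℓ := by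
    intro N
    induction N with
    | zero => exact ⟨Homeomorph.refl _, fun _ _ => rfl, fun x _ => by simp, fun _ => Iff.rfl⟩
    | succ N ih =>
      obtain ⟨s, hs1, hs2, hs3⟩ := ih
      refine ⟨c.trans s, fun x hx => ?_, fun x hx => ?_, fun x => ?_⟩
      · simp [hc2 x hx, hs1 x hx]
      · have h := hstep x hx
        have hle : ‖c x‖ ≤ R₁ := by
          rw [h]
          nlinarith [norm_nonneg x]
        refine (hs2 _ hle).trans ?_
        rw [h, pow_succ, mul_assoc]
      · simp [hs3, hc3]
  obtain ⟨N, hN⟩ := exists_pow_lt_of_lt_one (div_pos hη h1) (show 1 - ε < 1 by linarith)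
  obtain ⟨s, hs1, hs2, hs3⟩ := hiter N
  refine ⟨s, hs1, fun x hx => (hs2 x hx).trans_lt ?_, hs3⟩
  rw [lt_div_iff₀ h1] at hN
  refine lt_of_le_of_lt ?_ hN
  exact mul_le_mul_of_nonneg_left hx (pow_nonneg (by linarith) _)

theorem norm_lt_iff_of_eq_off {s : E ≃ₜ E} {R : ℝ} (hs : ∀ x, R ≤ ‖x‖ → s x = x) (x : E) :
    ‖s x‖ < R ↔ ‖x‖ < R := by
  constructor
  · intro h
    by_contra hx
    rw [hs x (not_lt.1 hx)] at h
    exact hx h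
  · intro h
    by_contra hx
    have := s.injective (hs (s x) (not_lt.1 hx))
    rw [this] at hx
    exact hx h

/-- In the chart `F`, the set `A` meets the ball of radius `R` in the line `ℓ` or not at all. -/
def MeetsInLine (ℓ : Submodule ℝ E) (F : E ≃ₜ Space) (R : ℝ) (A : Set Space) : Prop :=
  (∀ x, ‖x‖ < R → F x ∉ A) ∨ ∀ x, ‖x‖ < R → (F x ∈ A ↔ x ∈ ℓ)

theorem MeetsInLine.apply_mem_iff {ℓ : Submodule ℝ E} {F : E ≃ₜ Space} {R : ℝ} {A : Set Space}
    (h : MeetsInLine ℓ F R A) {s : E ≃ₜ E} (hs : ∀ x, R ≤ ‖x‖ → s x = x)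
    (hsℓ : ∀ x, s x ∈ ℓ ↔ x ∈ ℓ) (x : E) : F (s x) ∈ A ↔ F x ∈ A := by
  by_cases hx : ‖x‖ < R
  · have hx' := (norm_lt_iff_of_eq_off hs x).2 hx
    rcases h with h | h
    · simp [h x hx, h _ hx']
    · rw [h x hx, h _ hx', hsℓ]
  · rw [hs x (not_lt.1 hx)]

theorem MeetsInLine.mono {ℓ : Submodule ℝ E} {F : E ≃ₜ Space} {R R' : ℝ} {A : Set Space}
    (h : MeetsInLine ℓ F R A) (hR : R' ≤ R) : MeetsInLine ℓ F R' A :=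
  h.imp (fun h x hx => h x (hx.trans_le hR)) (fun h x hx => h x (hx.trans_le hR))

/-- The conjugate is the identity near the image of any point of norm greater than `R`. -/
theorem isotopicToId_conj [Nontrivial E] (F : E ≃ₜ Space) {s : E ≃ₜ E} {R : ℝ}
    (hs : ∀ x, R ≤ ‖x‖ → s x = x) : IsotopicToId (F.symm.trans (s.trans F)) := by
  obtain ⟨x₁, hx₁⟩ := NormedSpace.exists_lt_norm ℝ E R
  refine isotopicToId_of_eventually (x₀ := F x₁) ?_
  have h1 : Filter.Tendsto F.symm (𝓝 (F x₁)) (𝓝 x₁) := by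
    simpa using F.symm.continuous.tendsto (F x₁)
  filter_upwards [h1.eventually (continuous_norm.continuousAt.eventually (lt_mem_nhds hx₁))]
    with y hy
  simp [hs _ hy.le]

theorem image_eq_of_apply_mem_iff {X : Type*} [TopologicalSpace X] (f : X ≃ₜ X) {A : Set X}
    (h : ∀ x, f x ∈ A ↔ x ∈ A) : f '' A = A := by
  ext y
  constructor
  · rintro ⟨x, hx, rfl⟩
    exact (h x).2 hx
  · intro hy
    refine ⟨f.symm y, (h _).1 (by simpa using hy), by simp⟩

/-- If `G` carries the sets `P i` to the sets `P' i` and the germ of the chart `F` to that of the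
chart `F'`, then it can be changed so that it carries the unit ball of `F` to that of `F'`. -/
theorem exists_extend_germ [Nontrivial E] {ι : Type*} {P P' : ι → Set Space} {ℓ : Submodule ℝ E}
    {F F' : E ≃ₜ Space} {R : ℝ} (hR : 1 < R) (hF : ∀ i, MeetsInLine ℓ F R (P i))
    (hF' : ∀ i, MeetsInLine ℓ F' R (P' i)) {G : Space ≃ₜ Space} (hG : IsotopicToId G)
    (hGP : ∀ i, G '' P i = P' i) {A : E →L[ℝ] E} (hA : RealizableAlong ℓ A)
    (hgerm : ∀ᶠ x in 𝓝 0, G (F (A x)) = F' x) {r : ℝ} (hr : 0 < r) (hr1 : r ≤ 1) :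
    ∃ K : Space ≃ₜ Space, IsotopicToId K ∧ (∀ i, K '' P i = P' i) ∧
      ∃ R' > 1, ∀ x, r ≤ ‖x‖ → ‖x‖ < R' → K (F x) = F' x := by
  obtain ⟨γ, hγ1, hγ2, hγ3⟩ := hA r hr
  have hγR : ∀ x, R ≤ ‖x‖ → γ x = x := fun x hx => hγ1 x (by linarith)
  -- Within radius `η`, `γ` is the linear map `A` and `G` carries the corrected chart `F ∘ γ` to
  -- `F'`.
  obtain ⟨η, hη, hη'⟩ := Metric.eventually_nhds_iff_ball.1 (hγ3.and hgerm)
  obtain ⟨R₁, hR₁, hR₁R⟩ := exists_between hR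
  obtain ⟨s, hs1, hs2, hs3⟩ := exists_squeeze ℓ (zero_lt_one.trans hR₁) hR₁R hη
  let F₁ := γ.trans F
  have hF₁ : ∀ i, MeetsInLine ℓ F₁ R (P i) := by
    intro i
    rcases hF i with h | h
    · exact Or.inl fun x hx => h _ ((norm_lt_iff_of_eq_off hγR x).2 hx)
    · refine Or.inr fun x hx => ?_
      have := h _ ((norm_lt_iff_of_eq_off hγR x).2 hx)
      rw [hγ2] at this
      exact this
  have hs1' : ∀ x, R ≤ ‖x‖ → s.symm x = x := fun x hx => by
    rw [Homeomorph.symm_apply_eq, hs1 x hx]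
  have hs3' : ∀ x, s.symm x ∈ ℓ ↔ x ∈ ℓ := fun x => by
    rw [← hs3, Homeomorph.apply_symm_apply]
  let G₁ := F₁.symm.trans (s.trans F₁)
  let G₂ := F'.symm.trans (s.symm.trans F')
  have hG₁ : ∀ i, G₁ '' P i = P i := fun i => image_eq_of_apply_mem_iff _ fun y => by
    have := (hF₁ i).apply_mem_iff hs1 hs3 (F₁.symm y)
    rwa [Homeomorph.apply_symm_apply] at this
  have hG₂ : ∀ i, G₂ '' P' i = P' i := fun i => image_eq_of_apply_mem_iff _ fun y => by
    have := (hF' i).apply_mem_iff hs1' hs3' (F'.symm y)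
    rwa [Homeomorph.apply_symm_apply] at this
  -- Squeeze in the first chart, apply `G`, expand in the second chart. The squeezes keep all `P i`
  -- and `P' i`, as these meet the balls in `ℓ` or not at all. The result takes `F₁` to `F'`, and
  -- `F₁` differs from `F` only inside radius `r`, where `γ` acts.
  refine ⟨G₁.trans (G.trans G₂), ((isotopicToId_conj F₁ hs1).trans
    (hG.trans (isotopicToId_conj F' hs1'))), fun i => ?_, R₁, hR₁, fun x hx hx' => ?_⟩
  · have : ⇑(G₁.trans (G.trans G₂)) = G₂ ∘ G ∘ G₁ := rfl
    rw [this, Set.image_comp, Set.image_comp, hG₁, hGP, hG₂]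
  · have h1 : F x = F₁ x := by simp [F₁, hγ1 x hx]
    have h2 : G₁ (F₁ x) = F₁ (s x) := by simp [G₁]
    have h3 : G (F₁ (s x)) = F' (s x) := by
      obtain ⟨h4, h5⟩ := hη' (s x) (mem_ball_zero_iff.2 (hs2 x hx'.le))
      simp only [F₁, Homeomorph.trans_apply]
      rw [h4, h5]
    rw [Homeomorph.trans_apply, Homeomorph.trans_apply, h1, h2, h3]
    simp [G₂]

end Squeeze

/-! ### The trefoil -/

/-- The trefoil of size `1` at the origin. -/
noncomputable def baseTrefoil : Set Space := closedPolygon trefoilVertex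

theorem trefoil_eq_image_sim (p d : ℂ) (δ : ℝ) (hd : d ≠ 0) (hδ : δ ≠ 0) :
    trefoil p d δ = sim p d δ hd hδ '' baseTrefoil := by
  have h : ∀ a b : ℝ, a + b = 1 → ∀ x y : Space, sim p d δ hd hδ (a • x + b • y) =
      a • sim p d δ hd hδ x + b • sim p d δ hd hδ y := by
    intro a b hab x y
    have hab' : (a : ℂ) + b = 1 := by exact_mod_cast hab
    ext1
    · simp only [sim_apply, Prod.fst_add, Prod.smul_fst, Complex.real_smul]
      linear_combination (-p) * hab'
    · simp only [sim_apply, Prod.snd_add, Prod.smul_snd, smul_eq_mul]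
      ring
  unfold trefoil baseTrefoil closedPolygon
  rw [Set.image_iUnion]
  refine Set.iUnion_congr fun i => ?_
  ext y
  constructor
  · rintro ⟨a, b, ha, hb, hab, rfl⟩
    exact ⟨_, ⟨a, b, ha, hb, hab, rfl⟩, h a b hab _ _⟩
  · rintro ⟨_, ⟨a, b, ha, hb, hab, rfl⟩, rfl⟩
    exact ⟨a, b, ha, hb, hab, (h a b hab _ _).symm⟩

theorem mem_segment_space {P Q x : Space} : x ∈ segment ℝ P Q ↔ ∃ t : ℝ, 0 ≤ t ∧ t ≤ 1 ∧
    x.1.re = P.1.re + t * (Q.1.re - P.1.re) ∧ x.1.im = P.1.im + t * (Q.1.im - P.1.im) ∧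
    x.2 = P.2 + t * (Q.2 - P.2) := by
  constructor
  · rintro ⟨a, b, ha, hb, hab, rfl⟩
    obtain rfl : a = 1 - b := by linarith
    refine ⟨b, hb, by linarith, ?_, ?_, ?_⟩ <;> simp <;> ring
  · rintro ⟨t, h0, h1, h2, h3, h4⟩
    refine ⟨1 - t, t, by linarith, h0, by ring, ?_⟩
    ext1
    · apply Complex.ext
      · simp [h2]; ring
      · simp [h3]; ring
    · simp [h4]; ring

theorem mem_baseTrefoil {x : Space} : x ∈ baseTrefoil ↔ ∃ t : ℝ, 0 ≤ t ∧ t ≤ 1 ∧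
    ((x.1.re = 2 ∧ x.1.im = -2 + 4 * t ∧ x.2 = 0) ∨
     (x.1.re = 2 - 4 * t ∧ x.1.im = 2 ∧ x.2 = 0) ∨
     (x.1.re = -2 - 2 * t ∧ x.1.im = 2 - 4 * t ∧ x.2 = -t) ∨
     (x.1.re = -4 + 3 * t ∧ x.1.im = -2 - t ∧ x.2 = -1 + 2 * t) ∨
     (x.1.re = -1 ∧ x.1.im = -3 + 6 * t ∧ x.2 = 1 - 2 * t) ∨
     (x.1.re = -1 - 3 * t ∧ x.1.im = 3 - t ∧ x.2 = -1 + 2 * t) ∨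
     (x.1.re = -4 + 2 * t ∧ x.1.im = 2 - 4 * t ∧ x.2 = 1 - t) ∨
     (x.1.re = -2 + 4 * t ∧ x.1.im = -2 ∧ x.2 = 0)) := by
  unfold baseTrefoil closedPolygon
  simp only [Set.mem_iUnion, mem_segment_space]
  constructor
  · rintro ⟨i, t, h0, h1, h2, h3, h4⟩
    refine ⟨t, h0, h1, ?_⟩
    fin_cases i <;> simp [trefoilVertex] at h2 h3 h4
    · refine Or.inl ⟨?_, ?_, ?_⟩ <;> linarith
    · refine Or.inr (Or.inl ⟨?_, ?_, ?_⟩) <;> linarith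
    · refine Or.inr (Or.inr (Or.inl ⟨?_, ?_, ?_⟩)) <;> linarith
    · refine Or.inr (Or.inr (Or.inr (Or.inl ⟨?_, ?_, ?_⟩))) <;> linarith
    · refine Or.inr (Or.inr (Or.inr (Or.inr (Or.inl ⟨?_, ?_, ?_⟩)))) <;> linarith
    · refine Or.inr (Or.inr (Or.inr (Or.inr (Or.inr (Or.inl ⟨?_, ?_, ?_⟩))))) <;> linarith
    · refine Or.inr (Or.inr (Or.inr (Or.inr (Or.inr (Or.inr (Or.inl ⟨?_, ?_, ?_⟩)))))) <;> linarith
    · refine Or.inr (Or.inr (Or.inr (Or.inr (Or.inr (Or.inr (Or.inr ⟨?_, ?_, ?_⟩)))))) <;> linarith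
  · rintro ⟨t, h0, h1, h⟩
    rcases h with h | h | h | h | h | h | h | h <;> obtain ⟨h2, h3, h4⟩ := h
    · refine ⟨0, t, h0, h1, ?_⟩
      simp [trefoilVertex, h2, h3, h4]; ring
    · refine ⟨1, t, h0, h1, ?_⟩
      simp [trefoilVertex, h2, h3, h4]; ring
    · refine ⟨2, t, h0, h1, ?_⟩
      simp [trefoilVertex, h2, h3, h4]; ring_nf; simp
    · refine ⟨3, t, h0, h1, ?_⟩
      simp [trefoilVertex, h2, h3, h4]; ring_nf; simp
    · refine ⟨4, t, h0, h1, ?_⟩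
      simp [trefoilVertex, h2, h3, h4]; ring_nf; simp
    · refine ⟨5, t, h0, h1, ?_⟩
      simp [trefoilVertex, h2, h3, h4]; ring_nf; simp
    · refine ⟨6, t, h0, h1, ?_⟩
      simp [trefoilVertex, h2, h3, h4]; ring_nf; simp
    · refine ⟨7, t, h0, h1, ?_⟩
      simp [trefoilVertex, h2, h3, h4]; ring_nf

/-- The knotted part, left of real part `-1`, is separated from the flat remainder of the lobe at
height `0`; only the former needs to be thinned. -/
theorem baseTrefoil_cases {x : Space} (hx : x ∈ baseTrefoil) :
    (-4 ≤ x.1.re ∧ x.1.re ≤ -1 ∧ |x.1.im| ≤ 3 ∧ |x.2| ≤ 1) ∨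
      (-1 ≤ x.1.re ∧ x.1.re ≤ 2 ∧ |x.1.im| ≤ 2 ∧ (|x.1.im| = 2 ∨ x.1.re = 2) ∧ x.2 = 0) := by
  obtain ⟨t, h0, h1, h⟩ := mem_baseTrefoil.1 hx
  rcases h with ⟨h2, h3, h4⟩ | ⟨h2, h3, h4⟩ | h | h | h | h | h | ⟨h2, h3, h4⟩
  · refine Or.inr ⟨by linarith, by linarith, abs_le.2 ⟨by linarith, by linarith⟩, Or.inr h2, h4⟩
  · rcases le_total x.1.re (-1) with h | h
    · refine Or.inl ⟨by linarith, h, ?_, ?_⟩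
      · rw [h3]; norm_num
      · rw [h4]; norm_num
    · refine Or.inr ⟨h, by linarith, ?_, Or.inl ?_, h4⟩ <;> rw [h3] <;> norm_num
  · exact Or.inl ⟨by linarith, by linarith, abs_le.2 ⟨by linarith, by linarith⟩,
      abs_le.2 ⟨by linarith, by linarith⟩⟩
  · exact Or.inl ⟨by linarith, by linarith, abs_le.2 ⟨by linarith, by linarith⟩,
      abs_le.2 ⟨by linarith, by linarith⟩⟩
  · exact Or.inl ⟨by linarith, by linarith, abs_le.2 ⟨by linarith, by linarith⟩,
      abs_le.2 ⟨by linarith, by linarith⟩⟩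
  · exact Or.inl ⟨by linarith, by linarith, abs_le.2 ⟨by linarith, by linarith⟩,
      abs_le.2 ⟨by linarith, by linarith⟩⟩
  · exact Or.inl ⟨by linarith, by linarith, abs_le.2 ⟨by linarith, by linarith⟩,
      abs_le.2 ⟨by linarith, by linarith⟩⟩
  · rcases le_total x.1.re (-1) with h | h
    · refine Or.inl ⟨by linarith, h, ?_, ?_⟩
      · rw [h3]; norm_num
      · rw [h4]; norm_num
    · refine Or.inr ⟨h, by linarith, ?_, Or.inl ?_, h4⟩ <;> rw [h3] <;> norm_num

theorem right_side_mem_baseTrefoil {y : ℝ} (hy : |y| ≤ 2) :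
    ((⟨2, y⟩, 0) : Space) ∈ baseTrefoil := by
  obtain ⟨h1, h2⟩ := abs_le.1 hy
  exact mem_baseTrefoil.2 ⟨(y + 2) / 4, by linarith, by linarith,
    Or.inl ⟨rfl, by simp only []; ring, rfl⟩⟩

/-- The half turn about the real axis of the plane. -/
noncomputable def halfTurn : Space ≃ₜ Space where
  toFun x := ((starRingEnd ℂ) x.1, -x.2)
  invFun x := ((starRingEnd ℂ) x.1, -x.2)
  left_inv x := by simp
  right_inv x := by simp
  continuous_toFun := by fun_prop
  continuous_invFun := by fun_prop

@[simp] theorem halfTurn_apply (x : Space) : halfTurn x = ((starRingEnd ℂ) x.1, -x.2) := rfl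

/-- The half turn reverses the polygon: side `i` goes to side `-i` modulo `8`, with `t` replaced by
`1 - t`. This symmetry absorbs the signs of the clasps. -/
theorem halfTurn_mem_baseTrefoil {x : Space} (hx : x ∈ baseTrefoil) :
    halfTurn x ∈ baseTrefoil := by
  obtain ⟨t, h0, h1, h⟩ := mem_baseTrefoil.1 hx
  refine mem_baseTrefoil.2 ⟨1 - t, by linarith, by linarith, ?_⟩
  simp only [halfTurn_apply, Complex.conj_re, Complex.conj_im]
  rcases h with ⟨h2, h3, h4⟩ | ⟨h2, h3, h4⟩ | ⟨h2, h3, h4⟩ | ⟨h2, h3, h4⟩ | ⟨h2, h3, h4⟩ |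
    ⟨h2, h3, h4⟩ | ⟨h2, h3, h4⟩ | ⟨h2, h3, h4⟩ <;> rw [h2, h3, h4]
  · exact Or.inl ⟨by ring, by ring, by ring⟩
  · iterate 7 right
    exact ⟨by ring, by ring, by ring⟩
  · iterate 6 right
    exact Or.inl ⟨by ring, by ring, by ring⟩
  · iterate 5 right
    exact Or.inl ⟨by ring, by ring, by ring⟩
  · iterate 4 right
    exact Or.inl ⟨by ring, by ring, by ring⟩
  · iterate 3 right
    exact Or.inl ⟨by ring, by ring, by ring⟩
  · iterate 2 right
    exact Or.inl ⟨by ring, by ring, by ring⟩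
  · right
    exact Or.inl ⟨by ring, by ring, by ring⟩

theorem isCompact_baseTrefoil : IsCompact baseTrefoil := by
  unfold baseTrefoil closedPolygon
  refine isCompact_iUnion fun i => ?_
  rw [← convexHull_pair (𝕜 := ℝ)]
  exact (Set.toFinite _).isCompact_convexHull ℝ

/-- What remains is an arc made of half a side, seven sides and the other half side, each meeting
the next. The removed point is the place where an unknot will clasp the trefoil. -/
theorem isPreconnected_baseTrefoil_diff :
    IsPreconnected (baseTrefoil \ {((2, 0) : Space)}) := by
  let Q := trefoilVertex
  let A : Set Space := {x | x.1.re = 2 ∧ 0 < x.1.im ∧ x.1.im ≤ 2 ∧ x.2 = 0}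
  let B : Set Space := {x | x.1.re = 2 ∧ -2 ≤ x.1.im ∧ x.1.im < 0 ∧ x.2 = 0}
  have hA : IsPreconnected A := by
    refine Convex.isPreconnected ?_
    rintro x ⟨h1, h2, h3, h4⟩ y ⟨k1, k2, k3, k4⟩ a b ha hb hab
    refine ⟨?_, ?_, ?_, ?_⟩ <;> simp [h1, h4, k1, k4]
    · linarith
    · rcases ha.eq_or_lt with rfl | ha
      · obtain rfl : b = 1 := by linarith
        simpa using k2
      · have := mul_pos ha h2
        have := mul_nonneg hb k2.le
        linarith
    · nlinarith
  have hB : IsPreconnected B := by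
    refine Convex.isPreconnected ?_
    rintro x ⟨h1, h2, h3, h4⟩ y ⟨k1, k2, k3, k4⟩ a b ha hb hab
    refine ⟨?_, ?_, ?_, ?_⟩ <;> simp [h1, h4, k1, k4]
    · linarith
    · nlinarith
    · rcases ha.eq_or_lt with rfl | ha
      · obtain rfl : b = 1 := by linarith
        simpa using k3
      · have := mul_pos_of_neg_of_neg (neg_lt_zero.2 ha) h3
        have := mul_nonneg hb (neg_nonneg.2 k3.le)
        linarith
  have hs : ∀ i, IsPreconnected (segment ℝ (Q i) (Q (i + 1))) := fun i =>
    (convex_segment _ _).isPreconnected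
  have h1 := hA.union (Q 1) (by simp [A, Q, trefoilVertex]) (left_mem_segment ℝ _ _) (hs 1)
  have h2 := h1.union (Q 2) (Or.inr (right_mem_segment ℝ _ _)) (left_mem_segment ℝ _ _) (hs 2)
  have h3 := h2.union (Q 3) (Or.inr (right_mem_segment ℝ _ _)) (left_mem_segment ℝ _ _) (hs 3)
  have h4 := h3.union (Q 4) (Or.inr (right_mem_segment ℝ _ _)) (left_mem_segment ℝ _ _) (hs 4)
  have h5 := h4.union (Q 5) (Or.inr (right_mem_segment ℝ _ _)) (left_mem_segment ℝ _ _) (hs 5)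
  have h6 := h5.union (Q 6) (Or.inr (right_mem_segment ℝ _ _)) (left_mem_segment ℝ _ _) (hs 6)
  have h7 := h6.union (Q 7) (Or.inr (right_mem_segment ℝ _ _)) (left_mem_segment ℝ _ _) (hs 7)
  have h8 := h7.union (Q 0) (Or.inr (right_mem_segment ℝ _ _))
    (by simp [B, Q, trefoilVertex]) hB
  convert h8 using 1
  have hx2 : ∀ x : Space, x ≠ (2, 0) ↔ ¬(x.1.re = 2 ∧ x.1.im = 0 ∧ x.2 = 0) := by
    intro x
    rw [ne_eq, Prod.ext_iff, Complex.ext_iff]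
    simp [and_assoc]
  have hseg : ∀ i : Fin 8, i ≠ 0 → ∀ x ∈ segment ℝ (Q i) (Q (i + 1)),
      x ∈ baseTrefoil ∧ x ≠ (2, 0) := by
    intro i hi x hx
    refine ⟨Set.mem_iUnion.2 ⟨i, hx⟩, ?_⟩
    rw [hx2]
    rintro ⟨k1, k2, k3⟩
    obtain ⟨t, t0, t1, m1, m2, m3⟩ := mem_segment_space.1 hx
    fin_cases i <;> simp [Q, trefoilVertex] at m1 m2 m3 hi <;> linarith
  ext x
  constructor
  · rintro ⟨hx, hne⟩
    obtain ⟨i, hi⟩ := Set.mem_iUnion.1 hx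
    fin_cases i
    · obtain ⟨t, t0, t1, m1, m2, m3⟩ := mem_segment_space.1 hi
      have hne' := (hx2 x).1 hne
      simp [trefoilVertex] at m1 m2 m3
      rcases lt_trichotomy x.1.im 0 with h | h | h
      · exact Or.inr ⟨m1, by linarith, h, m3⟩
      · exact absurd ⟨m1, h, m3⟩ hne'
      · iterate 8 left
        exact ⟨m1, h, by linarith, m3⟩
    · iterate 7 left
      right; exact hi
    · iterate 6 left
      right; exact hi
    · iterate 5 left
      right; exact hi
    · iterate 4 left
      right; exact hi
    · iterate 3 left
      right; exact hi
    · iterate 2 left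
      right; exact hi
    · left
      right; exact hi
  · rintro ((((((((h | h) | h) | h) | h) | h) | h) | h) | h)
    · obtain ⟨m1, m2, m3, m4⟩ := h
      refine ⟨?_, (hx2 x).2 fun h => by linarith [h.2.1]⟩
      have : x = (⟨2, x.1.im⟩, 0) := by
        ext1
        · exact Complex.ext m1 rfl
        · exact m4
      rw [this]
      exact right_side_mem_baseTrefoil (abs_le.2 ⟨by linarith, m3⟩)
    · exact hseg 1 (by decide) x h
    · exact hseg 2 (by decide) x h
    · exact hseg 3 (by decide) x h
    · exact hseg 4 (by decide) x h
    · exact hseg 5 (by decide) x h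
    · exact hseg 6 (by decide) x h
    · exact hseg 7 (by decide) x h
    · obtain ⟨m1, m2, m3, m4⟩ := h
      refine ⟨?_, (hx2 x).2 fun h => by linarith [h.2.1]⟩
      have : x = (⟨2, x.1.im⟩, 0) := by
        ext1
        · exact Complex.ext m1 rfl
        · exact m4
      rw [this]
      exact right_side_mem_baseTrefoil (abs_le.2 ⟨m2, by linarith⟩)

/-! ### Making the knotted part of the trefoil thin -/

/-- A cutoff function supported to the left of the lobe of the trefoil. -/
noncomputable def leftBump (w : ℂ) : ℝ :=
  max 0 (min 1 (min ((-1 / 4 - w.re) * (4 / 3)) (w.re + 5))) * max 0 (min 1 (4 - |w.im|))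

theorem leftBump_nonneg (w : ℂ) : 0 ≤ leftBump w :=
  mul_nonneg (le_max_left _ _) (le_max_left _ _)

theorem clamp_le_one (s : ℝ) : max 0 (min 1 s) ≤ 1 := max_le zero_le_one (min_le_left _ _)

theorem clamp_eq_one {s : ℝ} (hs : 1 ≤ s) : max 0 (min 1 s) = 1 := by simp [min_eq_left hs]

theorem clamp_eq_zero {s : ℝ} (hs : s ≤ 0) : max 0 (min 1 s) = 0 :=
  max_eq_left ((min_le_right _ _).trans hs)

theorem leftBump_le_one (w : ℂ) : leftBump w ≤ 1 :=
  mul_le_one₀ (clamp_le_one _) (le_max_left _ _) (clamp_le_one _)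

theorem continuous_leftBump : Continuous leftBump := by
  unfold leftBump
  fun_prop

theorem abs_leftBump_sub_le (v w : ℂ) : |leftBump v - leftBump w| ≤ 7 / 3 * ‖v - w‖ := by
  unfold leftBump
  set a := max 0 (min 1 (min ((-1 / 4 - v.re) * (4 / 3)) (v.re + 5)))
  set a' := max 0 (min 1 (min ((-1 / 4 - w.re) * (4 / 3)) (w.re + 5)))
  set b := max 0 (min 1 (4 - |v.im|))
  set b' := max 0 (min 1 (4 - |w.im|))
  have hre : |v.re - w.re| ≤ ‖v - w‖ := by simpa using Complex.abs_re_le_norm (v - w)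
  have him : |v.im - w.im| ≤ ‖v - w‖ := by simpa using Complex.abs_im_le_norm (v - w)
  have ha : |a - a'| ≤ 4 / 3 * ‖v - w‖ := by
    refine (abs_clamp_sub_le _ _).trans ((abs_min_sub_min_le_max _ _ _ _).trans (max_le ?_ ?_))
    · rw [← sub_mul, abs_mul, show -1 / 4 - v.re - (-1 / 4 - w.re) = -(v.re - w.re) by ring,
        abs_neg, abs_of_pos (by norm_num : (0 : ℝ) < 4 / 3)]
      linarith
    · rw [show v.re + 5 - (w.re + 5) = v.re - w.re by ring]
      linarith [norm_nonneg (v - w)]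
  have hb : |b - b'| ≤ ‖v - w‖ := by
    refine (abs_clamp_sub_le _ _).trans ?_
    rw [show 4 - |v.im| - (4 - |w.im|) = -(|v.im| - |w.im|) by ring, abs_neg]
    exact (abs_abs_sub_abs_le _ _).trans him
  have h0 : |a'| ≤ 1 := by
    rw [abs_of_nonneg (le_max_left _ _)]; exact clamp_le_one _
  have h1 : |b| ≤ 1 := by
    rw [abs_of_nonneg (le_max_left _ _)]; exact clamp_le_one _
  calc |a * b - a' * b'| = |(a - a') * b + a' * (b - b')| := by ring_nf
    _ ≤ |a - a'| * |b| + |a'| * |b - b'| := by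
        rw [← abs_mul, ← abs_mul]; exact abs_add_le _ _
    _ ≤ |a - a'| * 1 + 1 * |b - b'| := by gcongr
    _ ≤ _ := by linarith

theorem leftBump_eq_zero {w : ℂ} (h : 7 ≤ ‖w‖ ∨ -1 / 4 ≤ w.re) : leftBump w = 0 := by
  unfold leftBump
  by_cases h1 : -1 / 4 ≤ w.re
  · rw [clamp_eq_zero, zero_mul]
    exact (min_le_left _ _).trans (by linarith)
  by_cases h2 : w.re + 5 ≤ 0
  · rw [clamp_eq_zero, zero_mul]
    exact (min_le_right _ _).trans h2
  by_cases h3 : 4 ≤ |w.im|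
  · rw [clamp_eq_zero (s := 4 - |w.im|) (by linarith), mul_zero]
  exfalso
  have h7 := h.resolve_right h1
  push Not at h1 h2 h3
  have h4 : ‖w‖ ^ 2 = w.re ^ 2 + w.im ^ 2 := by
    rw [← Complex.normSq_eq_norm_sq, Complex.normSq_apply]; ring
  have h5 : w.im ^ 2 ≤ 16 := by
    rw [← sq_abs]; nlinarith [abs_nonneg w.im]
  nlinarith

theorem leftBump_eq_one {w : ℂ} (h1 : -4 ≤ w.re) (h2 : w.re ≤ -1) (h3 : |w.im| ≤ 3) :
    leftBump w = 1 := by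
  unfold leftBump
  rw [clamp_eq_one, clamp_eq_one, one_mul]
  · linarith
  · exact le_min (by linarith) (by linarith)

/-- A homeomorphism of space that makes the knotted part of the trefoil thin. -/
theorem exists_thinning : ∃ Φ : Space ≃ₜ Space, ∀ x : Space,
    Φ x = (x.1 - ((leftBump x.1 / 5 : ℝ) : ℂ), x.2 - 9 / 10 * leftBump x.1 * x.2) := by
  obtain ⟨Φ₁, h₁⟩ := exists_fiberHomeo (E := ℂ) (F := ℝ)
    (f := fun x => -(9 / 10 * leftBump x.1 * x.2))
    (by have := continuous_leftBump; fun_prop) (9 / 10) (by norm_num) (fun x v w => by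
      rw [show -(9 / 10 * leftBump x * v) - -(9 / 10 * leftBump x * w) =
        -(9 / 10 * leftBump x * (v - w)) by ring, norm_neg, norm_mul, norm_mul,
        Real.norm_of_nonneg (leftBump_nonneg x)]
      have := leftBump_le_one x
      have h0 := norm_nonneg (v - w)
      have := mul_le_mul_of_nonneg_right this h0
      norm_num
      norm_num at this
      linarith)
  -- The contraction constant `7 / 15` is the Lipschitz constant `7 / 3` of `leftBump` times the
  -- shift `1 / 5`.
  obtain ⟨Φ₂, h₂⟩ := exists_fiberHomeo (E := ℝ) (F := ℂ)
    (f := fun x => -((leftBump x.2 / 5 : ℝ) : ℂ))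
    (by have := continuous_leftBump; fun_prop) (7 / 15) (by norm_num) (fun x v w => by
      rw [← Complex.ofReal_neg, ← Complex.ofReal_neg, ← Complex.ofReal_sub, Complex.norm_real,
        Real.norm_eq_abs, show -(leftBump v / 5) - -(leftBump w / 5) =
          -((leftBump v - leftBump w) / 5) by ring, abs_neg, abs_div,
          abs_of_pos (by norm_num : (0 : ℝ) < 5)]
      have := abs_leftBump_sub_le v w
      linarith)
  refine ⟨Φ₁.trans ((Homeomorph.prodComm ℂ ℝ).trans (Φ₂.trans (Homeomorph.prodComm ℝ ℂ))),
    fun x => ?_⟩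
  change ((Φ₂ ((Φ₁ x).2, (Φ₁ x).1)).2, (Φ₂ ((Φ₁ x).2, (Φ₁ x).1)).1) = _
  rw [h₂, h₁]
  ext1
  · simp [sub_eq_add_neg]
  · simp [sub_eq_add_neg]

/-- The thinning homeomorphism. -/
noncomputable def thinning : Space ≃ₜ Space := exists_thinning.choose

theorem thinning_apply (x : Space) :
    thinning x = (x.1 - ((leftBump x.1 / 5 : ℝ) : ℂ), x.2 - 9 / 10 * leftBump x.1 * x.2) :=
  exists_thinning.choose_spec x

theorem thinning_eq_self {x : Space} (h : 7 ≤ ‖x.1‖ ∨ -1 / 4 ≤ x.1.re) : thinning x = x := by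
  rw [thinning_apply, leftBump_eq_zero h]
  simp

theorem thinning_symm_eq_self {x : Space} (h : 7 ≤ ‖x.1‖ ∨ -1 / 4 ≤ x.1.re) :
    thinning.symm x = x := by
  rw [Homeomorph.symm_apply_eq, thinning_eq_self h]

/-- The trefoil with thin knotted part. -/
noncomputable def thinTrefoil : Set Space := thinning '' baseTrefoil

theorem norm_sq_eq_re_im (w : ℂ) : ‖w‖ ^ 2 = w.re ^ 2 + w.im ^ 2 := by
  rw [← Complex.normSq_eq_norm_sq, Complex.normSq_apply]
  ring

theorem thinTrefoil_cases {x : Space} (hx : x ∈ thinTrefoil) :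
    (x.1.re ≤ -6 / 5 ∧ ‖x.1‖ ≤ 11 / 2 ∧ |x.2| ≤ 1 / 10) ∨
      (2 ≤ ‖x.1‖ ∧ ‖x.1‖ ≤ 11 / 2 ∧ x.2 = 0 ∧ (|x.1.im| = 2 ∨ x.1.re = 2)) := by
  obtain ⟨y, hy, rfl⟩ := hx
  rw [thinning_apply]
  have hb0 := leftBump_nonneg y.1
  have hb1 := leftBump_le_one y.1
  rcases baseTrefoil_cases hy with ⟨h1, h2, h3, h4⟩ | ⟨h1, h2, h3, h4, h5⟩
  · left
    rw [leftBump_eq_one h1 h2 h3]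
    obtain ⟨h5, h6⟩ := abs_le.1 h3
    refine ⟨?_, ?_, ?_⟩
    · simp only [Complex.sub_re, Complex.ofReal_re]
      linarith
    · refine abs_le_of_sq_le_sq' ?_ (by norm_num) |>.2
      rw [norm_sq_eq_re_im]
      simp only [Complex.sub_re, Complex.ofReal_re, Complex.sub_im, Complex.ofReal_im]
      nlinarith
    · rw [show y.2 - 9 / 10 * 1 * y.2 = y.2 / 10 by ring, abs_div,
        abs_of_pos (by norm_num : (0 : ℝ) < 10)]
      linarith
  · right
    have him : (y.1 - ((leftBump y.1 / 5 : ℝ) : ℂ)).im = y.1.im := by simp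
    have hre : (y.1 - ((leftBump y.1 / 5 : ℝ) : ℂ)).re = y.1.re - leftBump y.1 / 5 := by simp
    have h6 : y.1.re = 2 → leftBump y.1 = 0 := fun h => leftBump_eq_zero (Or.inr (by linarith))
    refine ⟨?_, ?_, ?_, ?_⟩
    · rcases h4 with h4 | h4
      · refine le_trans (le_of_eq ?_) (Complex.abs_im_le_norm _)
        rw [him, h4]
      · refine le_trans ?_ (Complex.re_le_norm _)
        rw [hre, h6 h4, h4]
        norm_num
    · refine (Complex.norm_le_abs_re_add_abs_im _).trans ?_
      rw [him, hre]
      have : |y.1.re - leftBump y.1 / 5| ≤ 11 / 5 := abs_le.2 ⟨by linarith, by linarith⟩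
      linarith
    · simp [h5]
    · rcases h4 with h4 | h4
      · left; rw [him, h4]
      · right; rw [hre, h6 h4, h4]; norm_num

/-- These bounds place the thin trefoil in the ring that `twist` fixes. The shift by `1 / 5` pushes
the knotted part from real part at most `-1` beyond radius `6 / 5`, and its heights are divided by
`10`. -/
theorem thinTrefoil_norm_bounds {x : Space} (hx : x ∈ thinTrefoil) :
    6 / 5 ≤ ‖x.1‖ ∧ ‖x.1‖ ≤ 11 / 2 ∧ |x.2| ≤ 1 / 10 := by
  rcases thinTrefoil_cases hx with ⟨h1, h2, h3⟩ | ⟨h1, h2, h3, -⟩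
  · refine ⟨?_, h2, h3⟩
    refine le_trans ?_ (Complex.abs_re_le_norm _)
    rw [abs_of_neg (by linarith)]
    linarith
  · refine ⟨by linarith, h2, ?_⟩
    rw [h3]; norm_num

theorem mem_thinTrefoil_iff_of_right {x : Space} (h0 : -1 / 4 ≤ x.1.re) (h1 : |x.1.im| < 2) :
    x ∈ thinTrefoil ↔ x.1.re = 2 ∧ x.2 = 0 := by
  constructor
  · intro hx
    rcases thinTrefoil_cases hx with ⟨h2, -⟩ | ⟨-, -, h3, h4⟩
    · linarith
    · exact ⟨h4.resolve_left h1.ne, h3⟩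
  · rintro ⟨h2, h3⟩
    refine ⟨x, ?_, thinning_eq_self (Or.inr h0)⟩
    have : x = ((⟨2, x.1.im⟩, 0) : Space) := by
      ext1
      · exact Complex.ext h2 rfl
      · exact h3
    rw [this]
    exact right_side_mem_baseTrefoil h1.le

theorem halfTurn_mem_thinTrefoil_iff {x : Space} : halfTurn x ∈ thinTrefoil ↔ x ∈ thinTrefoil := by
  have h : ∀ x ∈ thinTrefoil, halfTurn x ∈ thinTrefoil := by
    rintro _ ⟨y, hy, rfl⟩
    refine ⟨halfTurn y, halfTurn_mem_baseTrefoil hy, ?_⟩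
    have hb : leftBump ((starRingEnd ℂ) y.1) = leftBump y.1 := by simp [leftBump]
    rw [thinning_apply, thinning_apply, halfTurn_apply, halfTurn_apply]
    simp only [hb, map_sub, Complex.conj_ofReal]
    ext1
    · rfl
    · simp only []
      ring
  refine ⟨fun hx => ?_, h x⟩
  have := h _ hx
  simpa using this

/-! ### Rotation around a fixed ring, and the chart at a vertex. -/

/-- Radial and vertical cutoff, equal to `1` on a ring that contains the thin trefoil. -/
noncomputable def ringCutoff (r z : ℝ) : ℝ :=
  max 0 (min 1 (min ((r - 11 / 10) * 10) (13 / 2 - r))) * max 0 (min 1 (2 - 10 * |z|))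

theorem ringCutoff_eq_one {r z : ℝ} (h1 : 6 / 5 ≤ r) (h2 : r ≤ 11 / 2) (h3 : |z| ≤ 1 / 10) :
    ringCutoff r z = 1 := by
  unfold ringCutoff
  rw [clamp_eq_one, clamp_eq_one, one_mul]
  · linarith
  · exact le_min (by linarith) (by linarith)

theorem ringCutoff_eq_zero {r z : ℝ} (h : r ≤ 11 / 10 ∨ 7 ≤ r ∨ 1 / 5 ≤ |z|) :
    ringCutoff r z = 0 := by
  unfold ringCutoff
  rcases h with h | h | h
  · rw [clamp_eq_zero, zero_mul]
    exact (min_le_left _ _).trans (by linarith)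
  · rw [clamp_eq_zero, zero_mul]
    exact (min_le_right _ _).trans (by linarith)
  · rw [clamp_eq_zero (s := 2 - 10 * |z|) (by linarith), mul_zero]

/-- The rotation of space by `β` outside a ring that stays fixed. -/
noncomputable def twist (β : ℝ) : Space ≃ₜ Space where
  toFun x := (Complex.exp ((β * (1 - ringCutoff ‖x.1‖ x.2) : ℝ) * Complex.I) * x.1, x.2)
  invFun x := (Complex.exp (-((β * (1 - ringCutoff ‖x.1‖ x.2) : ℝ) * Complex.I)) * x.1, x.2)
  left_inv x := by
    simp only [norm_mul, Complex.norm_exp_ofReal_mul_I, one_mul]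
    rw [← mul_assoc, ← Complex.exp_add]
    simp
  right_inv x := by
    have : ∀ r : ℝ, ‖Complex.exp (-(r * Complex.I))‖ = 1 := fun r => by
      rw [← neg_mul, ← Complex.ofReal_neg, Complex.norm_exp_ofReal_mul_I]
    simp only [norm_mul, this, one_mul]
    rw [← mul_assoc, ← Complex.exp_add]
    simp
  continuous_toFun := by
    unfold ringCutoff
    fun_prop
  continuous_invFun := by
    unfold ringCutoff
    fun_prop

theorem twist_apply (β : ℝ) (x : Space) : twist β x =
    (Complex.exp ((β * (1 - ringCutoff ‖x.1‖ x.2) : ℝ) * Complex.I) * x.1, x.2) := rfl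

/-- The part of space near the trefoil of size `1` in which the clasping unknots run. -/
def safeRegion : Set Space :=
  {x | 7 ≤ ‖x.1‖ ∨ (-1 / 4 ≤ x.1.re ∧ (‖x.1‖ ≤ 11 / 10 ∨ 1 / 5 ≤ |x.2|))}

/-- A chart around the trefoil of size `δ` at `p` facing direction `d`: it takes the thin trefoil to
this trefoil, and on the safe region it is the similarity with direction `d e^{iβ}`. -/
noncomputable def vertexChart (p d : ℂ) (δ : ℝ) (hd : d ≠ 0) (hδ : δ ≠ 0) (β : ℝ) :
    Space ≃ₜ Space :=
  (twist β).trans (thinning.symm.trans (sim p d δ hd hδ))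

theorem vertexChart_of_ring {p d : ℂ} {δ : ℝ} {hd : d ≠ 0} {hδ : δ ≠ 0} {β : ℝ} {x : Space}
    (h1 : 6 / 5 ≤ ‖x.1‖) (h2 : ‖x.1‖ ≤ 11 / 2) (h3 : |x.2| ≤ 1 / 10) :
    vertexChart p d δ hd hδ β x = sim p d δ hd hδ (thinning.symm x) := by
  simp [vertexChart, twist_apply, ringCutoff_eq_one h1 h2 h3]

/-- Here the cutoff vanishes, so the twist is the full rotation by `β`, and `thinning` is the
identity. One chart thus shows the trefoil in a fixed position and an edge that leaves at the angle
`β` as if it left straight ahead. -/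
theorem vertexChart_of_safe {p d : ℂ} {δ : ℝ} {hd : d ≠ 0} {hδ : δ ≠ 0} {β : ℝ} {x : Space}
    (h : (Complex.exp (β * Complex.I) * x.1, x.2) ∈ safeRegion) :
    vertexChart p d δ hd hδ β x =
      (p + δ * (d * Complex.exp (β * Complex.I)) * x.1, δ * x.2) := by
  have h1 : ringCutoff ‖x.1‖ x.2 = 0 := by
    refine ringCutoff_eq_zero ?_
    simp only [safeRegion, Set.mem_ofPred_eq, norm_mul, Complex.norm_exp_ofReal_mul_I,
      one_mul] at h
    tauto
  have h2 : thinning.symm (Complex.exp (β * Complex.I) * x.1, x.2) =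
      (Complex.exp (β * Complex.I) * x.1, x.2) := thinning_symm_eq_self (h.imp id And.left)
  simp only [vertexChart, Homeomorph.trans_apply, twist_apply, h1, sub_zero, mul_one, h2,
    sim_apply]
  rw [mul_assoc, mul_assoc, mul_assoc]

theorem vertexChart_image_thinTrefoil (p d : ℂ) (δ : ℝ) (hd : d ≠ 0) (hδ : δ ≠ 0) (β : ℝ) :
    vertexChart p d δ hd hδ β '' thinTrefoil = trefoil p d δ := by
  rw [trefoil_eq_image_sim p d δ hd hδ, thinTrefoil, Set.image_image]
  refine Set.image_congr fun y hy => ?_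
  obtain ⟨h1, h2, h3⟩ := thinTrefoil_norm_bounds (Set.mem_image_of_mem _ hy)
  rw [vertexChart_of_ring h1 h2 h3, Homeomorph.symm_apply_apply]

theorem vertexChart_mem_trefoil_iff {p d : ℂ} {δ : ℝ} {hd : d ≠ 0} {hδ : δ ≠ 0} {β : ℝ}
    {x : Space} : vertexChart p d δ hd hδ β x ∈ trefoil p d δ ↔ x ∈ thinTrefoil := by
  rw [← vertexChart_image_thinTrefoil p d δ hd hδ β]
  exact (vertexChart p d δ hd hδ β).injective.mem_set_image

theorem isClosed_trefoil (p d : ℂ) (δ : ℝ) (hd : d ≠ 0) (hδ : δ ≠ 0) :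
    IsClosed (trefoil p d δ) := by
  rw [trefoil_eq_image_sim p d δ hd hδ]
  exact (isCompact_baseTrefoil.image (sim p d δ hd hδ).continuous).isClosed

theorem isPreconnected_trefoil_diff (p d : ℂ) (δ : ℝ) (hd : d ≠ 0) (hδ : δ ≠ 0) (β : ℝ) :
    IsPreconnected (trefoil p d δ \ {vertexChart p d δ hd hδ β (2, 0)}) := by
  have h1 : vertexChart p d δ hd hδ β (2, 0) = sim p d δ hd hδ (2, 0) := by
    rw [vertexChart_of_ring (by norm_num) (by norm_num) (by norm_num),
      thinning_symm_eq_self (Or.inr (by norm_num))]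
  rw [h1, trefoil_eq_image_sim p d δ hd hδ, ← Set.image_singleton,
    ← Set.image_sdiff (sim p d δ hd hδ).injective]
  exact isPreconnected_baseTrefoil_diff.image _ (sim p d δ hd hδ).continuous.continuousOn

/-! ### The unknot along an edge -/

/-- A sign as a real number. -/
def sgn (a : ℤˣ) : ℝ := ((a : ℤ) : ℝ)

theorem sgn_mul_self (a : ℤˣ) : sgn a * sgn a = 1 := by
  rcases Int.units_eq_one_or a with rfl | rfl <;> simp [sgn]

theorem sgn_cases (a : ℤˣ) : sgn a = 1 ∨ sgn a = -1 := by
  rcases Int.units_eq_one_or a with rfl | rfl <;> simp [sgn]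

theorem sgn_mul (a b : ℤˣ) : sgn (a * b) = sgn a * sgn b := by simp [sgn]

theorem sgn_ne_zero (a : ℤˣ) : sgn a ≠ 0 := by
  rcases sgn_cases a with h | h <;> rw [h] <;> norm_num

theorem abs_sgn (a : ℤˣ) : |sgn a| = 1 := by
  rcases sgn_cases a with h | h <;> rw [h] <;> norm_num

/-- The height of the left strand above the edge, in units of `δ`. -/
def tilt (a b : ℤˣ) (t : ℝ) : ℝ := (1 - t) * sgn a - t * sgn b

theorem tilt_symm (a b : ℤˣ) (t : ℝ) : tilt b a (1 - t) = -tilt a b t := by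
  unfold tilt; ring

theorem abs_tilt_le (a b : ℤˣ) {t : ℝ} (h0 : -1 / 4 ≤ t) (h1 : t ≤ 5 / 4) : |tilt a b t| ≤ 2 := by
  unfold tilt
  rcases sgn_cases a with h | h <;> rcases sgn_cases b with h' | h' <;> rw [h, h', abs_le] <;>
    constructor <;> linarith

theorem le_sgn_mul_tilt (a b : ℤˣ) {t : ℝ} (h0 : 0 ≤ t) : 1 - 2 * t ≤ sgn a * tilt a b t := by
  unfold tilt
  rcases sgn_cases a with h | h <;> rcases sgn_cases b with h' | h' <;> rw [h, h'] <;> linarith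

theorem le_abs_tilt (a b : ℤˣ) {t : ℝ} (h0 : 0 ≤ t) : 1 - 2 * t ≤ |tilt a b t| := by
  have := le_sgn_mul_tilt a b h0
  refine this.trans ((le_abs_self _).trans ?_)
  rw [abs_mul, abs_sgn, one_mul]

@[fun_prop]
theorem continuous_tilt (a b : ℤˣ) : Continuous (tilt a b) := by
  unfold tilt
  fun_prop

/-- As `strand` is affine in `ε`, the two strands and the two end segments together are its values
on the boundary of a rectangle of parameters `(t, ε)`. -/
theorem claspingUnknot_eq (p q : ℂ) (h : ℝ → ℝ) (a b : ℤˣ) (δ : ℝ) (h1 : δ ≤ 1) :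
    claspingUnknot p q h a b δ = {x | ∃ t ε : ℝ, δ / 2 ≤ t ∧ t ≤ 1 - δ / 2 ∧ |ε| ≤ 1 ∧
      (|ε| = 1 ∨ t = δ / 2 ∨ t = 1 - δ / 2) ∧ strand p q h a b δ ε t = x} := by
  have hseg : ∀ t, segment ℝ (strand p q h a b δ 1 t) (strand p q h a b δ (-1) t) =
      {x | ∃ ε : ℝ, |ε| ≤ 1 ∧ strand p q h a b δ ε t = x} := by
    intro t
    ext x
    constructor
    · rintro ⟨r, s, hr, hs, hrs, rfl⟩
      obtain rfl : r = 1 - s := by linarith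
      refine ⟨1 - 2 * s, abs_le.2 ⟨by linarith, by linarith⟩, ?_⟩
      ext1
      · simp only [strand, Prod.fst_add, Prod.smul_fst, Complex.real_smul]
        push_cast
        ring
      · simp only [strand, Prod.snd_add, Prod.smul_snd, smul_eq_mul]
        ring
    · rintro ⟨ε, hε, rfl⟩
      obtain ⟨k1, k2⟩ := abs_le.1 hε
      refine ⟨(1 + ε) / 2, (1 - ε) / 2, by linarith, by linarith, by ring, ?_⟩
      ext1
      · simp only [strand, Prod.fst_add, Prod.smul_fst, Complex.real_smul]
        push_cast
        ring
      · simp only [strand, Prod.snd_add, Prod.smul_snd, smul_eq_mul]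
        ring
  unfold claspingUnknot
  rw [hseg, hseg]
  ext x
  constructor
  · rintro (((⟨t, ⟨h2, h3⟩, rfl⟩ | ⟨t, ⟨h2, h3⟩, rfl⟩) | ⟨ε, hε, rfl⟩) | ⟨ε, hε, rfl⟩)
    · exact ⟨t, 1, h2, h3, by simp, by simp, rfl⟩
    · exact ⟨t, -1, h2, h3, by simp, by simp, rfl⟩
    · exact ⟨δ / 2, ε, le_rfl, by linarith, hε, by simp, rfl⟩
    · exact ⟨1 - δ / 2, ε, by linarith, le_rfl, hε, by simp, rfl⟩
  · rintro ⟨t, ε, h2, h3, h4, h5 | rfl | rfl, rfl⟩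
    · rcases eq_or_eq_neg_of_abs_eq h5 with rfl | rfl
      · exact Or.inl (Or.inl (Or.inl ⟨t, ⟨h2, h3⟩, rfl⟩))
      · exact Or.inl (Or.inl (Or.inr ⟨t, ⟨h2, h3⟩, rfl⟩))
    · exact Or.inl (Or.inr ⟨ε, h4, rfl⟩)
    · exact Or.inr ⟨ε, h4, rfl⟩

theorem strand_symm (p q : ℂ) (h : ℝ → ℝ) (a b : ℤˣ) (δ ε t : ℝ) :
    strand q p (fun t => h (1 - t)) b a δ (-ε) (1 - t) = strand p q h a b δ ε t := by
  ext1
  · simp only [strand]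
    push_cast
    ring
  · simp only [strand, sub_sub_cancel]
    ring

theorem claspingUnknot_symm (p q : ℂ) (h : ℝ → ℝ) (a b : ℤˣ) (δ : ℝ) (h1 : δ ≤ 1) :
    claspingUnknot q p (fun t => h (1 - t)) b a δ = claspingUnknot p q h a b δ := by
  rw [claspingUnknot_eq _ _ _ _ _ _ h1, claspingUnknot_eq _ _ _ _ _ _ h1]
  ext x
  constructor
  · rintro ⟨t, ε, h2, h3, h4, h5, rfl⟩
    refine ⟨1 - t, -ε, by linarith, by linarith, by rwa [abs_neg], ?_, ?_⟩
    · rw [abs_neg]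
      rcases h5 with h5 | h5 | h5
      · exact Or.inl h5
      · exact Or.inr (Or.inr (by rw [h5]))
      · exact Or.inr (Or.inl (by rw [h5]; ring))
    · rw [← strand_symm, sub_sub_cancel, neg_neg]
  · rintro ⟨t, ε, h2, h3, h4, h5, rfl⟩
    refine ⟨1 - t, -ε, by linarith, by linarith, by rwa [abs_neg], ?_, strand_symm ..⟩
    · rw [abs_neg]
      rcases h5 with h5 | h5 | h5
      · exact Or.inl h5
      · exact Or.inr (Or.inr (by rw [h5]))
      · exact Or.inr (Or.inl (by rw [h5]; ring))

/-- A thick band around the unknot along an edge. -/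
def band (p q : ℂ) (h : ℝ → ℝ) (δ : ℝ) : Set Space :=
  {x | ∃ t ε ζ : ℝ, δ / 2 ≤ t ∧ t ≤ 1 - δ / 2 ∧ |ε| ≤ 1 ∧ |ζ| ≤ 2 ∧
    x = (p + t * (q - p) + ε * δ ^ 2 * Complex.I * (q - p), h t + δ * ζ)}

theorem claspingUnknot_subset_band {p q : ℂ} {h : ℝ → ℝ} {a b : ℤˣ} {δ : ℝ} (h0 : 0 < δ)
    (h1 : δ ≤ 1) :
    claspingUnknot p q h a b δ ⊆ band p q h δ := by
  rw [claspingUnknot_eq _ _ _ _ _ _ h1]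
  rintro _ ⟨t, ε, h2, h3, h4, -, rfl⟩
  refine ⟨t, ε, ε * tilt a b t, h2, h3, h4, ?_, ?_⟩
  · rw [abs_mul]
    have := abs_tilt_le a b (t := t) (by linarith) (by linarith)
    nlinarith [abs_nonneg ε, abs_nonneg (tilt a b t)]
  · ext1
    · rfl
    · simp only [strand, tilt, sgn]
      ring

theorem band_symm (p q : ℂ) (h : ℝ → ℝ) (δ : ℝ) :
    band q p (fun t => h (1 - t)) δ = band p q h δ := by
  ext x
  constructor
  · rintro ⟨t, ε, ζ, h2, h3, h4, h5, rfl⟩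
    refine ⟨1 - t, -ε, ζ, by linarith, by linarith, by rwa [abs_neg], h5, ?_⟩
    ext1
    · simp only []
      push_cast
      ring
    · rfl
  · rintro ⟨t, ε, ζ, h2, h3, h4, h5, rfl⟩
    refine ⟨1 - t, -ε, ζ, by linarith, by linarith, by rwa [abs_neg], h5, ?_⟩
    ext1
    · simp only []
      push_cast
      ring
    · simp

/-- The edge from `p` to `q` is long compared with the trefoils at its ends, and flat near them. -/
structure EdgeGood (p q : ℂ) (h : ℝ → ℝ) (δ : ℝ) : Prop where
  pos : 0 < δ
  le_tenth : δ ≤ 1 / 10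
  le_length : 20 * δ ≤ ‖q - p‖
  length_le : ‖q - p‖ ≤ 2
  cont : Continuous h
  flat_left : ∀ t, |t| * ‖q - p‖ ≤ 7 * δ → h t = 0
  flat_right : ∀ t, |1 - t| * ‖q - p‖ ≤ 7 * δ → h t = 0

theorem EdgeGood.symm {p q : ℂ} {h : ℝ → ℝ} {δ : ℝ} (H : EdgeGood p q h δ) :
    EdgeGood q p (fun t => h (1 - t)) δ where
  pos := H.pos
  le_tenth := H.le_tenth
  le_length := by rw [norm_sub_rev]; exact H.le_length
  length_le := by rw [norm_sub_rev]; exact H.length_le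
  cont := H.cont.comp (by fun_prop)
  flat_left t ht := H.flat_right _ (by rwa [sub_sub_cancel, norm_sub_rev])
  flat_right t ht := H.flat_left _ (by rwa [norm_sub_rev])

theorem EdgeGood.length_pos {p q : ℂ} {h : ℝ → ℝ} {δ : ℝ} (H : EdgeGood p q h δ) :
    0 < ‖q - p‖ := lt_of_lt_of_le (by linarith [H.pos]) H.le_length

/-- The unit vector from `p` towards `q`. -/
noncomputable def edgeDir (p q : ℂ) : ℂ := (q - p) / ‖q - p‖

theorem norm_edgeDir {p q : ℂ} (h : 0 < ‖q - p‖) : ‖edgeDir p q‖ = 1 := by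
  rw [edgeDir, norm_div, Complex.norm_real, norm_norm, div_self h.ne']

theorem edgeDir_ne_zero {p q : ℂ} (h : 0 < ‖q - p‖) : edgeDir p q ≠ 0 := by
  rw [← norm_pos_iff, norm_edgeDir h]
  exact one_pos

theorem edgeDir_mul_length {p q : ℂ} (h : 0 < ‖q - p‖) : edgeDir p q * ‖q - p‖ = q - p := by
  have : (‖q - p‖ : ℂ) ≠ 0 := by exact_mod_cast h.ne'
  rw [edgeDir, div_mul_cancel₀ _ this]

theorem edgeDir_symm (p q : ℂ) : edgeDir q p = -edgeDir p q := by
  rw [edgeDir, edgeDir, norm_sub_rev p q, ← neg_sub q p, neg_div]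

/-- The unknot along an edge, in the coordinates in which the edge runs along the real axis and the
trefoil at its beginning has size `1`. -/
noncomputable def bandCurve (L : ℝ) (h : ℝ → ℝ) (a b : ℤˣ) (δ : ℝ) : Set Space :=
  {x | L / 2 ≤ x.1.re ∧ x.1.re ≤ L / δ - L / 2 ∧ |x.1.im| ≤ δ * L ∧
    (|x.1.im| = δ * L ∨ x.1.re = L / 2 ∨ x.1.re = L / δ - L / 2) ∧
    x.2 = h (x.1.re / (L / δ)) / δ + x.1.im / (δ * L) * tilt a b (x.1.re / (L / δ))}

theorem sim_image_bandCurve {p q : ℂ} {h : ℝ → ℝ} (a b : ℤˣ) {δ : ℝ} (H : EdgeGood p q h δ) :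
    sim p (edgeDir p q) δ (edgeDir_ne_zero H.length_pos) (ne_of_gt H.pos) ''
      bandCurve ‖q - p‖ h a b δ = claspingUnknot p q h a b δ := by
  have hδ := H.pos
  have hL := H.length_pos
  have hd := edgeDir_mul_length hL
  have h1 := H.le_tenth
  set L := ‖q - p‖
  set e := edgeDir p q
  rw [claspingUnknot_eq _ _ _ _ _ _ (by linarith)]
  have key : ∀ t ε : ℝ, sim p e δ (edgeDir_ne_zero H.length_pos) H.pos.ne'
      (⟨t * (L / δ), ε * (δ * L)⟩, h t / δ + ε * tilt a b t) = strand p q h a b δ ε t := by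
    intro t ε
    have hδ' : (δ : ℂ) ≠ 0 := by exact_mod_cast hδ.ne'
    ext1
    · simp only [sim_apply, strand, ← hd]
      rw [Complex.mk_eq_add_mul_I]
      push_cast
      field_simp
      ring
    · simp only [sim_apply, strand, tilt, sgn]
      field_simp
  have hΛ : 0 < L / δ := by positivity
  have hω : 0 < δ * L := by positivity
  ext x
  constructor
  · rintro ⟨y, ⟨k1, k2, k3, k4, k5⟩, rfl⟩
    refine ⟨y.1.re / (L / δ), y.1.im / (δ * L), ?_, ?_, ?_, ?_, ?_⟩
    · rw [le_div_iff₀ hΛ]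
      refine le_trans (le_of_eq ?_) k1
      field_simp
    · rw [div_le_iff₀ hΛ]
      refine le_trans k2 (le_of_eq ?_)
      field_simp
    · rw [abs_div, abs_of_pos hω]
      exact (div_le_one hω).2 k3
    · rcases k4 with k4 | k4 | k4
      · left
        rw [abs_div, abs_of_pos hω, k4, div_self hω.ne']
      · right; left
        rw [k4]; field_simp
      · right; right
        rw [k4]; field_simp
    · rw [← key]
      congr 1
      ext1
      · apply Complex.ext
        · simp only []
          field_simp
        · simp only []
          field_simp
      · exact k5.symm
  · rintro ⟨t, ε, k1, k2, k3, k4, rfl⟩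
    refine ⟨_, ⟨?_, ?_, ?_, ?_, ?_⟩, key t ε⟩
    · simp only []
      calc L / 2 = δ / 2 * (L / δ) := by field_simp
        _ ≤ _ := by gcongr
    · simp only []
      calc t * (L / δ) ≤ (1 - δ / 2) * (L / δ) := by gcongr
        _ = _ := by field_simp
    · simp only []
      rw [abs_mul, abs_of_pos hω]
      exact mul_le_of_le_one_left hω.le k3
    · simp only []
      rcases k4 with k4 | rfl | rfl
      · left
        rw [abs_mul, abs_of_pos hω, k4, one_mul]
      · right; left
        field_simp
      · right; right
        field_simp
    · simp only []
      rw [mul_div_cancel_right₀ _ hΛ.ne', mul_div_cancel_right₀ _ hω.ne']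

section BandCurve

variable {p q : ℂ} {h : ℝ → ℝ} {a b : ℤˣ} {δ : ℝ}

/-- Near the beginning of the edge, the unknot consists of two strands far above and below the plane
and of the short segment that joins them. -/
theorem EdgeGood.bandCurve_near (H : EdgeGood p q h δ) {x : Space}
    (hx : x ∈ bandCurve ‖q - p‖ h a b δ) (hx7 : x.1.re ≤ 7) :
    1 / 5 ≤ |x.2| ∨ (x.1.re = ‖q - p‖ / 2 ∧ x.2 = x.1.im / (δ * ‖q - p‖) * tilt a b (δ / 2)) := by
  obtain ⟨h1, h2, h3, h4, h5⟩ := hx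
  have hδ := H.pos
  have hL := H.length_pos
  have hl := H.le_length
  have hl2 := H.length_le
  set L := ‖q - p‖
  have hΛ : 20 ≤ L / δ := (le_div_iff₀ hδ).2 hl
  have hflat : h (x.1.re / (L / δ)) = 0 := by
    refine H.flat_left _ ?_
    rw [abs_of_nonneg (div_nonneg (by linarith) (by linarith))]
    calc x.1.re / (L / δ) * L = x.1.re * δ := by field_simp
      _ ≤ _ := by gcongr
  rw [hflat, zero_div, zero_add] at h5
  have hω : 0 < δ * L := by positivity
  rcases h4 with h4 | h4 | h4
  · left
    rw [h5, abs_mul, abs_div, abs_of_pos hω, h4, div_self hω.ne', one_mul]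
    have h0 : 0 ≤ x.1.re / (L / δ) := div_nonneg (by linarith) (by linarith)
    have h7 : x.1.re / (L / δ) ≤ 7 / 20 := by
      rw [div_le_iff₀ (by linarith)]; linarith
    linarith [le_abs_tilt a b h0]
  · right
    refine ⟨h4, ?_⟩
    rw [h5, h4]
    congr 2
    field_simp
  · linarith

theorem EdgeGood.bandCurve_bounds (H : EdgeGood p q h δ) {x : Space}
    (hx : x ∈ bandCurve ‖q - p‖ h a b δ) : 0 < x.1.re ∧ |x.1.im| ≤ 1 / 5 := by
  obtain ⟨h1, h2, h3, h4, h5⟩ := hx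
  refine ⟨by linarith [H.length_pos], h3.trans ?_⟩
  nlinarith [H.pos, H.le_tenth, H.length_le, H.length_pos]

theorem norm_le_of_re_im {w : ℂ} (h1 : |w.re| ≤ 1) (h2 : |w.im| ≤ 1 / 5) : ‖w‖ ≤ 51 / 50 := by
  refine abs_le_of_sq_le_sq' ?_ (by norm_num) |>.2
  rw [norm_sq_eq_re_im, ← sq_abs w.re, ← sq_abs w.im]
  nlinarith [abs_nonneg w.re, abs_nonneg w.im]

/-- Within radius `7` the unknot is either at height at least `1 / 5`, above or below the ring, or
on its end segment, inside the ring. The sign of `u.re` keeps it away from the knotted part on the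
left. -/
theorem EdgeGood.mul_mem_safeRegion (H : EdgeGood p q h δ) {u : ℂ} (hu : ‖u‖ = 1)
    (hre : 0 ≤ u.re) {x : Space} (hx : x ∈ bandCurve ‖q - p‖ h a b δ) :
    ((u * x.1, x.2) : Space) ∈ safeRegion := by
  obtain ⟨h1, h2⟩ := H.bandCurve_bounds hx
  simp only [safeRegion, Set.mem_ofPred_eq, norm_mul, hu, one_mul]
  by_cases h7 : 7 ≤ ‖x.1‖
  · exact Or.inl h7
  right
  have hre7 : x.1.re ≤ 7 := (Complex.re_le_norm _).trans (not_le.1 h7).le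
  constructor
  · rw [Complex.mul_re]
    have h3 : |u.im| ≤ 1 := hu ▸ Complex.abs_im_le_norm u
    have h4 : |u.im * x.1.im| ≤ 1 / 5 := by
      rw [abs_mul]
      nlinarith [abs_nonneg u.im, abs_nonneg x.1.im]
    have := (abs_le.1 h4).2
    have := mul_nonneg hre h1.le
    linarith
  · rcases H.bandCurve_near hx hre7 with h5 | ⟨h5, -⟩
    · exact Or.inr h5
    · left
      refine (norm_le_of_re_im ?_ h2).trans (by norm_num)
      rw [abs_of_pos h1, h5]
      linarith [H.length_le]

end BandCurve

/-! ### A chart around the unknot along an edge -/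

/-- A function equal to the identity near `0` that vanishes away from `0`. -/
noncomputable def hat (u : ℝ) : ℝ := max (min u (1 / 2 - u)) 0 + min (max u (-1 / 2 - u)) 0

theorem hat_eq_self {u : ℝ} (h : |u| ≤ 1 / 4) : hat u = u := by
  obtain ⟨h1, h2⟩ := abs_le.1 h
  unfold hat
  rw [min_eq_left (by linarith : u ≤ 1 / 2 - u), max_eq_left (by linarith : -1 / 2 - u ≤ u)]
  rcases le_total 0 u with h | h
  · rw [max_eq_left h, min_eq_right h, add_zero]
  · rw [max_eq_right h, min_eq_left h, zero_add]

theorem hat_eq_zero {u : ℝ} (h : 1 / 2 ≤ |u|) : hat u = 0 := by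
  unfold hat
  rcases le_abs.1 h with h | h
  · rw [max_eq_right ((min_le_right _ _).trans (by linarith)),
      min_eq_right ((by linarith : (0 : ℝ) ≤ u).trans (le_max_left _ _)), add_zero]
  · rw [max_eq_right ((min_le_left _ _).trans (by linarith)),
      min_eq_right ((by linarith : (0 : ℝ) ≤ -1 / 2 - u).trans (le_max_right _ _)), add_zero]

theorem abs_hat_le (u : ℝ) : |hat u| ≤ 1 / 4 := by
  unfold hat
  rw [abs_le]
  have h1 : min u (1 / 2 - u) ≤ 1 / 4 := by
    rcases le_total u (1 / 4) with h | h
    · exact (min_le_left _ _).trans h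
    · exact (min_le_right _ _).trans (by linarith)
  have h2 : -1 / 4 ≤ max u (-1 / 2 - u) := by
    rcases le_total u (-1 / 4) with h | h
    · exact le_trans (by linarith) (le_max_right _ _)
    · exact h.trans (le_max_left _ _)
  constructor
  · have h3 : (0 : ℝ) ≤ max (min u (1 / 2 - u)) 0 := le_max_right _ _
    have h4 : -1 / 4 ≤ min (max u (-1 / 2 - u)) 0 := le_min h2 (by norm_num)
    linarith
  · have h3 : max (min u (1 / 2 - u)) 0 ≤ 1 / 4 := max_le h1 (by norm_num)
    have h4 : min (max u (-1 / 2 - u)) 0 ≤ 0 := min_le_right _ _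
    linarith

@[fun_prop]
theorem continuous_hat : Continuous hat := by
  unfold hat
  fun_prop

section EdgeChart

variable (L : ℝ) (h : ℝ → ℝ) (a b : ℤˣ) (δ : ℝ) (f : ℤˣ) (κ : ℝ)

/-- The coordinate along the edge of the point of the chart with coordinate `u`. -/
noncomputable def edgeCoord (u : ℝ) : ℝ :=
  2 + (2 - L / 2) * u + 2 * (L / δ - 4) * max 0 (u - 1 / 2)

/-- The slope of the surface spanned by the unknot. It is locally constant near the two places
where the trefoil and the next trefoil meet the surface and its boundary. -/
noncomputable def bandSlope (X Y : ℝ) : ℝ :=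
  tilt a b ((X - (hat (X - 2) + hat (X - (L / δ - L / 2))) *
    max 0 (min 1 (2 - 2 * |Y| / (δ * L)))) / (L / δ))

/-- The chart, as a function. -/
noncomputable def edgeFun (x : ℝ × ℝ × ℝ) : Space :=
  let X := edgeCoord L δ x.1
  let Y := -(sgn f * sgn a * (δ * L) * x.2.1) + sgn f * κ * x.2.2
  (⟨X, Y⟩, h (X / (L / δ)) / δ - sgn f * (tilt a b (2 / (L / δ)) * κ / (δ * L)) * x.2.2 +
    Y / (δ * L) * bandSlope L a b δ X Y)

end EdgeChart

section EdgeChart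

variable {p q : ℂ} {h : ℝ → ℝ} {a b : ℤˣ} {δ : ℝ} {f : ℤˣ} {κ : ℝ}

theorem EdgeGood.twenty_le (H : EdgeGood p q h δ) : 20 ≤ ‖q - p‖ / δ :=
  (le_div_iff₀ H.pos).2 H.le_length

theorem EdgeGood.sgn_mul_tilt_pos (H : EdgeGood p q h δ) (a b : ℤˣ) :
    0 < sgn a * tilt a b (2 / (‖q - p‖ / δ)) := by
  have h1 := H.twenty_le
  have h2 : 2 / (‖q - p‖ / δ) ≤ 1 / 10 := by
    rw [div_le_iff₀ (by linarith)]
    linarith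
  have := le_sgn_mul_tilt a b (t := 2 / (‖q - p‖ / δ)) (by positivity)
  linarith

theorem EdgeGood.tilt_ne_zero (H : EdgeGood p q h δ) (a b : ℤˣ) :
    tilt a b (2 / (‖q - p‖ / δ)) ≠ 0 := by
  intro h0
  have := H.sgn_mul_tilt_pos a b
  rw [h0, mul_zero] at this
  exact this.false

theorem EdgeGood.edgeCoord_strictMono (H : EdgeGood p q h δ) :
    StrictMono (edgeCoord ‖q - p‖ δ) := by
  intro u v huv
  have h1 := H.twenty_le
  have h2 := H.length_le
  unfold edgeCoord
  have h3 : max 0 (u - 1 / 2) ≤ max 0 (v - 1 / 2) := max_le_max le_rfl (by linarith)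
  have h4 := mul_le_mul_of_nonneg_left h3 (by linarith : 0 ≤ 2 * (‖q - p‖ / δ - 4))
  nlinarith

theorem continuous_edgeCoord (L δ : ℝ) : Continuous (edgeCoord L δ) := by
  unfold edgeCoord
  fun_prop

theorem EdgeGood.edgeCoord_surjective (H : EdgeGood p q h δ) :
    Function.Surjective (edgeCoord ‖q - p‖ δ) := by
  have h1 := H.twenty_le
  have h2 := H.length_le
  refine (continuous_edgeCoord _ _).surjective ?_ ?_
  · refine Filter.tendsto_atTop_mono' _ (f₁ := fun u => u) ?_ Filter.tendsto_id
    filter_upwards [Filter.eventually_ge_atTop (0 : ℝ)] with u hu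
    have := mul_nonneg (by linarith : 0 ≤ 2 * (‖q - p‖ / δ - 4)) (le_max_left 0 (u - 1 / 2))
    unfold edgeCoord
    nlinarith
  · refine Filter.tendsto_atBot_mono' _ (f₁ := fun u : ℝ => 2 + u) ?_
      (Filter.tendsto_atBot_add_const_left _ (2 : ℝ) Filter.tendsto_id)
    filter_upwards [Filter.eventually_le_atBot (0 : ℝ)] with u hu
    unfold edgeCoord
    rw [max_eq_left (by linarith), mul_zero, add_zero]
    nlinarith

theorem edgeCoord_zero (L δ : ℝ) : edgeCoord L δ 0 = 2 := by
  norm_num [edgeCoord]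

theorem edgeCoord_neg_one (L δ : ℝ) : edgeCoord L δ (-1) = L / 2 := by
  unfold edgeCoord
  rw [max_eq_left (by norm_num)]
  ring

theorem edgeCoord_one (L δ : ℝ) : edgeCoord L δ 1 = L / δ - L / 2 := by
  unfold edgeCoord
  rw [max_eq_right (by norm_num)]
  ring

theorem EdgeGood.continuous_bandSlope (L δ : ℝ) (a b : ℤˣ) :
    Continuous fun x : ℝ × ℝ => bandSlope L a b δ x.1 x.2 := by
  unfold bandSlope
  fun_prop

/-- The equations are solved one coordinate at a time: the first from the real part, the third from
the height relative to the surface over the same point of the plane, the second from the imaginary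
part. -/
theorem EdgeGood.exists_edgeChart (H : EdgeGood p q h δ) (a b f : ℤˣ) (hκ : 0 < κ) :
    ∃ Φ : ℝ × ℝ × ℝ ≃ₜ Space, ∀ x, Φ x = edgeFun ‖q - p‖ h a b δ f κ x := by
  have hδ := H.pos
  have hL := H.length_pos
  have hm := H.tilt_ne_zero a b
  have hcont := H.cont
  set L := ‖q - p‖
  set m := tilt a b (2 / (L / δ)) with hmdef
  let X : ℝ ≃o ℝ := StrictMono.orderIsoOfSurjective _ H.edgeCoord_strictMono H.edgeCoord_surjective
  have hX : ∀ u, X u = edgeCoord L δ u := fun _ => rfl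
  let g : ℂ → ℝ := fun w => h (w.re / (L / δ)) / δ + w.im / (δ * L) * bandSlope L a b δ w.re w.im
  have hg : Continuous g := by
    have h2 := EdgeGood.continuous_bandSlope L δ a b
    have h3 : Continuous fun w : ℂ => bandSlope L a b δ w.re w.im :=
      h2.comp (f := fun w : ℂ => (w.re, w.im)) (by fun_prop)
    have h4 : Continuous fun w : ℂ => h (w.re / (L / δ)) := hcont.comp (by fun_prop)
    exact (h4.div_const _).add (by fun_prop)
  have hf := sgn_mul_self f
  have ha := sgn_mul_self a
  have hf0 := sgn_ne_zero f
  have ha0 := sgn_ne_zero a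
  have hω : δ * L ≠ 0 := by positivity
  let Z : Space → ℝ := fun y => (g y.1 - y.2) / (sgn f * (m * κ / (δ * L)))
  have hc : sgn f * (m * κ / (δ * L)) ≠ 0 := by
    have := hκ.ne'
    positivity
  have hfun : ∀ x, edgeFun L h a b δ f κ x =
      (⟨X x.1, -(sgn f * sgn a * (δ * L) * x.2.1) + sgn f * κ * x.2.2⟩,
        g ⟨X x.1, -(sgn f * sgn a * (δ * L) * x.2.1) + sgn f * κ * x.2.2⟩ -
          sgn f * (m * κ / (δ * L)) * x.2.2) := by
    intro x
    simp only [edgeFun, hX, g, ← hmdef]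
    ext1
    · rfl
    · simp only []
      ring
  have hcX : Continuous X := X.continuous
  have hcX' : Continuous X.symm := X.symm.continuous
  have hmk : Continuous fun x : ℝ × ℝ × ℝ =>
      (⟨X x.1, -(sgn f * sgn a * (δ * L) * x.2.1) + sgn f * κ * x.2.2⟩ : ℂ) := by
    simp only [Complex.mk_eq_add_mul_I]
    fun_prop
  refine ⟨{
    toFun := edgeFun L h a b δ f κ
    invFun := fun y => (X.symm y.1.re,
      (sgn f * κ * Z y - y.1.im) * (sgn f * sgn a) / (δ * L), Z y)
    left_inv := ?_
    right_inv := ?_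
    continuous_toFun := ?_
    continuous_invFun := ?_ }, fun x => rfl⟩
  · intro x
    rw [hfun]
    simp only [Z]
    have h1 : (g ⟨X x.1, -(sgn f * sgn a * (δ * L) * x.2.1) + sgn f * κ * x.2.2⟩ -
        (g ⟨X x.1, -(sgn f * sgn a * (δ * L) * x.2.1) + sgn f * κ * x.2.2⟩ -
          sgn f * (m * κ / (δ * L)) * x.2.2)) / (sgn f * (m * κ / (δ * L))) = x.2.2 := by
      rw [sub_sub_cancel, mul_div_cancel_left₀ _ hc]
    rw [h1]
    refine Prod.ext ?_ (Prod.ext ?_ rfl)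
    · simp
    · simp only []
      rw [div_eq_iff hω]
      linear_combination (δ * L * x.2.1 * (sgn a * sgn a)) * hf + (δ * L * x.2.1) * ha
  · intro y
    rw [hfun]
    simp only [OrderIso.apply_symm_apply]
    have h1 : -(sgn f * sgn a * (δ * L) * ((sgn f * κ * Z y - y.1.im) * (sgn f * sgn a) / (δ * L)))
        + sgn f * κ * Z y = y.1.im := by
      field_simp
      linear_combination (-(sgn f * κ * Z y - y.1.im) * (sgn a * sgn a)) * hf
        - (sgn f * κ * Z y - y.1.im) * ha
    rw [h1]
    ext1
    · rfl
    · simp only [Z, Complex.eta]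
      rw [mul_div_cancel₀ _ hc]
      ring
  · rw [show edgeFun L h a b δ f κ = _ from funext hfun]
    exact hmk.prodMk ((hg.comp hmk).sub (by fun_prop))
  · have hZ : Continuous Z := by
      simp only [Z]
      exact ((hg.comp continuous_fst).sub continuous_snd).div_const _
    fun_prop

/-- A chart around the unknot along an edge. -/
noncomputable def EdgeGood.edgeChart (H : EdgeGood p q h δ) (a b f : ℤˣ) (hκ : 0 < κ) :
    ℝ × ℝ × ℝ ≃ₜ Space := (H.exists_edgeChart a b f hκ).choose

theorem EdgeGood.edgeChart_apply (H : EdgeGood p q h δ) (a b f : ℤˣ) (hκ : 0 < κ)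
    (x : ℝ × ℝ × ℝ) : H.edgeChart a b f hκ x = edgeFun ‖q - p‖ h a b δ f κ x :=
  (H.exists_edgeChart a b f hκ).choose_spec x

/-- The boundary of a square in the plane. -/
def modelUnknot : Set (ℝ × ℝ × ℝ) :=
  {x | |x.1| ≤ 1 ∧ |x.2.1| ≤ 1 ∧ (|x.1| = 1 ∨ |x.2.1| = 1) ∧ x.2.2 = 0}

/-- The square bounded by the model of the unknot. -/
def plate : Set (ℝ × ℝ × ℝ) := {x | |x.1| ≤ 1 ∧ |x.2.1| ≤ 1 ∧ x.2.2 = 0}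

theorem EdgeGood.edgeCoord_le_iff (H : EdgeGood p q h δ) (u : ℝ) :
    edgeCoord ‖q - p‖ δ u ≤ ‖q - p‖ / δ - ‖q - p‖ / 2 ↔ u ≤ 1 := by
  rw [← edgeCoord_one, H.edgeCoord_strictMono.le_iff_le]

theorem EdgeGood.le_edgeCoord_iff (H : EdgeGood p q h δ) (u : ℝ) :
    ‖q - p‖ / 2 ≤ edgeCoord ‖q - p‖ δ u ↔ -1 ≤ u := by
  rw [← edgeCoord_neg_one ‖q - p‖ δ, H.edgeCoord_strictMono.le_iff_le]

/-- The flattening of the slope is invisible on the boundary of the plate: the cutoff vanishes on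
the long sides, `L / 2 ≤ 1` is too far from `2` for the hats at the near end, and `hat 0 = 0` at the
far end. -/
theorem EdgeGood.bandSlope_of_boundary (H : EdgeGood p q h δ) {X Y : ℝ}
    (hXY : |Y| = δ * ‖q - p‖ ∨ X = ‖q - p‖ / 2 ∨ X = ‖q - p‖ / δ - ‖q - p‖ / 2) :
    bandSlope ‖q - p‖ a b δ X Y = tilt a b (X / (‖q - p‖ / δ)) := by
  have hδ := H.pos
  have hL := H.length_pos
  have hl2 := H.length_le
  have h20 := H.twenty_le
  set L := ‖q - p‖
  unfold bandSlope
  congr 2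
  rcases hXY with h1 | h1 | h1
  · rw [h1, mul_div_cancel_right₀ _ (by positivity), clamp_eq_zero (by norm_num)]
    ring
  · rw [hat_eq_zero (u := X - 2), hat_eq_zero]
    · ring
    · rw [h1, le_abs]; right; linarith
    · rw [h1, le_abs]; right; linarith
  · rw [hat_eq_zero (u := X - 2), h1, sub_self, hat_eq_self (by norm_num)]
    · ring
    · rw [h1, le_abs]; left; linarith

/-- Over the boundary of the strip, the heights of the chart and of the unknot differ by a nonzero
multiple of the third coordinate, so this coordinate must vanish. -/
theorem EdgeGood.edgeChart_mem_bandCurve_iff (H : EdgeGood p q h δ) (a b f : ℤˣ) (hκ : 0 < κ)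
    (x : ℝ × ℝ × ℝ) :
    H.edgeChart a b f hκ x ∈ bandCurve ‖q - p‖ h a b δ ↔ x ∈ modelUnknot := by
  have hδ := H.pos
  have hL := H.length_pos
  have hω : 0 < δ * ‖q - p‖ := by positivity
  have hm := H.tilt_ne_zero a b
  have hf0 := sgn_ne_zero f
  have hYabs : ∀ s : ℝ, |-(sgn f * sgn a * (δ * ‖q - p‖) * s)| = δ * ‖q - p‖ * |s| := by
    intro s
    rw [abs_neg, abs_mul, abs_mul, abs_mul, abs_sgn, abs_sgn, abs_of_pos hω]
    ring
  have hone : edgeCoord ‖q - p‖ δ x.1 = ‖q - p‖ / 2 ↔ x.1 = -1 := by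
    rw [← edgeCoord_neg_one ‖q - p‖ δ, H.edgeCoord_strictMono.injective.eq_iff]
  have hone' : edgeCoord ‖q - p‖ δ x.1 = ‖q - p‖ / δ - ‖q - p‖ / 2 ↔ x.1 = 1 := by
    rw [← edgeCoord_one ‖q - p‖ δ, H.edgeCoord_strictMono.injective.eq_iff]
  rw [H.edgeChart_apply]
  simp only [bandCurve, edgeFun, Set.mem_ofPred_eq, modelUnknot]
  rw [H.edgeCoord_le_iff, H.le_edgeCoord_iff]
  constructor
  · rintro ⟨k1, k2, k3, k4, k5⟩
    rw [H.bandSlope_of_boundary k4] at k5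
    have hz : x.2.2 = 0 := by
      have : sgn f * (tilt a b (2 / (‖q - p‖ / δ)) * κ / (δ * ‖q - p‖)) * x.2.2 = 0 := by linarith
      have h0 : sgn f * (tilt a b (2 / (‖q - p‖ / δ)) * κ / (δ * ‖q - p‖)) ≠ 0 := by
        have := hκ.ne'
        positivity
      exact (mul_eq_zero.1 this).resolve_left h0
    rw [hz, mul_zero, add_zero, hYabs] at k3 k4
    rw [hone, hone'] at k4
    refine ⟨abs_le.2 ⟨k1, k2⟩, (mul_le_iff_le_one_right hω).1 k3, ?_, hz⟩
    rcases k4 with k4 | k4 | k4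
    · exact Or.inr ((mul_eq_left₀ hω.ne').1 k4)
    · left; rw [k4]; norm_num
    · left; rw [k4]; norm_num
  · rintro ⟨k1, k2, k3, hz⟩
    have k4 : |-(sgn f * sgn a * (δ * ‖q - p‖) * x.2.1) + sgn f * κ * x.2.2| = δ * ‖q - p‖ ∨
        edgeCoord ‖q - p‖ δ x.1 = ‖q - p‖ / 2 ∨
        edgeCoord ‖q - p‖ δ x.1 = ‖q - p‖ / δ - ‖q - p‖ / 2 := by
      rw [hz, mul_zero, add_zero, hYabs, hone, hone']
      rcases k3 with k3 | k3
      · rcases eq_or_eq_neg_of_abs_eq k3 with k3 | k3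
        · exact Or.inr (Or.inr k3)
        · exact Or.inr (Or.inl k3)
      · left; rw [k3, mul_one]
    refine ⟨(abs_le.1 k1).1, (abs_le.1 k1).2, ?_, k4, ?_⟩
    · rw [hz, mul_zero, add_zero, hYabs]
      exact mul_le_of_le_one_right hω.le k2
    · rw [H.bandSlope_of_boundary k4, hz]
      ring

theorem EdgeGood.edgeChart_image_modelUnknot (H : EdgeGood p q h δ) (a b f : ℤˣ) (hκ : 0 < κ) :
    H.edgeChart a b f hκ '' modelUnknot = bandCurve ‖q - p‖ h a b δ := by
  ext y
  constructor
  · rintro ⟨x, hx, rfl⟩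
    exact (H.edgeChart_mem_bandCurve_iff a b f hκ x).2 hx
  · intro hy
    refine ⟨(H.edgeChart a b f hκ).symm y, ?_, by simp⟩
    rw [← H.edgeChart_mem_bandCurve_iff a b f hκ]
    simpa using hy

theorem EdgeGood.sim_edgeChart_mem_band (H : EdgeGood p q h δ) (a b f : ℤˣ) (hκ : 0 < κ)
    {x : ℝ × ℝ × ℝ} (hx : x ∈ plate) :
    sim p (edgeDir p q) δ (edgeDir_ne_zero H.length_pos) H.pos.ne' (H.edgeChart a b f hκ x) ∈
      band p q h δ := by
  have hδ := H.pos
  have hL := H.length_pos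
  have h20 := H.twenty_le
  have hω : 0 < δ * ‖q - p‖ := by positivity
  have hd := edgeDir_mul_length hL
  obtain ⟨k1, k2, hz⟩ := hx
  rw [H.edgeChart_apply]
  have hX1 := (H.le_edgeCoord_iff x.1).2 (abs_le.1 k1).1
  have hX2 := (H.edgeCoord_le_iff x.1).2 (abs_le.1 k1).2
  simp only [edgeFun, hz, mul_zero, add_zero, sub_zero]
  set X := edgeCoord ‖q - p‖ δ x.1
  set L := ‖q - p‖
  set Y := -(sgn f * sgn a * (δ * L) * x.2.1) with hY
  have hYabs : |Y / (δ * L)| ≤ 1 := by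
    rw [hY, abs_div, abs_neg, abs_mul, abs_mul, abs_mul, abs_sgn, abs_sgn, abs_of_pos hω,
      div_le_one hω, one_mul, one_mul]
    exact mul_le_of_le_one_right hω.le k2
  have hδ' : (δ : ℂ) ≠ 0 := by exact_mod_cast hδ.ne'
  have hL' : (L : ℂ) ≠ 0 := by exact_mod_cast hL.ne'
  have hΛ : 0 < L / δ := by linarith
  refine ⟨X / (L / δ), Y / (δ * L), Y / (δ * L) * bandSlope L a b δ X Y, ?_, ?_, hYabs, ?_, ?_⟩
  · rw [le_div_iff₀ hΛ]
    refine le_trans (le_of_eq ?_) hX1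
    field_simp
  · rw [div_le_iff₀ hΛ]
    refine le_trans hX2 (le_of_eq ?_)
    field_simp
  · rw [abs_mul]
    -- The hats move the argument by at most `1 / 2`, while `L / δ ≥ 20`; the parameter of the tilt
    -- stays in `[-1/4, 5/4]`.
    have h1 : |bandSlope L a b δ X Y| ≤ 2 := by
      set c := max 0 (min 1 (2 - 2 * |Y| / (δ * L))) with hc
      have hc0 : 0 ≤ c := le_max_left _ _
      have hc1 : c ≤ 1 := clamp_le_one _
      have h2 : |(hat (X - 2) + hat (X - (L / δ - L / 2))) * c| ≤ 1 / 2 := by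
        rw [abs_mul, abs_of_nonneg hc0]
        have h3 := abs_add_le (hat (X - 2)) (hat (X - (L / δ - L / 2)))
        have h4 := abs_hat_le (X - 2)
        have h5 := abs_hat_le (X - (L / δ - L / 2))
        nlinarith [abs_nonneg (hat (X - 2) + hat (X - (L / δ - L / 2)))]
      obtain ⟨h3, h4⟩ := abs_le.1 h2
      refine abs_tilt_le a b ?_ ?_
      · rw [le_div_iff₀ hΛ]; linarith
      · rw [div_le_iff₀ hΛ]; linarith
    nlinarith [abs_nonneg (Y / (δ * L)), abs_nonneg (bandSlope L a b δ X Y)]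
  · ext1
    · simp only [sim_apply, ← hd]
      rw [Complex.mk_eq_add_mul_I]
      push_cast
      field_simp
      ring
    · simp only [sim_apply]
      field_simp

end EdgeChart

/-! ### The chart around an edge in space -/

section EdgeChart

variable {p q d : ℂ} {h : ℝ → ℝ} {a b : ℤˣ} {δ : ℝ} {f : ℤˣ} {κ : ℝ}

/-- The half-turn if `f = -1`, the identity if `f = 1`. -/
noncomputable def signFlip (f : ℤˣ) : Space ≃ₜ Space :=
  if f = 1 then Homeomorph.refl _ else halfTurn

theorem signFlip_apply (f : ℤˣ) (x : Space) :
    signFlip f x = (⟨x.1.re, sgn f * x.1.im⟩, sgn f * x.2) := by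
  rcases Int.units_eq_one_or f with rfl | rfl
  · simp [signFlip, sgn]
  · have : (-1 : ℤˣ) ≠ 1 := by decide
    rw [signFlip, if_neg this, halfTurn_apply]
    ext1
    · apply Complex.ext <;> simp [sgn]
    · simp [sgn]

theorem signFlip_signFlip (f : ℤˣ) (x : Space) : signFlip f (signFlip f x) = x := by
  have hf := sgn_mul_self f
  simp only [signFlip_apply, ← mul_assoc, hf, one_mul]

theorem norm_signFlip_fst (f : ℤˣ) (x : Space) : ‖(signFlip f x).1‖ = ‖x.1‖ := by
  rw [← abs_norm, ← abs_norm x.1, ← sq_eq_sq_iff_abs_eq_abs, norm_sq_eq_re_im, norm_sq_eq_re_im,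
    signFlip_apply, mul_pow, sq (sgn f), sgn_mul_self, one_mul]

theorem abs_signFlip_snd (f : ℤˣ) (x : Space) : |(signFlip f x).2| = |x.2| := by
  rw [signFlip_apply, abs_mul, abs_sgn, one_mul]

theorem signFlip_mem_thinTrefoil_iff {f : ℤˣ} {x : Space} :
    signFlip f x ∈ thinTrefoil ↔ x ∈ thinTrefoil := by
  unfold signFlip
  split_ifs
  · rfl
  · exact halfTurn_mem_thinTrefoil_iff

/-- The part of space around the trefoil at `p` in which the clasping unknots run. -/
def safeZone (p d : ℂ) (δ : ℝ) (hd : d ≠ 0) (hδ : δ ≠ 0) : Set Space :=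
  sim p d δ hd hδ '' safeRegion

theorem mem_safeZone_of_norm {hd : d ≠ 0} {hδ : δ ≠ 0} (hd1 : ‖d‖ = 1) (hδ0 : 0 < δ) {x : Space}
    (hx : 7 * δ ≤ ‖x.1 - p‖) : x ∈ safeZone p d δ hd hδ := by
  obtain ⟨y, rfl⟩ := (sim p d δ hd hδ).surjective x
  refine ⟨y, Or.inl ?_, rfl⟩
  rw [sim_apply] at hx
  simp only [add_sub_cancel_left, norm_mul, Complex.norm_real, hd1, mul_one,
    Real.norm_of_nonneg hδ0.le] at hx
  exact le_of_mul_le_mul_right (by linarith) hδ0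

/-- The angle between the direction `d` and the direction of the edge from `p` to `q`. -/
noncomputable def edgeAngle (p q d : ℂ) : ℝ := (edgeDir p q / d).arg

theorem exp_edgeAngle (hL : 0 < ‖q - p‖) (hd : ‖d‖ = 1) :
    Complex.exp (edgeAngle p q d * Complex.I) = edgeDir p q / d := by
  have h1 : ‖edgeDir p q / d‖ = 1 := by rw [norm_div, norm_edgeDir hL, hd, div_one]
  have := Complex.norm_mul_exp_arg_mul_I (edgeDir p q / d)
  rwa [h1, Complex.ofReal_one, one_mul] at this

theorem edgeDir_div_re_nonneg (hd : ‖d‖ = 1) (hre : 0 ≤ ((starRingEnd ℂ) d * (q - p)).re) :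
    0 ≤ (edgeDir p q / d).re := by
  have h1 : edgeDir p q / d = (starRingEnd ℂ) d * (q - p) / (‖q - p‖ : ℝ) := by
    rw [div_eq_mul_inv _ d, Complex.inv_def, ← Complex.sq_norm, hd, edgeDir]
    simp
    ring
  rw [h1, Complex.div_ofReal_re]
  positivity

theorem vertexChart_symm_of_mem_safeZone {hd : d ≠ 0} {hδ : δ ≠ 0} {β : ℝ} {x : Space}
    (hx : x ∈ safeZone p d δ hd hδ) {e : ℂ} (he : e ≠ 0)
    (heq : d * Complex.exp (β * Complex.I) = e) :
    (vertexChart p d δ hd hδ β).symm x = (sim p e δ he hδ).symm x := by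
  obtain ⟨y, hy, rfl⟩ := hx
  rw [Homeomorph.symm_apply_eq]
  obtain ⟨z, hz⟩ := (sim p e δ he hδ).surjective (sim p d δ hd hδ y)
  rw [← hz, Homeomorph.symm_apply_apply]
  have h1 : y = (Complex.exp (β * Complex.I) * z.1, z.2) := by
    have h2 := Prod.ext_iff.1 hz
    simp only [sim_apply, add_right_inj, ← heq] at h2
    have hδ' : (δ : ℂ) ≠ 0 := by exact_mod_cast hδ
    ext1
    · have h3 : (δ : ℂ) * d * (Complex.exp (β * Complex.I) * z.1) = δ * d * y.1 := by
        rw [← h2.1]; ring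
      exact (mul_left_cancel₀ (mul_ne_zero hδ' hd) h3).symm
    · exact (mul_left_cancel₀ hδ h2.2).symm
  rw [vertexChart_of_safe (h1 ▸ hy), sim_apply, heq]

theorem vertexChart_eventually {hd : d ≠ 0} {hδ : δ ≠ 0} {β : ℝ} :
    ∀ᶠ x : Space in 𝓝 (2, 0), vertexChart p d δ hd hδ β x = sim p d δ hd hδ x := by
  have h1 : ∀ᶠ x : Space in 𝓝 (2, 0), 6 / 5 < ‖x.1‖ :=
    (by fun_prop : Continuous fun x : Space => ‖x.1‖).continuousAt.eventually
      (lt_mem_nhds (by norm_num))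
  have h2 : ∀ᶠ x : Space in 𝓝 (2, 0), ‖x.1‖ < 11 / 2 :=
    (by fun_prop : Continuous fun x : Space => ‖x.1‖).continuousAt.eventually
      (gt_mem_nhds (by norm_num))
  have h3 : ∀ᶠ x : Space in 𝓝 (2, 0), |x.2| < 1 / 10 :=
    (by fun_prop : Continuous fun x : Space => |x.2|).continuousAt.eventually
      (gt_mem_nhds (by norm_num))
  have h4 : ∀ᶠ x : Space in 𝓝 (2, 0), 0 < x.1.re :=
    (by fun_prop : Continuous fun x : Space => x.1.re).continuousAt.eventually
      (lt_mem_nhds (by norm_num))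
  filter_upwards [h1, h2, h3, h4] with x h1 h2 h3 h4
  rw [vertexChart_of_ring h1.le h2.le h3.le, thinning_symm_eq_self (Or.inr (by linarith))]

/-- An edge that leaves its first vertex on the side to which the trefoil there faces. -/
structure EdgeGoodAt (p q : ℂ) (h : ℝ → ℝ) (δ : ℝ) (d : ℂ) : Prop extends EdgeGood p q h δ where
  norm_dir : ‖d‖ = 1
  re_nonneg : 0 ≤ ((starRingEnd ℂ) d * (q - p)).re

theorem EdgeGoodAt.dir_ne_zero (H : EdgeGoodAt p q h δ d) : d ≠ 0 := by
  rw [← norm_pos_iff, H.norm_dir]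
  exact one_pos

theorem EdgeGoodAt.dir_mul_exp (H : EdgeGoodAt p q h δ d) :
    d * Complex.exp (edgeAngle p q d * Complex.I) = edgeDir p q := by
  rw [exp_edgeAngle H.length_pos H.norm_dir, mul_div_cancel₀ _ H.dir_ne_zero]

theorem EdgeGoodAt.norm_quot (H : EdgeGoodAt p q h δ d) : ‖edgeDir p q / d‖ = 1 := by
  rw [norm_div, norm_edgeDir H.length_pos, H.norm_dir, div_one]

theorem EdgeGoodAt.claspingUnknot_subset_safeZone (H : EdgeGoodAt p q h δ d) (a b : ℤˣ) :
    claspingUnknot p q h a b δ ⊆ safeZone p d δ H.dir_ne_zero H.pos.ne' := by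
  rw [← sim_image_bandCurve a b H.toEdgeGood]
  rintro _ ⟨x, hx, rfl⟩
  refine ⟨_, H.mul_mem_safeRegion H.norm_quot (edgeDir_div_re_nonneg H.norm_dir H.re_nonneg) hx, ?_⟩
  have := H.dir_ne_zero
  simp only [sim_apply]
  ext1
  · simp only []
    field_simp
  · rfl

/-- The chart in space around the unknot along an edge. -/
noncomputable def EdgeGoodAt.chart (H : EdgeGoodAt p q h δ d) (a b f : ℤˣ) (hκ : 0 < κ) :
    ℝ × ℝ × ℝ ≃ₜ Space :=
  (H.edgeChart a b f hκ).trans (vertexChart p d δ H.dir_ne_zero H.pos.ne' (edgeAngle p q d))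

theorem EdgeGoodAt.chart_apply (H : EdgeGoodAt p q h δ d) (a b f : ℤˣ) (hκ : 0 < κ)
    (x : ℝ × ℝ × ℝ) : H.chart a b f hκ x =
      vertexChart p d δ H.dir_ne_zero H.pos.ne' (edgeAngle p q d) (H.edgeChart a b f hκ x) := rfl

theorem EdgeGoodAt.chart_of_mem_safeZone (H : EdgeGoodAt p q h δ d) (a b f : ℤˣ) (hκ : 0 < κ)
    {x : ℝ × ℝ × ℝ} (hx : H.chart a b f hκ x ∈ safeZone p d δ H.dir_ne_zero H.pos.ne') :
    H.chart a b f hκ x = sim p (edgeDir p q) δ (edgeDir_ne_zero H.length_pos) H.pos.ne'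
      (H.edgeChart a b f hκ x) := by
  have := vertexChart_symm_of_mem_safeZone hx (edgeDir_ne_zero H.length_pos) H.dir_mul_exp
  rwa [H.chart_apply, Homeomorph.symm_apply_apply, eq_comm, Homeomorph.symm_apply_eq] at this

theorem EdgeGoodAt.chart_mem_claspingUnknot_iff (H : EdgeGoodAt p q h δ d) (a b f : ℤˣ)
    (hκ : 0 < κ) (x : ℝ × ℝ × ℝ) :
    H.chart a b f hκ x ∈ claspingUnknot p q h a b δ ↔ x ∈ modelUnknot := by
  rw [← H.edgeChart_mem_bandCurve_iff a b f hκ]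
  constructor
  · intro hx
    rw [H.chart_of_mem_safeZone a b f hκ (H.claspingUnknot_subset_safeZone a b hx),
      ← sim_image_bandCurve a b H.toEdgeGood] at hx
    exact (Homeomorph.injective _).mem_set_image.1 hx
  · intro hx
    have h1 := Set.mem_image_of_mem
      (sim p (edgeDir p q) δ (edgeDir_ne_zero H.length_pos) H.pos.ne') hx
    rw [sim_image_bandCurve a b H.toEdgeGood] at h1
    have h2 := vertexChart_symm_of_mem_safeZone (H.claspingUnknot_subset_safeZone a b h1)
      (edgeDir_ne_zero H.length_pos) H.dir_mul_exp
    rw [Homeomorph.symm_apply_apply, Homeomorph.symm_apply_eq] at h2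
    rw [H.chart_apply, ← h2]
    exact h1

theorem EdgeGoodAt.chart_image_modelUnknot (H : EdgeGoodAt p q h δ d) (a b f : ℤˣ) (hκ : 0 < κ) :
    H.chart a b f hκ '' modelUnknot = claspingUnknot p q h a b δ := by
  ext y
  constructor
  · rintro ⟨x, hx, rfl⟩
    exact (H.chart_mem_claspingUnknot_iff a b f hκ x).2 hx
  · intro hy
    refine ⟨(H.chart a b f hκ).symm y, ?_, by simp⟩
    rw [← H.chart_mem_claspingUnknot_iff a b f hκ]
    simpa using hy

/-- A common point would lie in the safe zone, where the chart is a similarity composed with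
`edgeChart`; but this composite maps the plate into the band, which misses `C`. -/
theorem EdgeGoodAt.chart_notMem (H : EdgeGoodAt p q h δ d) (a b f : ℤˣ) (hκ : 0 < κ)
    {x : ℝ × ℝ × ℝ} (hx : x ∈ plate) {C : Set Space}
    (hC : C ⊆ safeZone p d δ H.dir_ne_zero H.pos.ne') (hCb : Disjoint C (band p q h δ)) :
    H.chart a b f hκ x ∉ C := by
  intro hxC
  refine Set.disjoint_left.1 hCb hxC ?_
  rw [H.chart_of_mem_safeZone a b f hκ (hC hxC)]
  exact H.sim_edgeChart_mem_band a b f hκ hx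

/-- In this range the trefoil is its straight side with real part `2` and height `0`. There the
slope equals the tilt used in `edgeFun`, so the two contributions of the third coordinate to the
height cancel: this coordinate runs along the side of the trefoil. -/
theorem EdgeGood.edgeChart_mem_thinTrefoil_iff (H : EdgeGood p q h δ) (a b f : ℤˣ) (hκ : 0 < κ)
    {x : ℝ × ℝ × ℝ} (h1 : |x.1| ≤ 11 / 10) (h2 : |x.2.1| ≤ 11 / 10) (h3 : κ * |x.2.2| ≤ 1) :
    H.edgeChart a b f hκ x ∈ thinTrefoil ↔ x.1 = 0 ∧ x.2.1 = 0 := by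
  have hδ := H.pos
  have hδ1 := H.le_tenth
  have hL := H.length_pos
  have hl2 := H.length_le
  have h20 := H.twenty_le
  have hω : 0 < δ * ‖q - p‖ := by positivity
  have hm := H.tilt_ne_zero a b
  have hf0 := sgn_ne_zero f
  have ha0 := sgn_ne_zero a
  have h0 : edgeCoord ‖q - p‖ δ x.1 = 2 ↔ x.1 = 0 := by
    rw [← edgeCoord_zero ‖q - p‖ δ, H.edgeCoord_strictMono.injective.eq_iff]
  rw [H.edgeChart_apply]
  set L := ‖q - p‖
  have hX : -1 / 4 ≤ edgeCoord L δ x.1 := by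
    have h4 := mul_nonneg (by linarith : 0 ≤ 2 * (L / δ - 4)) (le_max_left 0 (x.1 - 1 / 2))
    have h5 := (abs_le.1 h1).1
    unfold edgeCoord
    nlinarith
  have hY : |-(sgn f * sgn a * (δ * L) * x.2.1) + sgn f * κ * x.2.2| < 2 := by
    have h4 := abs_add_le (-(sgn f * sgn a * (δ * L) * x.2.1)) (sgn f * κ * x.2.2)
    rw [abs_neg, abs_mul (sgn f * sgn a * (δ * L)), abs_mul (sgn f * sgn a), abs_mul (sgn f),
      abs_mul (sgn f * κ), abs_mul (sgn f), abs_sgn, abs_sgn, abs_of_pos hω,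
      abs_of_pos hκ, one_mul, one_mul, one_mul] at h4
    have h5 : δ * L ≤ 1 / 5 := by nlinarith
    nlinarith [abs_nonneg x.2.1]
  rw [mem_thinTrefoil_iff_of_right hX hY]
  simp only [edgeFun]
  rw [h0]
  refine and_congr_right fun hx0 => ?_
  have hX2 := h0.2 hx0
  have hslope : bandSlope L a b δ (edgeCoord L δ x.1)
      (-(sgn f * sgn a * (δ * L) * x.2.1) + sgn f * κ * x.2.2) = tilt a b (2 / (L / δ)) := by
    unfold bandSlope
    rw [hX2, sub_self, hat_eq_self (by norm_num), hat_eq_zero]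
    · simp
    · rw [le_abs]; right; linarith
  have hh : h (2 / (L / δ)) = 0 := by
    refine H.flat_left _ ?_
    rw [abs_of_nonneg (by positivity)]
    calc 2 / (L / δ) * L = 2 * δ := by field_simp
      _ ≤ _ := by linarith
  rw [hslope, hX2, hh]
  have key : 0 / δ - sgn f * (tilt a b (2 / (L / δ)) * κ / (δ * L)) * x.2.2 +
      (-(sgn f * sgn a * (δ * L) * x.2.1) + sgn f * κ * x.2.2) / (δ * L) *
        tilt a b (2 / (L / δ)) = -(sgn f * sgn a * tilt a b (2 / (L / δ))) * x.2.1 := by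
    generalize tilt a b (2 / (L / δ)) = m
    field_simp
    ring
  rw [key, mul_eq_zero, neg_eq_zero]
  have : sgn f * sgn a * tilt a b (2 / (L / δ)) ≠ 0 := by positivity
  tauto

/-! ### A neighbourhood of the plate free of other components, and the chart near the two clasps. -/

theorem isCompact_plate : IsCompact plate := by
  have : plate = Set.Icc (-1, -1, 0) (1, 1, 0) := by
    ext x
    simp only [plate, Set.mem_ofPred_eq, Set.mem_Icc, Prod.le_def, abs_le]
    constructor
    · rintro ⟨⟨h1, h2⟩, ⟨h3, h4⟩, h5⟩
      exact ⟨⟨h1, h3, h5.ge⟩, h2, h4, h5.le⟩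
    · rintro ⟨⟨h1, h3, h5⟩, h2, h4, h6⟩
      exact ⟨⟨h1, h2⟩, ⟨h3, h4⟩, le_antisymm h6 h5⟩
  rw [this]
  exact isCompact_Icc

theorem exists_box_around_plate {C : Set (ℝ × ℝ × ℝ)} (hC : IsClosed C) (h : Disjoint plate C) :
    ∃ ε > 0, ∀ x : ℝ × ℝ × ℝ, |x.1| < 1 + ε → |x.2.1| < 1 + ε → |x.2.2| < ε → x ∉ C := by
  obtain ⟨ε, hε, hsub⟩ := isCompact_plate.exists_thickening_subset_open hC.isOpen_compl
    (Set.subset_compl_iff_disjoint_right.2 h)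
  refine ⟨ε, hε, fun x h1 h2 h3 => hsub ?_⟩
  have hclamp : ∀ u : ℝ, |u| < 1 + ε → ∃ v, |v| ≤ 1 ∧ |u - v| < ε := by
    intro u hu
    obtain ⟨hu1, hu2⟩ := abs_lt.1 hu
    rcases le_total u (-1) with h | h
    · exact ⟨-1, by norm_num, abs_lt.2 ⟨by linarith, by linarith⟩⟩
    rcases le_total u 1 with h' | h'
    · exact ⟨u, abs_le.2 ⟨h, h'⟩, by simpa using hε⟩
    · exact ⟨1, by norm_num, abs_lt.2 ⟨by linarith, by linarith⟩⟩
  obtain ⟨v1, hv1, hd1⟩ := hclamp _ h1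
  obtain ⟨v2, hv2, hd2⟩ := hclamp _ h2
  refine Metric.mem_thickening_iff.2 ⟨(v1, v2, 0), ⟨hv1, hv2, rfl⟩, ?_⟩
  rw [Prod.dist_eq, Prod.dist_eq, Real.dist_eq, Real.dist_eq, Real.dist_eq, sub_zero]
  exact max_lt hd1 (max_lt hd2 h3)

theorem EdgeGoodAt.chart_scale (H : EdgeGoodAt p q h δ d) (a b f : ℤˣ) (hκ : 0 < κ)
    (x : ℝ × ℝ × ℝ) : H.chart a b f hκ x = H.chart a b f one_pos (x.1, x.2.1, κ * x.2.2) := by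
  rw [H.chart_apply, H.chart_apply, H.edgeChart_apply, H.edgeChart_apply]
  congr 1
  simp only [edgeFun, mul_one]
  ext1
  · simp only [mul_assoc]
  · simp only []
    rw [← mul_assoc (sgn f) κ]
    ring

/-- The vertical line through the centre of the plate. -/
def plateAxis : Submodule ℝ (ℝ × ℝ × ℝ) where
  carrier := {x | x.1 = 0 ∧ x.2.1 = 0}
  add_mem' := by
    rintro x y ⟨h1, h2⟩ ⟨h3, h4⟩
    exact ⟨by simp [h1, h3], by simp [h2, h4]⟩
  zero_mem' := ⟨rfl, rfl⟩
  smul_mem' := by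
    rintro c x ⟨h1, h2⟩
    exact ⟨by simp [h1], by simp [h2]⟩

theorem mem_plateAxis {x : ℝ × ℝ × ℝ} : x ∈ plateAxis ↔ x.1 = 0 ∧ x.2.1 = 0 := Iff.rfl

/-- By compactness a thin box around the plate misses the other components. The factor `κ`
compresses the third coordinate so that a whole ball of radius `R > 1` in the sup norm is mapped
into this box. -/
theorem EdgeGoodAt.exists_meetsInLine (H : EdgeGoodAt p q h δ d) (a b f : ℤˣ) {ι : Type*}
    [Finite ι] (C : ι → Set Space) (hC : ∀ i, C i = trefoil p d δ ∨
      (IsClosed (C i) ∧ C i ⊆ safeZone p d δ H.dir_ne_zero H.pos.ne' ∧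
        Disjoint (C i) (band p q h δ))) :
    ∃ κ, ∃ hκ : 0 < κ, ∃ R > 1, ∀ i, (C i = trefoil p d δ ∧
        ∀ x, ‖x‖ < R → (H.chart a b f hκ x ∈ C i ↔ x ∈ plateAxis)) ∨
      (C i ≠ trefoil p d δ ∧ ∀ x, ‖x‖ < R → H.chart a b f hκ x ∉ C i) := by
  classical
  let D : Set (ℝ × ℝ × ℝ) :=
    ⋃ i : {i // C i ≠ trefoil p d δ}, H.chart a b f one_pos ⁻¹' C i
  have hD : IsClosed D := isClosed_iUnion_of_finite fun i =>
    ((hC i).resolve_left i.2).1.preimage (Homeomorph.continuous _)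
  have hdisj : Disjoint plate D := by
    rw [Set.disjoint_left]
    intro x hx hxD
    obtain ⟨i, hi⟩ := Set.mem_iUnion.1 hxD
    have := (hC i).resolve_left i.2
    exact H.chart_notMem a b f one_pos hx this.2.1 this.2.2 hi
  obtain ⟨ε, hε, hbox⟩ := exists_box_around_plate hD hdisj
  have hκ : 0 < min ε 1 / 2 := by positivity
  refine ⟨min ε 1 / 2, hκ, 1 + min ε (1 / 10), by simp [hε], fun i => ?_⟩
  have hR1 : 1 + min ε (1 / 10) ≤ 1 + ε := by linarith [min_le_left ε (1 / 10)]
  have hR2 : 1 + min ε (1 / 10) ≤ 11 / 10 := by linarith [min_le_right ε (1 / 10)]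
  have hnorm : ∀ x : ℝ × ℝ × ℝ, ‖x‖ < 1 + min ε (1 / 10) → |x.1| < 1 + min ε (1 / 10) ∧
      |x.2.1| < 1 + min ε (1 / 10) ∧ |x.2.2| < 1 + min ε (1 / 10) := by
    intro x hx
    rw [Prod.norm_def, Prod.norm_def, max_lt_iff, max_lt_iff] at hx
    exact hx
  by_cases hi : C i = trefoil p d δ
  · refine Or.inl ⟨hi, fun x hx => ?_⟩
    obtain ⟨h1, h2, h3⟩ := hnorm x hx
    rw [hi, H.chart_apply, vertexChart_mem_trefoil_iff,
      H.edgeChart_mem_thinTrefoil_iff a b f hκ (h1.le.trans hR2) (h2.le.trans hR2), mem_plateAxis]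
    have := min_le_right ε 1
    nlinarith [abs_nonneg x.2.2]
  · refine Or.inr ⟨hi, fun x hx hxC => ?_⟩
    obtain ⟨h1, h2, h3⟩ := hnorm x hx
    rw [H.chart_scale] at hxC
    refine hbox (x.1, x.2.1, min ε 1 / 2 * x.2.2) (h1.trans_le hR1) (h2.trans_le hR1) ?_
      (Set.mem_iUnion.2 ⟨⟨i, hi⟩, hxC⟩)
    simp only []
    rw [abs_mul, abs_of_pos hκ]
    have := min_le_left ε 1
    have := min_le_right ε 1
    nlinarith [abs_nonneg x.2.2]

/-- The affine map that describes the chart near the first clasp. -/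
noncomputable def edgeGerm (L : ℝ) (a b : ℤˣ) (δ κ : ℝ) (x : ℝ × ℝ × ℝ) : Space :=
  (⟨2 + (2 - L / 2) * x.1, -(sgn a * (δ * L) * x.2.1) + κ * x.2.2⟩,
    -(sgn a * tilt a b (2 / (L / δ)) * x.2.1))

/-- Near the first clasp the edge is flat, `edgeCoord` is linear and `hat` makes the slope constant,
so the chart is affine. -/
theorem EdgeGoodAt.chart_eventually_start (H : EdgeGoodAt p q h δ d) (a b f : ℤˣ) (hκ : 0 < κ) :
    ∀ᶠ x in 𝓝 0, H.chart a b f hκ x = sim p d δ H.dir_ne_zero H.pos.ne'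
      (signFlip f (edgeGerm ‖q - p‖ a b δ κ x)) := by
  have hδ := H.pos
  have hL := H.length_pos
  have hl2 := H.length_le
  have h20 := H.twenty_le
  have hω : 0 < δ * ‖q - p‖ := by positivity
  set L := ‖q - p‖
  have e1 : ∀ᶠ x : ℝ × ℝ × ℝ in 𝓝 0, |x.1| < 1 / 8 :=
    (by fun_prop : Continuous fun x : ℝ × ℝ × ℝ => |x.1|).continuousAt.eventually
      (gt_mem_nhds (by norm_num))
  have e2 : ∀ᶠ x : ℝ × ℝ × ℝ in 𝓝 0,
      |-(sgn f * sgn a * (δ * L) * x.2.1) + sgn f * κ * x.2.2| < δ * L / 2 :=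
    (by fun_prop : Continuous fun x : ℝ × ℝ × ℝ =>
      |-(sgn f * sgn a * (δ * L) * x.2.1) + sgn f * κ * x.2.2|).continuousAt.eventually
      (gt_mem_nhds (by simpa using hω))
  have hcg : Continuous fun x => signFlip f (edgeGerm L a b δ κ x) := by
    refine (signFlip f).continuous.comp ?_
    unfold edgeGerm
    simp only [Complex.mk_eq_add_mul_I]
    fun_prop
  have e3 : Filter.Tendsto (fun x => signFlip f (edgeGerm L a b δ κ x)) (𝓝 0) (𝓝 (2, 0)) := by
    convert hcg.tendsto 0 using 2
    rw [signFlip_apply]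
    ext1
    · apply Complex.ext <;> simp [edgeGerm]
    · simp [edgeGerm]
  filter_upwards [e1, e2, e3.eventually (vertexChart_eventually (p := p) (d := d)
    (hd := H.dir_ne_zero) (hδ := H.pos.ne') (β := edgeAngle p q d))] with x h1 h2 h3
  rw [H.chart_apply, ← h3]
  congr 1
  rw [H.edgeChart_apply, signFlip_apply]
  obtain ⟨k1, k2⟩ := abs_lt.1 h1
  have hX : edgeCoord L δ x.1 = 2 + (2 - L / 2) * x.1 := by
    rw [edgeCoord, max_eq_left (by linarith), mul_zero, add_zero]
  have hXlt : |(2 - L / 2) * x.1| ≤ 1 / 4 := by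
    rw [abs_mul, abs_of_nonneg (by linarith)]
    nlinarith
  obtain ⟨k3, k4⟩ := abs_le.1 hXlt
  have hslope : bandSlope L a b δ (edgeCoord L δ x.1)
      (-(sgn f * sgn a * (δ * L) * x.2.1) + sgn f * κ * x.2.2) = tilt a b (2 / (L / δ)) := by
    unfold bandSlope
    rw [hX, add_sub_cancel_left, hat_eq_self hXlt, hat_eq_zero, clamp_eq_one]
    · congr 1
      ring
    · have : 2 * |-(sgn f * sgn a * (δ * L) * x.2.1) + sgn f * κ * x.2.2| / (δ * L) ≤ 1 := by
        rw [div_le_one hω]; linarith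
      linarith
    · rw [le_abs]; right; linarith
  have hh : h (edgeCoord L δ x.1 / (L / δ)) = 0 := by
    refine H.flat_left _ ?_
    rw [hX, abs_of_nonneg (div_nonneg (by linarith) (by linarith))]
    calc (2 + (2 - L / 2) * x.1) / (L / δ) * L = (2 + (2 - L / 2) * x.1) * δ := by field_simp
      _ ≤ _ := by gcongr; linarith
  simp only [edgeFun, edgeGerm]
  rw [hslope, hh, hX]
  ext1
  · apply Complex.ext
    · rfl
    · simp only []
      ring
  · simp only []
    have hL0 : ‖q - p‖ ≠ 0 := hL.ne'
    generalize tilt a b (2 / (L / δ)) = m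
    field_simp
    ring

/-- The height and the offset, in the chart near the second clasp. -/
theorem EdgeGoodAt.chart_eventually_end (H : EdgeGoodAt p q h δ d) (a b f : ℤˣ) (hκ : 0 < κ) :
    ∀ᶠ x in 𝓝 ((1, 0, 0) : ℝ × ℝ × ℝ), ∀ Y : ℝ,
      Y = -(sgn f * sgn a * (δ * ‖q - p‖) * x.2.1) + sgn f * κ * x.2.2 →
      H.chart a b f hκ x = (q + δ * edgeDir q p *
          ⟨‖q - p‖ / 2 - (2 - ‖q - p‖ / 2 + 2 * (‖q - p‖ / δ - 4)) * (x.1 - 1), -Y⟩,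
        δ * (-(sgn f * (tilt a b (2 / (‖q - p‖ / δ)) * κ / (δ * ‖q - p‖)) * x.2.2) +
          Y / (δ * ‖q - p‖) * tilt a b (1 - δ / 2))) := by
  have hδ := H.pos
  have hL := H.length_pos
  have hl2 := H.length_le
  have h20 := H.twenty_le
  have hω : 0 < δ * ‖q - p‖ := by positivity
  have hdL := edgeDir_mul_length hL
  set L := ‖q - p‖
  set S := 2 - L / 2 + 2 * (L / δ - 4) with hS
  have hSpos : 0 < S := by linarith
  have e1 : ∀ᶠ x : ℝ × ℝ × ℝ in 𝓝 (1, 0, 0), |S * (x.1 - 1)| < 1 / 4 :=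
    (by fun_prop : Continuous fun x : ℝ × ℝ × ℝ => |S * (x.1 - 1)|).continuousAt.eventually
      (gt_mem_nhds (by norm_num))
  have e2 : ∀ᶠ x : ℝ × ℝ × ℝ in 𝓝 (1, 0, 0),
      |-(sgn f * sgn a * (δ * L) * x.2.1) + sgn f * κ * x.2.2| < δ * L / 2 :=
    (by fun_prop : Continuous fun x : ℝ × ℝ × ℝ =>
      |-(sgn f * sgn a * (δ * L) * x.2.1) + sgn f * κ * x.2.2|).continuousAt.eventually
      (gt_mem_nhds (by simpa using hω))
  filter_upwards [e1, e2] with x h1 h2 Y hY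
  rw [← hY] at h2
  obtain ⟨k1, k2⟩ := abs_lt.1 h1
  have hx1 : -1 / 2 ≤ x.1 - 1 := by
    by_contra hcon
    nlinarith
  have hX : edgeCoord L δ x.1 = L / δ - L / 2 + S * (x.1 - 1) := by
    rw [edgeCoord, max_eq_right (by linarith), hS]
    ring
  have hslope : bandSlope L a b δ (edgeCoord L δ x.1) Y = tilt a b (1 - δ / 2) := by
    unfold bandSlope
    rw [hX, add_sub_cancel_left, hat_eq_zero, hat_eq_self h1.le, clamp_eq_one]
    · congr 1
      field_simp
      ring
    · have : 2 * |Y| / (δ * L) ≤ 1 := by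
        rw [div_le_one hω]; linarith
      linarith
    · rw [le_abs]; left; linarith
  have hh : h (edgeCoord L δ x.1 / (L / δ)) = 0 := by
    refine H.flat_right _ ?_
    have h3 : 1 - edgeCoord L δ x.1 / (L / δ) = (L / 2 - S * (x.1 - 1)) / (L / δ) := by
      rw [hX]
      field_simp
      ring
    have h4 : |L / 2 - S * (x.1 - 1)| ≤ 7 := abs_le.2 ⟨by linarith, by linarith⟩
    rw [h3, abs_div, abs_of_nonneg (by linarith : 0 ≤ L / δ)]
    calc |L / 2 - S * (x.1 - 1)| / (L / δ) * L = |L / 2 - S * (x.1 - 1)| * δ := by field_simp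
      _ ≤ _ := by gcongr
  have hchart : H.edgeChart a b f hκ x = (⟨L / δ - L / 2 + S * (x.1 - 1), Y⟩,
      -(sgn f * (tilt a b (2 / (L / δ)) * κ / (δ * L)) * x.2.2) +
        Y / (δ * L) * tilt a b (1 - δ / 2)) := by
    rw [H.edgeChart_apply]
    simp only [edgeFun]
    rw [← hY, hslope, hh, hX]
    ext1
    · rfl
    · simp only []
      ring
  rw [H.chart_apply, hchart, vertexChart_of_safe, H.dir_mul_exp]
  · ext1
    · simp only [edgeDir_symm p q, Complex.mk_eq_add_mul_I]
      have hq : q = p + edgeDir p q * L := by rw [hdL]; ring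
      conv_rhs => rw [hq]
      push_cast
      have hδ' : (δ : ℂ) ≠ 0 := by exact_mod_cast hδ.ne'
      rw [show edgeDir p (p + edgeDir p q * L) = edgeDir p q by rw [← hq]]
      field_simp
      ring
    · rfl
  · left
    simp only [norm_mul, Complex.norm_exp_ofReal_mul_I, one_mul]
    refine le_trans ?_ (Complex.re_le_norm _)
    simp only []
    linarith

end EdgeChart

/-! ### The chart around a trefoil at the end of an edge -/

section TrefoilChart

/-- The scaling of the chart around a trefoil. -/
noncomputable def trefoilScale : Space ≃ₜ Space where
  toFun x := ((11 / 2 : ℝ) * x.1, x.2 / 8)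
  invFun x := ((2 / 11 : ℝ) * x.1, x.2 * 8)
  left_inv x := by
    ext1
    · simp only []
      push_cast
      ring
    · simp
  right_inv x := by
    ext1
    · simp only []
      push_cast
      ring
    · simp
  continuous_toFun := by fun_prop
  continuous_invFun := by fun_prop

theorem trefoilScale_apply (x : Space) : trefoilScale x = ((11 / 2 : ℝ) * x.1, x.2 / 8) := rfl

/-- The point at height `z` at which the unknot crosses the disc of the lobe. -/
noncomputable def clasperCenter (L δ m : ℝ) (u : ℂ) (z : ℝ) : ℂ :=
  u * ⟨L / 2, δ * L * max (-1 / 2) (min (1 / 2) z) / m⟩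

theorem norm_clasperCenter_le {L δ m : ℝ} {u : ℂ} (hδ : 0 < δ) (hδ1 : δ ≤ 1 / 10) (hL : 0 < L)
    (hL2 : L ≤ 2) (hm : 9 / 10 ≤ |m|) (hu : ‖u‖ = 1) (z : ℝ) :
    ‖clasperCenter L δ m u z‖ ≤ 51 / 50 := by
  rw [clasperCenter, norm_mul, hu, one_mul]
  refine norm_le_of_re_im ?_ ?_
  · simp only []
    rw [abs_of_pos (by linarith)]
    linarith
  · simp only []
    have h1 : |max (-1 / 2) (min (1 / 2) z)| ≤ 1 / 2 :=
      abs_le.2 ⟨(by norm_num : -(1 / 2 : ℝ) ≤ -1 / 2).trans (le_max_left _ _),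
        max_le (by norm_num) (min_le_left _ _)⟩
    have h2 : δ * L ≤ 1 / 5 := by nlinarith
    rw [abs_div, abs_mul, abs_of_pos (by positivity), div_le_iff₀ (by linarith)]
    nlinarith [abs_nonneg (max (-1 / 2) (min (1 / 2) z))]

/-- A cutoff function of the distance. -/
noncomputable def shiftCutoff (r : ℝ) : ℝ := max 0 (min 1 (21 / 20 * (1 - r / (11 / 10))))

theorem shiftCutoff_eq_zero {r : ℝ} (h : 11 / 10 ≤ r) : shiftCutoff r = 0 :=
  clamp_eq_zero (by linarith)

theorem shiftCutoff_eq_one {r : ℝ} (h : r ≤ 1 / 20) : shiftCutoff r = 1 :=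
  clamp_eq_one (by linarith)

/-- In each horizontal plane the displacement is a contraction: the slope `21 / 22` of the cutoff
times `51 / 50` is below `99 / 100`. The vertical axis is moved to the curve `c`. -/
theorem exists_shift {c : ℝ → ℂ} (hc : Continuous c) (hc1 : ∀ z, ‖c z‖ ≤ 51 / 50) :
    ∃ Φ : Space ≃ₜ Space, ∀ x, Φ x = (x.1 + (shiftCutoff ‖x.1‖ : ℂ) * c x.2, x.2) := by
  have hcs : Continuous shiftCutoff := by
    unfold shiftCutoff
    fun_prop
  obtain ⟨Φ, hΦ⟩ := exists_fiberHomeo (E := ℝ) (F := ℂ)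
    (f := fun x => (shiftCutoff ‖x.2‖ : ℂ) * c x.1)
    (by fun_prop) (99 / 100) (by norm_num) (fun x v w => by
      rw [← sub_mul, norm_mul, ← Complex.ofReal_sub, Complex.norm_real, Real.norm_eq_abs]
      have h1 : |shiftCutoff ‖v‖ - shiftCutoff ‖w‖| ≤ 21 / 22 * ‖v - w‖ := by
        refine (abs_clamp_sub_le _ _).trans ?_
        rw [show 21 / 20 * (1 - ‖v‖ / (11 / 10)) - 21 / 20 * (1 - ‖w‖ / (11 / 10)) =
          -(21 / 22 * (‖v‖ - ‖w‖)) by ring, abs_neg, abs_mul, abs_of_pos (by norm_num)]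
        exact mul_le_mul_of_nonneg_left (abs_norm_sub_norm_le v w) (by norm_num)
      calc _ ≤ 21 / 22 * ‖v - w‖ * (51 / 50) := by
            gcongr
            exact hc1 x
        _ ≤ _ := by nlinarith [norm_nonneg (v - w)])
  refine ⟨(Homeomorph.prodComm ℂ ℝ).trans (Φ.trans (Homeomorph.prodComm ℝ ℂ)), fun x => ?_⟩
  simp [hΦ]

variable {p q d : ℂ} {h : ℝ → ℝ} {a b : ℤˣ} {δ : ℝ} {f : ℤˣ} {κ : ℝ}

theorem EdgeGood.le_abs_tilt_half (H : EdgeGood p q h δ) (a b : ℤˣ) :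
    9 / 10 ≤ |tilt a b (δ / 2)| := by
  have := H.pos
  have := H.le_tenth
  linarith [le_abs_tilt a b (t := δ / 2) (by linarith)]

theorem EdgeGoodAt.exists_shift (H : EdgeGoodAt p q h δ d) (a b : ℤˣ) :
    ∃ Φ : Space ≃ₜ Space, ∀ x, Φ x = (x.1 + (shiftCutoff ‖x.1‖ : ℂ) *
      clasperCenter ‖q - p‖ δ (tilt a b (δ / 2)) (edgeDir p q / d) x.2, x.2) := by
  refine _root_.exists_shift ?_ fun z => norm_clasperCenter_le H.pos H.le_tenth H.length_pos
    H.length_le (H.le_abs_tilt_half a b) H.norm_quot z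
  unfold clasperCenter
  simp only [Complex.mk_eq_add_mul_I]
  fun_prop

/-- The homeomorphism of space that moves the unknot along the edge to a vertical line. -/
noncomputable def EdgeGoodAt.shift (H : EdgeGoodAt p q h δ d) (a b : ℤˣ) : Space ≃ₜ Space :=
  (H.exists_shift a b).choose

theorem EdgeGoodAt.shift_apply (H : EdgeGoodAt p q h δ d) (a b : ℤˣ) (x : Space) :
    H.shift a b x = (x.1 + (shiftCutoff ‖x.1‖ : ℂ) *
      clasperCenter ‖q - p‖ δ (tilt a b (δ / 2)) (edgeDir p q / d) x.2, x.2) :=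
  (H.exists_shift a b).choose_spec x

theorem EdgeGoodAt.shift_of_le (H : EdgeGoodAt p q h δ d) (a b : ℤˣ) {x : Space}
    (hx : 11 / 10 ≤ ‖x.1‖) : H.shift a b x = x := by
  rw [H.shift_apply, shiftCutoff_eq_zero hx]
  simp

/-- The chart around the trefoil at the beginning of an edge. -/
noncomputable def EdgeGoodAt.endChart (H : EdgeGoodAt p q h δ d) (a b g : ℤˣ) : Space ≃ₜ Space :=
  (trefoilScale.trans (signFlip g)).trans
    ((H.shift a b).trans (vertexChart p d δ H.dir_ne_zero H.pos.ne' 0))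

theorem EdgeGoodAt.endChart_apply (H : EdgeGoodAt p q h δ d) (a b g : ℤˣ) (x : Space) :
    H.endChart a b g x = vertexChart p d δ H.dir_ne_zero H.pos.ne' 0
      (H.shift a b (signFlip g (trefoilScale x))) := rfl

/-- The trefoil in the chart around it. -/
def modelTrefoil : Set Space := trefoilScale ⁻¹' thinTrefoil

theorem norm_of_mem_modelTrefoil {x : Space} (hx : x ∈ modelTrefoil) :
    1 / 5 ≤ ‖x‖ ∧ ‖x‖ ≤ 1 := by
  obtain ⟨h1, h2, h3⟩ := thinTrefoil_norm_bounds hx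
  rw [trefoilScale_apply] at h1 h2 h3
  simp only [norm_mul, Complex.norm_real] at h1 h2
  rw [Real.norm_of_nonneg (by norm_num)] at h1 h2
  simp only [abs_div] at h3
  rw [abs_of_pos (by norm_num : (0 : ℝ) < 8)] at h3
  rw [Prod.norm_def, Real.norm_eq_abs]
  exact ⟨le_trans (by linarith) (le_max_left _ _), max_le (by linarith) (by linarith)⟩

/-- The shift acts only within radius `11 / 10`, the thin trefoil lies beyond `6 / 5`, and the sign
flip preserves it. -/
theorem EdgeGoodAt.endChart_image_modelTrefoil (H : EdgeGoodAt p q h δ d) (a b g : ℤˣ) :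
    H.endChart a b g '' modelTrefoil = trefoil p d δ := by
  have key : ∀ x ∈ modelTrefoil, H.endChart a b g x =
      vertexChart p d δ H.dir_ne_zero H.pos.ne' 0 (signFlip g (trefoilScale x)) := by
    intro x hx
    obtain ⟨h1, -⟩ := thinTrefoil_norm_bounds hx
    rw [H.endChart_apply, H.shift_of_le]
    rw [norm_signFlip_fst]
    linarith
  rw [← vertexChart_image_thinTrefoil p d δ H.dir_ne_zero H.pos.ne' 0, Set.image_congr key]
  ext y
  constructor
  · rintro ⟨x, hx, rfl⟩
    exact ⟨_, signFlip_mem_thinTrefoil_iff.2 hx, rfl⟩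
  · rintro ⟨x, hx, rfl⟩
    refine ⟨trefoilScale.symm (signFlip g x), ?_, ?_⟩
    · rw [modelTrefoil, Set.mem_preimage, Homeomorph.apply_symm_apply]
      exact signFlip_mem_thinTrefoil_iff.2 hx
    · simp only []
      rw [Homeomorph.apply_symm_apply, signFlip_signFlip]

/-- The vertical line. -/
def heightAxis : Submodule ℝ Space where
  carrier := {x | x.1 = 0}
  add_mem' := by
    rintro x y h1 h2
    simp only [Set.mem_ofPred_eq, Prod.fst_add] at *
    rw [h1, h2, add_zero]
  zero_mem' := rfl
  smul_mem' := by
    rintro c x h1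
    simp only [Set.mem_ofPred_eq, Prod.smul_fst] at *
    rw [h1, smul_zero]

theorem mem_heightAxis {x : Space} : x ∈ heightAxis ↔ x.1 = 0 := Iff.rfl

theorem EdgeGoodAt.norm_shift_lt (H : EdgeGoodAt p q h δ d) (a b g : ℤˣ) {x : Space}
    (hx : ‖x‖ < 11 / 10) : ‖(H.shift a b (signFlip g (trefoilScale x))).1‖ < 7 ∧
      |(H.shift a b (signFlip g (trefoilScale x))).2| < 1 / 5 := by
  rw [Prod.norm_def, max_lt_iff, Real.norm_eq_abs] at hx
  have h1 : ‖(signFlip g (trefoilScale x)).1‖ < 121 / 20 := by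
    rw [norm_signFlip_fst, trefoilScale_apply]
    simp only [norm_mul, Complex.norm_real]
    rw [Real.norm_of_nonneg (by norm_num)]
    linarith
  have h2 : |(signFlip g (trefoilScale x)).2| < 1 / 5 := by
    rw [abs_signFlip_snd, trefoilScale_apply]
    simp only [abs_div]
    rw [abs_of_pos (by norm_num : (0 : ℝ) < 8)]
    linarith
  set y := signFlip g (trefoilScale x)
  constructor
  · rcases le_total (11 / 10) ‖y.1‖ with h3 | h3
    · rw [H.shift_of_le a b h3]
      linarith
    · rw [H.shift_apply]
      refine lt_of_le_of_lt (norm_add_le _ _) ?_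
      have h0 : 0 ≤ shiftCutoff ‖y.1‖ := le_max_left _ _
      rw [norm_mul, Complex.norm_real, Real.norm_of_nonneg h0]
      have h4 : shiftCutoff ‖y.1‖ ≤ 1 := clamp_le_one _
      have h5 := norm_clasperCenter_le H.pos H.le_tenth H.length_pos
        H.length_le (H.le_abs_tilt_half a b) H.norm_quot y.2
      have := mul_le_mul h4 h5 (norm_nonneg _) zero_le_one
      linarith
  · rw [H.shift_apply]
    exact h2

theorem norm_thinning_symm_lt {x : Space} (hx : ‖x.1‖ < 7) : ‖(thinning.symm x).1‖ < 7 := by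
  by_contra hcon
  have h1 := thinning_eq_self (Or.inl (not_lt.1 hcon))
  rw [Homeomorph.apply_symm_apply] at h1
  rw [← h1] at hcon
  exact hcon hx

theorem twist_zero (x : Space) : twist 0 x = x := by
  simp [twist_apply]

/-- The chart maps this ball into the open cylinder of radius `7 δ` over `p`. -/
theorem EdgeGoodAt.endChart_notMem (H : EdgeGoodAt p q h δ d) (a b g : ℤˣ) {x : Space}
    (hx : ‖x‖ < 11 / 10) {C : Set Space} (hC : ∀ y ∈ C, 7 * δ ≤ ‖y.1 - p‖) :
    H.endChart a b g x ∉ C := by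
  intro hxC
  have h1 := hC _ hxC
  have h2 := norm_thinning_symm_lt (H.norm_shift_lt a b g hx).1
  rw [H.endChart_apply, vertexChart] at h1
  simp only [Homeomorph.trans_apply, twist_zero, sim_apply, add_sub_cancel_left, norm_mul,
    Complex.norm_real, H.norm_dir, mul_one, Real.norm_of_nonneg H.pos.le] at h1
  have := H.pos
  nlinarith

/-- Heights in the ball are below `1 / 5` in units of `δ`, which leaves only the end segment of the
unknot. It is the graph of `clasperCenter` over the height, and the shift carries the vertical axis
onto it. -/
theorem EdgeGoodAt.endChart_mem_claspingUnknot_iff (H : EdgeGoodAt p q h δ d) (a b g : ℤˣ)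
    {x : Space} (hx : ‖x‖ < 11 / 10) :
    H.endChart a b g x ∈ claspingUnknot p q h a b δ ↔ x ∈ heightAxis := by
  have hδ := H.pos
  have hL := H.length_pos
  have hl2 := H.length_le
  have h20 := H.twenty_le
  have hω : 0 < δ * ‖q - p‖ := by positivity
  have hm := H.le_abs_tilt_half a b
  have hm0 : tilt a b (δ / 2) ≠ 0 := by
    intro h0
    rw [h0, abs_zero] at hm
    linarith
  have hquot := H.norm_quot
  have hu0 : edgeDir p q / d ≠ 0 := by
    rw [← norm_pos_iff, hquot]; exact one_pos
  obtain ⟨k1, k2⟩ := H.norm_shift_lt a b g hx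
  have key : ∀ y : Space, ‖y.1‖ < 7 → |y.2| < 1 / 5 →
      (vertexChart p d δ H.dir_ne_zero H.pos.ne' 0 y ∈ claspingUnknot p q h a b δ ↔
        y.1 = clasperCenter ‖q - p‖ δ (tilt a b (δ / 2)) (edgeDir p q / d) y.2) := by
    intro y h1 h2
    have hclip : max (-1 / 2) (min (1 / 2) y.2) = y.2 := by
      obtain ⟨k1, k2⟩ := abs_lt.1 h2
      rw [min_eq_right (by linarith), max_eq_right (by linarith)]
    constructor
    · intro hy
      have h4 := vertexChart_symm_of_mem_safeZone (β := 0)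
        (H.claspingUnknot_subset_safeZone a b hy) H.dir_ne_zero (by simp)
      rw [Homeomorph.symm_apply_apply, eq_comm, Homeomorph.symm_apply_eq] at h4
      rw [h4, ← sim_image_bandCurve a b H.toEdgeGood] at hy
      obtain ⟨w, hw, hwy⟩ := hy
      have h5 := Prod.ext_iff.1 hwy
      simp only [sim_apply, add_right_inj] at h5
      have hd := H.dir_ne_zero
      have hδ' : (δ : ℂ) ≠ 0 := by exact_mod_cast hδ.ne'
      have h6 : y.1 = edgeDir p q / d * w.1 := by
        have h7 : (δ : ℂ) * (edgeDir p q * w.1) = δ * (d * y.1) := by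
          rw [← mul_assoc, h5.1]; ring
        rw [div_mul_eq_mul_div, mul_left_cancel₀ hδ' h7, mul_div_cancel_left₀ _ hd]
      have h7 : w.2 = y.2 := mul_left_cancel₀ hδ.ne' h5.2
      have h8 : ‖w.1‖ < 7 := by
        rw [h6, norm_mul, hquot, one_mul] at h1
        exact h1
      rcases H.bandCurve_near hw ((Complex.re_le_norm _).trans h8.le) with h9 | ⟨h9, h10⟩
      · rw [h7] at h9
        linarith
      · rw [h6, clasperCenter, hclip]
        congr 1
        apply Complex.ext
        · exact h9
        · simp only []
          rw [← h7, h10]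
          field_simp
    · intro hy
      have h3 : ((⟨‖q - p‖ / 2, δ * ‖q - p‖ * y.2 / tilt a b (δ / 2)⟩, y.2) : Space) ∈
          bandCurve ‖q - p‖ h a b δ := by
        have hflat : h (‖q - p‖ / 2 / (‖q - p‖ / δ)) = 0 := by
          refine H.flat_left _ ?_
          rw [abs_of_nonneg (by positivity)]
          calc ‖q - p‖ / 2 / (‖q - p‖ / δ) * ‖q - p‖ = ‖q - p‖ / 2 * δ := by field_simp
            _ ≤ _ := by gcongr; linarith
        refine ⟨le_rfl, by simp only []; linarith, ?_, Or.inr (Or.inl rfl), ?_⟩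
        · simp only []
          rw [abs_div, abs_mul, abs_of_pos hω, div_le_iff₀ (by linarith)]
          exact mul_le_mul_of_nonneg_left (by linarith) hω.le
        · simp only []
          rw [hflat, show ‖q - p‖ / 2 / (‖q - p‖ / δ) = δ / 2 by field_simp]
          field_simp
          ring
      have h4 := Set.mem_image_of_mem
        (sim p (edgeDir p q) δ (edgeDir_ne_zero H.length_pos) H.pos.ne') h3
      rw [sim_image_bandCurve a b H.toEdgeGood] at h4
      have h5 := vertexChart_symm_of_mem_safeZone (β := 0)
        (H.claspingUnknot_subset_safeZone a b h4) H.dir_ne_zero (by simp)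
      rw [Homeomorph.symm_apply_eq] at h5
      rw [h5] at h4
      convert h4
      rw [eq_comm, Homeomorph.symm_apply_eq]
      have hd := H.dir_ne_zero
      ext1
      · simp only [sim_apply]
        rw [hy, clasperCenter, hclip]
        field_simp
      · rfl
  rw [H.endChart_apply, key _ k1 k2, mem_heightAxis]
  set y := signFlip g (trefoilScale x) with hy
  have hy0 : y.1 = 0 ↔ x.1 = 0 := by
    rw [← norm_eq_zero, hy, norm_signFlip_fst, trefoilScale_apply]
    simp
  rw [← hy0]
  have hcenter : H.shift a b (0, y.2) =
      (clasperCenter ‖q - p‖ δ (tilt a b (δ / 2)) (edgeDir p q / d) y.2, y.2) := by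
    rw [H.shift_apply, shiftCutoff_eq_one (by simp)]
    simp
  have hsnd : (H.shift a b y).2 = y.2 := by rw [H.shift_apply]
  rw [hsnd]
  constructor
  · intro h1
    have h2 : H.shift a b y = H.shift a b (0, y.2) := by
      rw [hcenter]
      exact Prod.ext h1 hsnd
    rw [(H.shift a b).injective h2]
  · intro h1
    rw [show y = (0, y.2) from Prod.ext h1 rfl, hcenter]

theorem EdgeGoodAt.endChart_eventually (H : EdgeGoodAt p q h δ d) (a b g : ℤˣ) :
    ∀ᶠ x in 𝓝 (0 : Space), H.endChart a b g x =
      (p + δ * edgeDir p q * (⟨‖q - p‖ / 2, δ * ‖q - p‖ * (sgn g * x.2 / 8) / tilt a b (δ / 2)⟩ +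
        d / edgeDir p q * ((11 / 2 : ℝ) * ⟨x.1.re, sgn g * x.1.im⟩)), δ * (sgn g * x.2 / 8)) := by
  have hquot := H.norm_quot
  have hd := H.dir_ne_zero
  have hL := H.length_pos
  have hl2 := H.length_le
  have he := edgeDir_ne_zero H.length_pos
  have hre := edgeDir_div_re_nonneg H.norm_dir H.re_nonneg
  let y : Space → Space := fun x => signFlip g (trefoilScale x)
  have hy : Continuous y := (signFlip g).continuous.comp trefoilScale.continuous
  have hy0 : y 0 = 0 := by
    simp only [y, signFlip_apply, trefoilScale_apply]
    ext1
    · apply Complex.ext <;> simp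
    · simp
  have hs : Continuous fun x => H.shift a b (y x) := (H.shift a b).continuous.comp hy
  have hs0 : H.shift a b (y 0) = (edgeDir p q / d * (‖q - p‖ / 2 : ℝ), 0) := by
    rw [hy0, H.shift_apply, shiftCutoff_eq_one (by simp)]
    simp only [clasperCenter, Prod.fst_zero, Prod.snd_zero, Complex.ofReal_one, one_mul, zero_add]
    rw [min_eq_right (by norm_num), max_eq_right (by norm_num)]
    congr 2
    apply Complex.ext <;> simp
  have e1 : ∀ᶠ x in 𝓝 (0 : Space), ‖(y x).1‖ < 1 / 20 :=
    (by fun_prop : Continuous fun x => ‖(y x).1‖).continuousAt.eventually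
      (gt_mem_nhds (by simp [hy0]))
  have e2 : ∀ᶠ x in 𝓝 (0 : Space), |(y x).2| < 1 / 2 :=
    (by fun_prop : Continuous fun x => |(y x).2|).continuousAt.eventually
      (gt_mem_nhds (by simp [hy0]))
  have e3 : ∀ᶠ x in 𝓝 (0 : Space), ‖(H.shift a b (y x)).1‖ < 11 / 10 :=
    (by fun_prop : Continuous fun x => ‖(H.shift a b (y x)).1‖).continuousAt.eventually
      (gt_mem_nhds (by
        simp only []
        rw [hs0]
        simp only [norm_mul, hquot, Complex.norm_real, one_mul]
        rw [Real.norm_of_nonneg (by positivity)]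
        linarith))
  have e4 : ∀ᶠ x in 𝓝 (0 : Space), -1 / 4 < (H.shift a b (y x)).1.re :=
    (by fun_prop : Continuous fun x => (H.shift a b (y x)).1.re).continuousAt.eventually
      (lt_mem_nhds (by
        simp only []
        rw [hs0]
        simp only [Complex.re_mul_ofReal]
        have := mul_nonneg hre (by linarith : 0 ≤ ‖q - p‖ / 2)
        linarith))
  filter_upwards [e1, e2, e3, e4] with x h1 h2 h3 h4
  rw [H.endChart_apply, vertexChart_of_safe]
  · rw [H.shift_apply]
    change ((p + δ * (d * _) * ((y x).1 + (shiftCutoff ‖(y x).1‖ : ℂ) * _), δ * (y x).2) :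
      Space) = _
    obtain ⟨k1, k2⟩ := abs_lt.1 h2
    rw [shiftCutoff_eq_one h1.le, clasperCenter, min_eq_right (by linarith : (y x).2 ≤ 1 / 2),
      max_eq_right (by linarith : -1 / 2 ≤ (y x).2)]
    have hy1 : (y x).1 = (11 / 2 : ℝ) * ⟨x.1.re, sgn g * x.1.im⟩ := by
      simp only [y, signFlip_apply, trefoilScale_apply]
      apply Complex.ext
      · simp
      · simp
        ring
    have hy2 : (y x).2 = sgn g * x.2 / 8 := by
      simp only [y, signFlip_apply, trefoilScale_apply]
      ring
    rw [hy1, hy2]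
    ext1
    · simp only [Complex.ofReal_zero, zero_mul, Complex.exp_zero, mul_one, Complex.ofReal_one,
        one_mul]
      field_simp
      ring
    · rfl
  · right
    simp only [Complex.ofReal_zero, zero_mul, Complex.exp_zero, one_mul]
    exact ⟨h4.le, Or.inl h3.le⟩

/-- Near the second clasp of an edge, the chart around the trefoil is a linear change of coordinates
of the chart around the edge. -/
theorem EdgeGoodAt.exists_endChart_eq_chart {d' : ℂ} {h' : ℝ → ℝ} (H : EdgeGoodAt p q h δ d)
    (H' : EdgeGoodAt q p h' δ d') (a b f : ℤˣ) (hκ : 0 < κ) :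
    ∃ v : ℂ, ‖v‖ = 1 ∧ ∃ α > 0, ∃ β > 0, ∃ γ > 0, ∃ k : ℝ, ∀ᶠ x in 𝓝 (0 : Space),
      H'.endChart b a (f * a * b) x = H.chart a b f hκ
        (1 - α * (v * x.1).re, β * x.2 + k * (v * x.1).im, γ * (v * x.1).im) := by
  have hδ := H.pos
  have hL := H.length_pos
  have hl2 := H.length_le
  have h20 := H.twenty_le
  have hω : 0 < δ * ‖q - p‖ := by positivity
  have hm := H.sgn_mul_tilt_pos a b
  have hm0 : 0 < sgn b * tilt b a (δ / 2) := by
    have := H.le_tenth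
    linarith [le_sgn_mul_tilt b a (t := δ / 2) (by linarith)]
  have hend : tilt a b (1 - δ / 2) = -tilt b a (δ / 2) := tilt_symm b a _
  have hnorm : ‖p - q‖ = ‖q - p‖ := norm_sub_rev p q
  set g := f * a * b with hg
  have hgs : sgn g = sgn f * sgn a * sgn b := by rw [hg, sgn_mul, sgn_mul]
  have hff := sgn_mul_self f
  have haa := sgn_mul_self a
  have hbb := sgn_mul_self b
  have hquot : ‖d' / edgeDir q p‖ = 1 := by
    rw [norm_div, norm_edgeDir H'.length_pos, H'.norm_dir, div_one]
  -- The sign flip conjugates the plane when `g = -1`; moving it past the rotation conjugates the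
  -- rotation.
  have hv : ∃ v : ℂ, ‖v‖ = 1 ∧ ∀ w : ℂ,
      d' / edgeDir q p * ((11 / 2 : ℝ) * ⟨w.re, sgn g * w.im⟩) =
        (11 / 2 : ℝ) * ⟨(v * w).re, sgn g * (v * w).im⟩ := by
    set u := d' / edgeDir q p
    rcases sgn_cases g with h1 | h1
    · refine ⟨u, hquot, fun w => ?_⟩
      simp only [h1, one_mul, Complex.eta]
      ring
    · refine ⟨(starRingEnd ℂ) u, by rw [RCLike.norm_conj, hquot], fun w => ?_⟩
      rw [h1]
      apply Complex.ext <;> simp <;> ring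
  obtain ⟨v, hv1, hv⟩ := hv
  have hstart := H'.endChart_eventually b a g
  rw [hnorm] at hstart
  simp only [hv] at hstart
  set L := ‖q - p‖
  set m := tilt a b (2 / (L / δ))
  set n := tilt b a (δ / 2)
  set S := 2 - L / 2 + 2 * (L / δ - 4) with hS
  have hSpos : 0 < S := by linarith
  have hm' : m ≠ 0 := fun h0 => by rw [h0, mul_zero] at hm; exact hm.false
  have hn' : n ≠ 0 := fun h0 => by rw [h0, mul_zero] at hm0; exact hm0.false
  -- The constants result from comparing the two affine germs coordinate by coordinate. The choice
  -- `g = f * a * b` makes the coefficients `β` and `γ` positive, as is needed to join the linear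
  -- comparison maps to the identity.
  refine ⟨v, hv1, 11 / 2 / S, by positivity, 1 / (8 * (sgn b * n)), by positivity,
    11 / 2 * (sgn b * n) / (sgn a * m * κ), by positivity,
    (sgn a * κ * (11 / 2 * (sgn b * n) / (sgn a * m * κ)) + 11 / 2 * sgn b) / (δ * L), ?_⟩
  set γ := 11 / 2 * (sgn b * n) / (sgn a * m * κ) with hγ
  set k := (sgn a * κ * γ + 11 / 2 * sgn b) / (δ * L) with hk
  have hb0 := sgn_ne_zero b
  have ha0 := sgn_ne_zero a
  have hδ' : (δ : ℂ) ≠ 0 := by exact_mod_cast hδ.ne'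
  have hκ0 := hκ.ne'
  have hend' := H.chart_eventually_end a b f hκ
  have htend : Filter.Tendsto (fun x : Space => ((1 - 11 / 2 / S * (v * x.1).re,
      1 / (8 * (sgn b * n)) * x.2 + k * (v * x.1).im, γ * (v * x.1).im) : ℝ × ℝ × ℝ))
      (𝓝 0) (𝓝 (1, 0, 0)) := by
    have hc : Continuous (fun x : Space => ((1 - 11 / 2 / S * (v * x.1).re,
      1 / (8 * (sgn b * n)) * x.2 + k * (v * x.1).im, γ * (v * x.1).im) : ℝ × ℝ × ℝ)) := by fun_prop
    convert hc.tendsto 0 using 2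
    simp
  filter_upwards [hstart, htend.eventually hend'] with x h1 h2
  set I := (v * x.1).im
  have hk' : δ * L * k = sgn a * κ * γ + 11 / 2 * sgn b := by rw [hk]; field_simp
  have hβ : 1 / (8 * (sgn b * n)) = sgn b / (8 * n) := by
    rw [div_eq_div_iff (by positivity) (by positivity)]
    linear_combination (-8 * n) * hbb
  have hγ' : sgn a * m * κ * γ = 11 / 2 * (sgn b * n) := by rw [hγ]; field_simp
  have hY : -(sgn g * (δ * L * (x.2 / (8 * n)) + 11 / 2 * I)) =
      -(sgn f * sgn a * (δ * L) * (1 / (8 * (sgn b * n)) * x.2 + k * I)) +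
        sgn f * κ * (γ * I) := by
    rw [hβ, hgs]
    linear_combination (sgn f * sgn a * I) * hk' + (sgn f * κ * γ * I) * haa
  have h2' := h2 _ hY
  have hLq : ‖q - p‖ = L := rfl
  rw [hLq, ← hS, hend] at h2'
  rw [h1, h2']
  ext1
  · simp only []
    congr 2
    apply Complex.ext
    · simp only [Complex.add_re, Complex.re_ofReal_mul]
      field_simp
      ring
    · simp only [Complex.add_im, Complex.im_ofReal_mul]
      field_simp
  · simp only []
    congr 1
    rw [hgs]
    have h3 : m * κ * γ = 11 / 2 * (sgn a * sgn b * n) := by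
      linear_combination sgn a * hγ' - (m * κ * γ) * haa
    have h4 : sgn f * (m * κ / (δ * L)) * (γ * I) =
        sgn f * (11 / 2 * (sgn a * sgn b * n)) * I / (δ * L) := by
      rw [← h3]; ring
    change _ = -(sgn f * (m * κ / (δ * L)) * (γ * I)) + _
    rw [h4]
    field_simp
    ring

end TrefoilChart

/-! ### Linear maps realizable near a clasp -/

section Realizable

variable {E : Type*} [NormedAddCommGroup E] [NormedSpace ℝ E] [FiniteDimensional ℝ E]

theorem isUnit_of_forall_eq_zero {A : E →L[ℝ] E} (h : ∀ x, A x = 0 → x = 0) : IsUnit A := by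
  have : CompleteSpace E := FiniteDimensional.complete ℝ E
  rw [ContinuousLinearMap.isUnit_iff_isUnit_toLinearMap, LinearMap.isUnit_iff_ker_eq_bot,
    LinearMap.ker_eq_bot']
  exact h

theorem realizableAlong_of_forall {ℓ : Submodule ℝ E} {A : E →L[ℝ] E}
    (h : ∀ t ∈ Set.Icc (0 : ℝ) 1, ∀ x, (1 - t) • x + t • A x = 0 → x = 0)
    (hℓ : ∀ x ∈ ℓ, A x ∈ ℓ) : RealizableAlong ℓ A := by
  have h1 : A = 1 + (A - 1) := by abel
  rw [h1]
  refine realizableAlong_of_segment (fun t ht => isUnit_of_forall_eq_zero fun x hx => ?_)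
    fun x hx => ℓ.sub_mem (hℓ x hx) hx
  refine h t ht x ?_
  rw [← hx]
  simp only [add_apply, one_apply_eq_self, smul_apply, sub_apply]
  module

end Realizable

theorem eq_zero_of_convex_mul {t α x : ℝ} (ht : t ∈ Set.Icc (0 : ℝ) 1) (hα : 0 < α)
    (h : (1 - t) * x + t * (α * x) = 0) : x = 0 := by
  obtain ⟨h0, h1⟩ := ht
  have h2 : (1 - t + t * α) * x = 0 := by linear_combination h
  refine (mul_eq_zero.1 h2).resolve_left (ne_of_gt ?_)
  rcases h0.eq_or_lt with rfl | h0
  · norm_num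
  · nlinarith [mul_pos h0 hα]

/-- A triangular map of the coordinates around an edge. -/
noncomputable def plateMap (α β γ k : ℝ) : (ℝ × ℝ × ℝ) →L[ℝ] (ℝ × ℝ × ℝ) :=
  LinearMap.toContinuousLinearMap
    { toFun := fun x => (α * x.1, β * x.2.1, γ * x.2.2 + k * x.2.1)
      map_add' := fun x y => by
        ext1
        · simp only [Prod.fst_add]; ring
        · ext1 <;> simp only [Prod.fst_add, Prod.snd_add] <;> ring
      map_smul' := fun c x => by
        ext1
        · simp only [Prod.smul_fst, smul_eq_mul, RingHom.id_apply]; ring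
        · ext1 <;>
            simp only [Prod.smul_fst, Prod.smul_snd, smul_eq_mul, RingHom.id_apply] <;> ring }

theorem plateMap_apply (α β γ k : ℝ) (x : ℝ × ℝ × ℝ) :
    plateMap α β γ k x = (α * x.1, β * x.2.1, γ * x.2.2 + k * x.2.1) := rfl

theorem realizableAlong_plateMap {α β γ : ℝ} (hα : 0 < α) (hβ : 0 < β) (hγ : 0 < γ) (k : ℝ) :
    RealizableAlong plateAxis (plateMap α β γ k) := by
  refine realizableAlong_of_forall (fun t ht x hx => ?_) fun x hx => ?_
  · rw [plateMap_apply] at hx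
    have h1 := congrArg Prod.fst hx
    have h2 := congrArg (fun y : ℝ × ℝ × ℝ => y.2.1) hx
    have h3 := congrArg (fun y : ℝ × ℝ × ℝ => y.2.2) hx
    simp only [Prod.fst_add, Prod.snd_add, Prod.smul_fst, Prod.smul_snd, smul_eq_mul, Prod.fst_zero,
      Prod.snd_zero] at h1 h2 h3
    have k2 := eq_zero_of_convex_mul ht hβ h2
    rw [k2, mul_zero, add_zero] at h3
    exact Prod.ext (eq_zero_of_convex_mul ht hα h1) (Prod.ext k2 (eq_zero_of_convex_mul ht hγ h3))
  · rw [mem_plateAxis] at hx ⊢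
    simp [plateMap_apply, hx.1, hx.2]

/-- A triangular map of space. -/
noncomputable def clasperMap (α β γ k : ℝ) : Space →L[ℝ] Space :=
  LinearMap.toContinuousLinearMap
    { toFun := fun x => (⟨α * x.1.re, β * x.1.im⟩, γ * x.2 + k * x.1.im)
      map_add' := fun x y => by
        ext1
        · apply Complex.ext <;>
            simp only [Prod.fst_add, Complex.add_re, Complex.add_im] <;> ring
        · simp only [Prod.fst_add, Prod.snd_add, Complex.add_im]; ring
      map_smul' := fun c x => by
        ext1
        · apply Complex.ext <;> simp <;> ring
        · simp; ring }

theorem clasperMap_apply (α β γ k : ℝ) (x : Space) :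
    clasperMap α β γ k x = (⟨α * x.1.re, β * x.1.im⟩, γ * x.2 + k * x.1.im) := rfl

theorem realizableAlong_clasperMap {α β γ : ℝ} (hα : 0 < α) (hβ : 0 < β) (hγ : 0 < γ) (k : ℝ) :
    RealizableAlong heightAxis (clasperMap α β γ k) := by
  refine realizableAlong_of_forall (fun t ht x hx => ?_) fun x hx => ?_
  · rw [clasperMap_apply] at hx
    have h1 := congrArg (fun y : Space => y.1.re) hx
    have h2 := congrArg (fun y : Space => y.1.im) hx
    have h3 := congrArg (fun y : Space => y.2) hx
    simp only [Prod.fst_add, Prod.snd_add, Prod.smul_fst, Prod.smul_snd, smul_eq_mul, Prod.fst_zero,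
      Prod.snd_zero, Complex.add_re, Complex.add_im, Complex.real_smul, Complex.re_ofReal_mul,
      Complex.im_ofReal_mul, Complex.zero_re, Complex.zero_im] at h1 h2 h3
    have k2 := eq_zero_of_convex_mul ht hβ h2
    rw [k2, mul_zero, add_zero] at h3
    exact Prod.ext (Complex.ext (eq_zero_of_convex_mul ht hα h1) k2)
      (eq_zero_of_convex_mul ht hγ h3)
  · rw [mem_heightAxis] at hx ⊢
    simp only [clasperMap_apply, hx, Complex.zero_re, Complex.zero_im, mul_zero]
    rfl

/-- The rotation of space about the vertical axis. -/
noncomputable def axisRotation (v : ℂ) : Space →L[ℝ] Space :=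
  LinearMap.toContinuousLinearMap
    { toFun := fun x => (v * x.1, x.2)
      map_add' := fun x y => by
        ext1
        · simp only [Prod.fst_add]; ring
        · rfl
      map_smul' := fun c x => by
        ext1
        · simp only [Prod.smul_fst, Complex.real_smul, RingHom.id_apply]; ring
        · rfl }

theorem axisRotation_apply (v : ℂ) (x : Space) : axisRotation v x = (v * x.1, x.2) := rfl

/-- The segment from the identity to a rotation consists of invertible maps unless the rotation is
the half turn. In general a rotation is the square of another one; if the chosen square root is
`-1`, then `v = 1`. -/
theorem realizableAlong_axisRotation {v : ℂ} (hv : ‖v‖ = 1) :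
    RealizableAlong heightAxis (axisRotation v) := by
  have key : ∀ s : ℂ, ‖s‖ = 1 → s ≠ -1 → RealizableAlong heightAxis (axisRotation s) := by
    intro s hs hs1
    refine realizableAlong_of_forall (fun t ht x hx => ?_) fun x hx => ?_
    · rw [axisRotation_apply] at hx
      have h1 := congrArg Prod.fst hx
      have h2 := congrArg Prod.snd hx
      simp only [Prod.fst_add, Prod.snd_add, Prod.smul_fst, Prod.smul_snd, smul_eq_mul,
        Prod.fst_zero, Prod.snd_zero, Complex.real_smul] at h1 h2
      have h3 : (((1 - t : ℝ) : ℂ) + t * s) * x.1 = 0 := by linear_combination h1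
      refine Prod.ext ((mul_eq_zero.1 h3).resolve_left fun h4 => hs1 ?_) (by
        simp only [Prod.snd_zero]; linarith)
      have h5 : ((t - 1 : ℝ) : ℂ) = t * s := by
        push_cast at h4 ⊢
        linear_combination -h4
      have h6 := congrArg norm h5
      rw [norm_mul, hs, mul_one, Complex.norm_real, Complex.norm_real, Real.norm_eq_abs,
        Real.norm_eq_abs, abs_of_nonneg ht.1, abs_of_nonpos (by linarith [ht.2])] at h6
      have h7 : t = 1 / 2 := by linarith
      rw [h7] at h5
      push_cast at h5
      linear_combination -2 * h5
    · rw [mem_heightAxis] at hx ⊢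
      rw [axisRotation_apply, hx, mul_zero]
  obtain ⟨s, rfl⟩ := IsAlgClosed.exists_eq_mul_self v
  have hs : ‖s‖ = 1 := by
    rw [norm_mul, ← sq] at hv
    have h0 := norm_nonneg s
    nlinarith
  have hmul : ∀ s : ℂ, axisRotation (s * s) = axisRotation s * axisRotation s := by
    intro s
    refine ContinuousLinearMap.ext fun x => ?_
    simp only [mul_apply_eq_comp, axisRotation_apply, mul_assoc]
  by_cases h : s = -1
  · have h1 : s * s = 1 := by rw [h]; norm_num
    rw [h1]
    refine key 1 norm_one ?_
    norm_num
  · rw [hmul]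
    exact (key s hs h).mul (key s hs h)

/-! ### Chains of trefoils -/

/-- A chain of trefoils of size `δ` at the points `p i`, facing the directions `d i`, and of unknots
that join consecutive trefoils. -/
structure ChainData where
  p : ℕ → ℂ
  d : ℕ → ℂ
  h : ℕ → ℝ → ℝ
  a : ℕ → ℤˣ
  b : ℕ → ℤˣ
  δ : ℝ

namespace ChainData

/-- The trefoils of the chain. -/
noncomputable def vertex (c : ChainData) (i : ℕ) : Set Space := trefoil (c.p i) (c.d i) c.δ

/-- The unknots of the chain. -/
noncomputable def edge (c : ChainData) (i : ℕ) : Set Space :=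
  claspingUnknot (c.p i) (c.p (i + 1)) (c.h i) (c.a i) (c.b i) c.δ

/-- The first `n` trefoils of the chain and the unknots between them are well separated. -/
structure Good (c : ChainData) (n : ℕ) : Prop where
  pos : 0 < c.δ
  norm_dir : ∀ i < n, ‖c.d i‖ = 1
  edge_good : ∀ i, i + 1 < n → EdgeGoodAt (c.p i) (c.p (i + 1)) (c.h i) c.δ (c.d i)
  edge_good_symm : ∀ i, i + 1 < n →
    EdgeGoodAt (c.p (i + 1)) (c.p i) (fun t => c.h i (1 - t)) c.δ (c.d (i + 1))
  vertex_far : ∀ i j, i < n → j < n → i ≠ j → 14 * c.δ ≤ ‖c.p i - c.p j‖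
  band_far : ∀ i j, i + 1 < n → j < n → j ≠ i → j ≠ i + 1 →
    ∀ x ∈ band (c.p i) (c.p (i + 1)) (c.h i) c.δ, 7 * c.δ ≤ ‖x.1 - c.p j‖
  band_disjoint : ∀ i j, i + 1 < n → j + 1 < n → i ≠ j →
    Disjoint (band (c.p i) (c.p (i + 1)) (c.h i) c.δ) (band (c.p j) (c.p (j + 1)) (c.h j) c.δ)

end ChainData

theorem norm_lt_of_mem_trefoil {p d : ℂ} {δ : ℝ} (hd : ‖d‖ = 1) (hδ : 0 < δ) {x : Space}
    (hx : x ∈ trefoil p d δ) : ‖x.1 - p‖ < 7 * δ := by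
  have hd0 : d ≠ 0 := by
    rw [← norm_pos_iff, hd]; exact one_pos
  rw [← vertexChart_image_thinTrefoil p d δ hd0 hδ.ne' 0] at hx
  obtain ⟨y, hy, rfl⟩ := hx
  obtain ⟨h1, h2, h3⟩ := thinTrefoil_norm_bounds hy
  have h4 := norm_thinning_symm_lt (x := y) (by linarith)
  rw [vertexChart_of_ring h1 h2 h3, sim_apply]
  simp only [add_sub_cancel_left, norm_mul, Complex.norm_real, hd, mul_one,
    Real.norm_of_nonneg hδ.le]
  nlinarith

theorem isCompact_claspingUnknot {p q : ℂ} {h : ℝ → ℝ} {δ : ℝ} (H : EdgeGood p q h δ) (a b : ℤˣ) :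
    IsCompact (claspingUnknot p q h a b δ) := by
  have h1 : IsCompact modelUnknot := by
    refine isCompact_plate.of_isClosed_subset ?_ fun x hx => ⟨hx.1, hx.2.1, hx.2.2.2⟩
    have c1 : Continuous fun x : ℝ × ℝ × ℝ => |x.1| := by fun_prop
    have c2 : Continuous fun x : ℝ × ℝ × ℝ => |x.2.1| := by fun_prop
    have c3 : Continuous fun x : ℝ × ℝ × ℝ => x.2.2 := by fun_prop
    exact (isClosed_le c1 continuous_const).inter ((isClosed_le c2 continuous_const).inter
      (((isClosed_eq c1 continuous_const).union (isClosed_eq c2 continuous_const)).inter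
        (isClosed_eq c3 continuous_const)))
  rw [← sim_image_bandCurve a b H, ← H.edgeChart_image_modelUnknot a b 1 one_pos]
  exact (h1.image (Homeomorph.continuous _)).image (Homeomorph.continuous _)

namespace ChainData

variable {c c' : ChainData} {n : ℕ}

theorem Good.dir_ne_zero (H : c.Good n) {i : ℕ} (hi : i < n) : c.d i ≠ 0 := by
  rw [← norm_pos_iff, H.norm_dir i hi]
  exact one_pos

theorem Good.edge_subset_band (H : c.Good n) {i : ℕ} (hi : i + 1 < n) :
    c.edge i ⊆ band (c.p i) (c.p (i + 1)) (c.h i) c.δ :=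
  claspingUnknot_subset_band H.pos (by linarith [(H.edge_good i hi).le_tenth])

theorem Good.edge_eq (H : c.Good n) {i : ℕ} (hi : i + 1 < n) :
    c.edge i = claspingUnknot (c.p (i + 1)) (c.p i) (fun t => c.h i (1 - t)) (c.b i) (c.a i) c.δ :=
  (claspingUnknot_symm _ _ _ _ _ _ (by linarith [(H.edge_good i hi).le_tenth])).symm

theorem Good.vertex_far' (H : c.Good n) {i j : ℕ} (hi : i < n) (hj : j < n) (hij : i ≠ j)
    {x : Space} (hx : x ∈ c.vertex i) : 7 * c.δ ≤ ‖x.1 - c.p j‖ := by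
  have h1 := norm_lt_of_mem_trefoil (H.norm_dir i hi) H.pos hx
  have h2 := H.vertex_far i j hi hj hij
  have h3 := norm_sub_le_norm_sub_add_norm_sub (c.p i) x.1 (c.p j)
  rw [norm_sub_rev (c.p i) x.1] at h3
  linarith

/-- The components of the chain that come before a given place. -/
noncomputable def part (c : ChainData) (k m : ℕ) : {i // i ≤ k} ⊕ {i // i < m} → Set Space :=
  Sum.elim (fun i => c.vertex i) fun i => c.edge i

/-- Of the earlier components only the last trefoil pierces the plate. The last unknot clasps the
same trefoil but runs in its safe zone, all others stay outside the cylinder of radius `7 δ`, and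
the bands are disjoint. -/
theorem Good.exists_meetsInLine_chart (H : c.Good n) {k : ℕ} (hk : k + 1 < n) (f : ℤˣ) :
    ∃ κ, ∃ hκ : 0 < κ, ∃ R > 1, ∀ i, MeetsInLine plateAxis
      ((H.edge_good k hk).chart (c.a k) (c.b k) f hκ) R (c.part k k i) := by
  have hpos := H.pos
  suffices hC : ∀ i, c.part k k i = trefoil (c.p k) (c.d k) c.δ ∨ (IsClosed (c.part k k i) ∧
      c.part k k i ⊆ safeZone (c.p k) (c.d k) c.δ (H.edge_good k hk).dir_ne_zero hpos.ne' ∧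
        Disjoint (c.part k k i) (band (c.p k) (c.p (k + 1)) (c.h k) c.δ)) by
    obtain ⟨κ, hκ, R, hR, h⟩ := (H.edge_good k hk).exists_meetsInLine (c.a k) (c.b k) f _ hC
    refine ⟨κ, hκ, R, hR, fun i => ?_⟩
    rcases h i with h | h
    · exact Or.inr h.2
    · exact Or.inl h.2
  rintro (⟨i, hi⟩ | ⟨i, hi⟩)
  · rcases hi.eq_or_lt with rfl | hi'
    · exact Or.inl rfl
    · have hne : i ≠ k := hi'.ne
      refine Or.inr ⟨isClosed_trefoil _ _ _ (H.dir_ne_zero (i := i) (by omega)) hpos.ne',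
        fun x hx => ?_, ?_⟩
      · exact mem_safeZone_of_norm (H.norm_dir k (by omega)) hpos
          (H.vertex_far' (by omega) (by omega) hne hx)
      · rw [Set.disjoint_left]
        intro x hx hxb
        have h1 := norm_lt_of_mem_trefoil (H.norm_dir i (by omega)) hpos hx
        have h2 := H.band_far k i hk (by omega) hne (by omega) x hxb
        linarith
  · have hi1 : i + 1 < n := by omega
    refine Or.inr ⟨(isCompact_claspingUnknot (H.edge_good i hi1).toEdgeGood _ _).isClosed, ?_, ?_⟩
    · rcases (Nat.succ_le_of_lt hi).eq_or_lt with rfl | hi'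
      · change c.edge i ⊆ _
        rw [H.edge_eq hi1]
        exact (H.edge_good_symm i hi1).claspingUnknot_subset_safeZone _ _
      · intro x hx
        exact mem_safeZone_of_norm (H.norm_dir k (by omega)) hpos
          (H.band_far i k hi1 (by omega) (by omega) (by omega) x (H.edge_subset_band hi1 hx))
    · exact (H.band_disjoint i k hi1 hk (by omega)).mono_left (H.edge_subset_band hi1)

/-- Among the components present so far, only the last unknot enters the cylinder of radius `7 δ`
over the new vertex. -/
theorem Good.meetsInLine_endChart (H : c.Good n) {k : ℕ} (hk : k + 1 < n) (g : ℤˣ)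
    (i : {i // i ≤ k} ⊕ {i // i < k + 1}) : MeetsInLine heightAxis
      ((H.edge_good_symm k hk).endChart (c.b k) (c.a k) g) (11 / 10) (c.part k (k + 1) i) := by
  rcases i with ⟨i, hi⟩ | ⟨i, hi⟩
  · exact Or.inl fun x hx => (H.edge_good_symm k hk).endChart_notMem _ _ _ hx fun y hy =>
      H.vertex_far' (Nat.lt_of_le_of_lt hi (by omega)) hk (by omega) hy
  · rcases (Nat.le_of_lt_succ hi).eq_or_lt with rfl | hi'
    · refine Or.inr fun x hx => ?_
      change _ ∈ c.edge i ↔ _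
      rw [H.edge_eq hk]
      exact (H.edge_good_symm i hk).endChart_mem_claspingUnknot_iff _ _ _ hx
    · exact Or.inl fun x hx => (H.edge_good_symm k hk).endChart_notMem _ _ _ hx fun y hy =>
        H.band_far i (k + 1) (by omega) hk (by omega) (by omega) y
          (H.edge_subset_band (by omega) hy)

end ChainData

/-! ### Comparison of the charts of two chains, and the isotopy between them. -/

theorem norm_eq_one_of_mem_modelUnknot {x : ℝ × ℝ × ℝ} (hx : x ∈ modelUnknot) : ‖x‖ = 1 := by
  obtain ⟨h1, h2, h3, h4⟩ := hx
  rw [Prod.norm_def, Prod.norm_def, h4, norm_zero, Real.norm_eq_abs, Real.norm_eq_abs,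
    max_eq_left (abs_nonneg x.2.1)]
  rcases h3 with h3 | h3
  · rw [h3]; exact max_eq_left h2
  · rw [h3]; exact max_eq_right h1

/-- The charts around the beginnings of two edges differ by a linear change of coordinates. -/
theorem exists_edgeGerm_comp {p q p' q' : ℂ} {h h' : ℝ → ℝ} {δ δ' κ κ' : ℝ}
    (H : EdgeGood p q h δ) (H' : EdgeGood p' q' h' δ') (a b a' b' : ℤˣ) (hκ : 0 < κ)
    (hκ' : 0 < κ') : ∃ A, RealizableAlong plateAxis A ∧
      ∀ x, edgeGerm ‖q - p‖ a b δ κ (A x) = edgeGerm ‖q' - p'‖ a' b' δ' κ' x := by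
  have hL := H.length_le
  have hL' := H'.length_le
  have hm := H.sgn_mul_tilt_pos a b
  have hm' := H'.sgn_mul_tilt_pos a' b'
  have h2 : 0 < 2 - ‖q - p‖ / 2 := by linarith
  have h2' : 0 < 2 - ‖q' - p'‖ / 2 := by linarith
  set L := ‖q - p‖
  set L' := ‖q' - p'‖
  set m := sgn a * tilt a b (2 / (L / δ)) with hmd
  set m' := sgn a' * tilt a' b' (2 / (L' / δ')) with hmd'
  refine ⟨plateMap ((2 - L' / 2) / (2 - L / 2)) (m' / m) (κ' / κ)
    ((sgn a * (δ * L) * (m' / m) - sgn a' * (δ' * L')) / κ),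
    realizableAlong_plateMap (by positivity) (by positivity) (by positivity) _, fun x => ?_⟩
  simp only [edgeGerm, plateMap_apply, ← hmd, ← hmd']
  ext1
  · apply Complex.ext
    · simp only []
      rw [← mul_assoc, mul_div_cancel₀ _ h2.ne']
    · simp only []
      field_simp
      ring
  · simp only []
    field_simp

/-- The charts around the ends of two edges differ by a linear change of coordinates. -/
theorem exists_clasper_comp {v v' : ℂ} (hv : ‖v‖ = 1) (hv' : ‖v'‖ = 1)
    {α β γ α' β' γ' : ℝ} (hα : 0 < α) (hβ : 0 < β) (hγ : 0 < γ) (hα' : 0 < α') (hβ' : 0 < β')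
    (hγ' : 0 < γ') (k k' : ℝ) : ∃ A : Space →L[ℝ] Space, RealizableAlong heightAxis A ∧
      ∀ x, ((1 - α * (v * (A x).1).re, β * (A x).2 + k * (v * (A x).1).im,
        γ * (v * (A x).1).im) : ℝ × ℝ × ℝ) =
        (1 - α' * (v' * x.1).re, β' * x.2 + k' * (v' * x.1).im, γ' * (v' * x.1).im) := by
  have hv0 : v ≠ 0 := by
    rw [← norm_pos_iff, hv]; exact one_pos
  refine ⟨axisRotation v⁻¹ * (clasperMap (α' / α) (γ' / γ) (β' / β) ((k' - k * (γ' / γ)) / β) *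
    axisRotation v'), (realizableAlong_axisRotation (by rw [norm_inv, hv, inv_one])).mul
    ((realizableAlong_clasperMap (by positivity) (by positivity) (by positivity) _).mul
      (realizableAlong_axisRotation hv')), fun x => ?_⟩
  simp only [mul_apply_eq_comp, axisRotation_apply, clasperMap_apply, mul_inv_cancel_left₀ hv0]
  refine Prod.ext ?_ (Prod.ext ?_ ?_)
  · simp only []
    field_simp
  · simp only []
    field_simp
    ring
  · simp only []
    field_simp

namespace ChainData

variable {c c' : ChainData} {n : ℕ}

/-- Two good chains are isotopic. -/
theorem Good.exists_isotopy (H : c.Good n) (H' : c'.Good n) (k : ℕ) (hk : k < n) :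
    ∃ (f f' : ℤˣ) (G : Space ≃ₜ Space), IsotopicToId G ∧
      (∀ i, G '' c.part k k i = c'.part k k i) ∧
      ∀ᶠ x in 𝓝 ((2, 0) : Space),
        G (sim (c.p k) (c.d k) c.δ (H.dir_ne_zero hk) H.pos.ne' (signFlip f x)) =
          sim (c'.p k) (c'.d k) c'.δ (H'.dir_ne_zero hk) H'.pos.ne' (signFlip f' x) := by
  -- Besides the components, the induction carries the germ at the point `(2, 0)` of the last
  -- trefoil, where the next unknot clasps. The signs `f` and `f'` may differ, since they depend on
  -- the clasps passed so far.
  induction k with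
  | zero =>
    refine ⟨1, 1, (sim (c.p 0) (c.d 0) c.δ (H.dir_ne_zero hk) H.pos.ne').symm.trans
      (sim (c'.p 0) (c'.d 0) c'.δ (H'.dir_ne_zero hk) H'.pos.ne'),
      (isotopicToId_sim _ _ _ _ H.pos).symm.trans (isotopicToId_sim _ _ _ _ H'.pos), ?_, ?_⟩
    · rintro (⟨i, hi⟩ | ⟨i, hi⟩)
      · obtain rfl : i = 0 := by omega
        simp only [part, Sum.elim_inl, vertex]
        rw [trefoil_eq_image_sim _ _ _ (H.dir_ne_zero hk) H.pos.ne',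
          trefoil_eq_image_sim _ _ _ (H'.dir_ne_zero hk) H'.pos.ne', Set.image_image]
        simp only [Homeomorph.trans_apply, Homeomorph.symm_apply_apply]
      · omega
    · exact Filter.Eventually.of_forall fun x => by
        simp only [Homeomorph.trans_apply, Homeomorph.symm_apply_apply]
  | succ k ih =>
    obtain ⟨f, f', G, hG, hGP, hgerm⟩ := ih (by omega)
    obtain ⟨κ, hκ, R, hR, hmeet⟩ := H.exists_meetsInLine_chart hk f
    obtain ⟨κ', hκ', R', hR', hmeet'⟩ := H'.exists_meetsInLine_chart hk f'
    obtain ⟨A, hA, hAeq⟩ := exists_edgeGerm_comp (H.edge_good k hk).toEdgeGood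
      (H'.edge_good k hk).toEdgeGood (c.a k) (c.b k) (c'.a k) (c'.b k) hκ hκ'
    have hgerm1 : ∀ᶠ x in 𝓝 0, G ((H.edge_good k hk).chart (c.a k) (c.b k) f hκ (A x)) =
        (H'.edge_good k hk).chart (c'.a k) (c'.b k) f' hκ' x := by
      have hA0 : Filter.Tendsto A (𝓝 0) (𝓝 0) := by
        simpa using A.continuous.tendsto 0
      have hE : Filter.Tendsto (edgeGerm ‖c'.p (k + 1) - c'.p k‖ (c'.a k) (c'.b k) c'.δ κ') (𝓝 0)
          (𝓝 (2, 0)) := by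
        have hc : Continuous (edgeGerm ‖c'.p (k + 1) - c'.p k‖ (c'.a k) (c'.b k) c'.δ κ') := by
          unfold edgeGerm
          simp only [Complex.mk_eq_add_mul_I]
          fun_prop
        convert hc.tendsto 0 using 2
        ext1
        · apply Complex.ext <;> simp [edgeGerm]
        · simp [edgeGerm]
      filter_upwards [
        hA0.eventually ((H.edge_good k hk).chart_eventually_start (c.a k) (c.b k) f hκ),
        (H'.edge_good k hk).chart_eventually_start (c'.a k) (c'.b k) f' hκ',
        hE.eventually hgerm] with x h1 h2 h3
      rw [h1, h2, hAeq, h3]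
    -- The unknot has norm `1` in the chart, so any `r < 1` serves; a neighbourhood of `(1, 0, 0)`,
    -- the place of the next clasp, is matched as well.
    obtain ⟨G₁, hG₁, hG₁P, R₁, hR₁, hG₁eq⟩ := exists_extend_germ (lt_min hR hR')
      (fun i => (hmeet i).mono (min_le_left _ _)) (fun i => (hmeet' i).mono (min_le_right _ _))
      hG hGP hA hgerm1 (r := 1 / 2) (by norm_num) (by norm_num)
    have hedge : G₁ '' c.edge k = c'.edge k := by
      rw [edge, edge, ← (H.edge_good k hk).chart_image_modelUnknot _ _ f hκ,
        ← (H'.edge_good k hk).chart_image_modelUnknot _ _ f' hκ', Set.image_image]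
      refine Set.image_congr fun x hx => hG₁eq x ?_ ?_ <;>
      · rw [norm_eq_one_of_mem_modelUnknot hx]
        linarith
    have hgerm2 : ∀ᶠ x in 𝓝 ((1, 0, 0) : ℝ × ℝ × ℝ),
        G₁ ((H.edge_good k hk).chart (c.a k) (c.b k) f hκ x) =
          (H'.edge_good k hk).chart (c'.a k) (c'.b k) f' hκ' x := by
      have h1 : ‖((1, 0, 0) : ℝ × ℝ × ℝ)‖ = 1 := by simp [Prod.norm_def]
      filter_upwards [continuous_norm.continuousAt.eventually
        (lt_mem_nhds (by simp only [h1]; norm_num : (1 / 2 : ℝ) < _)),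
        continuous_norm.continuousAt.eventually
          (gt_mem_nhds (by simp only [h1]; exact hR₁))] with x h1 h2
      exact hG₁eq x h1.le h2
    obtain ⟨v, hv, α, hα, β, hβ, γ, hγ, l, hl⟩ := (H.edge_good k hk).exists_endChart_eq_chart
      (H.edge_good_symm k hk) (c.a k) (c.b k) f hκ
    obtain ⟨v', hv', α', hα', β', hβ', γ', hγ', l', hl'⟩ :=
      (H'.edge_good k hk).exists_endChart_eq_chart
        (H'.edge_good_symm k hk) (c'.a k) (c'.b k) f' hκ'
    obtain ⟨B, hB, hBeq⟩ := exists_clasper_comp hv hv' hα hβ hγ hα' hβ' hγ' l l'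
    set g := f * c.a k * c.b k
    set g' := f' * c'.a k * c'.b k
    have hgerm3 : ∀ᶠ x in 𝓝 0,
        G₁ ((H.edge_good_symm k hk).endChart (c.b k) (c.a k) g (B x)) =
          (H'.edge_good_symm k hk).endChart (c'.b k) (c'.a k) g' x := by
      have hB0 : Filter.Tendsto B (𝓝 0) (𝓝 0) := by
        simpa using B.continuous.tendsto 0
      have hE : Filter.Tendsto (fun x : Space => ((1 - α' * (v' * x.1).re,
          β' * x.2 + l' * (v' * x.1).im, γ' * (v' * x.1).im) : ℝ × ℝ × ℝ)) (𝓝 0)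
          (𝓝 (1, 0, 0)) := by
        have hc : Continuous (fun x : Space => ((1 - α' * (v' * x.1).re,
          β' * x.2 + l' * (v' * x.1).im, γ' * (v' * x.1).im) : ℝ × ℝ × ℝ)) := by fun_prop
        convert hc.tendsto 0 using 2
        simp
      filter_upwards [hB0.eventually hl, hl', hE.eventually hgerm2] with x h1 h2 h3
      rw [h1, h2, hBeq, h3]
    -- The unknot just matched now counts among the earlier components. The value `1 / 5` is the
    -- lower bound for the norm on `modelTrefoil`.
    obtain ⟨G₂, hG₂, hG₂P, R₂, hR₂, hG₂eq⟩ := exists_extend_germ (P := c.part k (k + 1))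
      (P' := c'.part k (k + 1)) (by norm_num : (1 : ℝ) < 11 / 10)
      (H.meetsInLine_endChart hk g) (H'.meetsInLine_endChart hk g') hG₁ (by
        rintro (⟨i, hi⟩ | ⟨i, hi⟩)
        · exact hG₁P (Sum.inl ⟨i, hi⟩)
        · rcases (Nat.le_of_lt_succ hi).eq_or_lt with rfl | hi'
          · exact hedge
          · exact hG₁P (Sum.inr ⟨i, hi'⟩)) hB hgerm3 (r := 1 / 5) (by norm_num) (by norm_num)
    have hvertex : G₂ '' c.vertex (k + 1) = c'.vertex (k + 1) := by
      rw [vertex, vertex, ← (H.edge_good_symm k hk).endChart_image_modelTrefoil (c.b k) (c.a k) g,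
        ← (H'.edge_good_symm k hk).endChart_image_modelTrefoil (c'.b k) (c'.a k) g',
        Set.image_image]
      refine Set.image_congr fun x hx => hG₂eq x ?_ ?_ <;>
      · have := norm_of_mem_modelTrefoil hx
        linarith
    refine ⟨g, g', G₂, hG₂, ?_, ?_⟩
    · rintro (⟨i, hi⟩ | ⟨i, hi⟩)
      · rcases hi.eq_or_lt with rfl | hi'
        · exact hvertex
        · exact hG₂P (Sum.inl ⟨i, Nat.le_of_lt_succ hi'⟩)
      · exact hG₂P (Sum.inr ⟨i, hi⟩)
    · have hchart : ∀ {p q d : ℂ} {h : ℝ → ℝ} {δ : ℝ} (K : EdgeGoodAt p q h δ d) (a b g : ℤˣ),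
          ∀ᶠ x in 𝓝 ((2, 0) : Space), K.endChart a b g (trefoilScale.symm x) =
            sim p d δ K.dir_ne_zero K.pos.ne' (signFlip g x) := by
        intro p q d h δ K a b g
        have h1 : ∀ᶠ x : Space in 𝓝 (2, 0), 11 / 10 < ‖x.1‖ :=
          (by fun_prop : Continuous fun x : Space => ‖x.1‖).continuousAt.eventually
            (lt_mem_nhds (by norm_num))
        have h2 : Filter.Tendsto (signFlip g) (𝓝 (2, 0)) (𝓝 (2, 0)) := by
          convert (signFlip g).continuous.tendsto (2, 0) using 2
          rw [signFlip_apply]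
          ext1
          · apply Complex.ext <;> simp
          · simp
        filter_upwards [h1, h2.eventually (vertexChart_eventually (p := p) (d := d)
          (hd := K.dir_ne_zero) (hδ := K.pos.ne') (β := 0))] with x h1 h2
        rw [K.endChart_apply, Homeomorph.apply_symm_apply, K.shift_of_le, h2]
        rw [norm_signFlip_fst]
        exact h1.le
      -- In the end chart the next clasping place has norm `4 / 11`, between `1 / 5` and `1`, so its
      -- germ is matched too.
      have hs : Filter.Tendsto (fun x => ‖trefoilScale.symm x‖) (𝓝 (2, 0)) (𝓝 (4 / 11)) := by
        have := (trefoilScale.symm.continuous.norm).tendsto (2, 0)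
        convert this using 2
        change _ = ‖(((2 / 11 : ℝ) * 2, 0 * 8) : Space)‖
        rw [Prod.norm_def]
        norm_num
      filter_upwards [hchart (H.edge_good_symm k hk) (c.b k) (c.a k) g,
        hchart (H'.edge_good_symm k hk) (c'.b k) (c'.a k) g',
        hs.eventually (lt_mem_nhds (by norm_num : (1 / 5 : ℝ) < 4 / 11)),
        hs.eventually (gt_mem_nhds (by norm_num : (4 / 11 : ℝ) < 1))] with x h1 h2 h3 h4
      rw [← h1, ← h2]
      exact hG₂eq _ h3.le (h4.trans hR₂)

end ChainData

/-! ### The link of a drawing is well separated -/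

theorem norm_sq_chord {u v : ℂ} (hu : ‖u‖ = 1) (hv : ‖v‖ = 1) (t : ℝ) :
    ‖u + t * (v - u)‖ ^ 2 = 1 - t * (1 - t) * ‖v - u‖ ^ 2 := by
  have h1 : ‖u‖ ^ 2 = 1 := by rw [hu, one_pow]
  have h2 : ‖v‖ ^ 2 = 1 := by rw [hv, one_pow]
  rw [norm_sq_eq_re_im] at h1 h2 ⊢
  rw [norm_sq_eq_re_im]
  simp only [Complex.add_re, Complex.add_im, Complex.re_ofReal_mul, Complex.im_ofReal_mul,
    Complex.sub_re, Complex.sub_im]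
  linear_combination (1 - t) * h1 + t * h2

/-- On the unit circle the chord formula leaves `t (1 - t) ‖v - u‖² = 0`. -/
theorem eq_endpoint_of_norm_chord {u v w : ℂ} (hu : ‖u‖ = 1) (hv : ‖v‖ = 1) (hw : ‖w‖ = 1)
    {t : ℝ} (h : u + t * (v - u) = w) : w = u ∨ w = v := by
  have h1 := norm_sq_chord hu hv t
  rw [h, hw] at h1
  have h2 : t * (1 - t) * ‖v - u‖ ^ 2 = 0 := by linarith
  rcases mul_eq_zero.1 h2 with h3 | h3
  · rcases mul_eq_zero.1 h3 with h4 | h4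
    · left; rw [← h, h4]; simp
    · right
      obtain rfl : t = 1 := by linarith
      rw [← h]; push_cast; ring
  · left
    have : v - u = 0 := by simpa using h3
    rw [← h, this]; simp

/-- If the imaginary part vanished, `v - u` would be a real multiple of `w - u`, and a line would
meet the circle in three points. -/
theorem im_conj_mul_ne_zero {u v w : ℂ} (hu : ‖u‖ = 1) (hv : ‖v‖ = 1) (hw : ‖w‖ = 1) (huv : v ≠ u)
    (huw : w ≠ u) (hvw : v ≠ w) : ((starRingEnd ℂ) (w - u) * (v - u)).im ≠ 0 := by
  intro h
  have hz : w - u ≠ 0 := sub_ne_zero.2 huw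
  have hn : ‖w - u‖ ^ 2 ≠ 0 := by positivity
  have h1 : (v - u) =
      ((((starRingEnd ℂ) (w - u) * (v - u)).re / ‖w - u‖ ^ 2 : ℝ) : ℂ) * (w - u) := by
    have h2 : ((starRingEnd ℂ) (w - u) * (v - u)) =
        ((((starRingEnd ℂ) (w - u) * (v - u)).re : ℝ) : ℂ) :=
      Complex.ext (by simp) (by rw [h]; simp)
    have h3 : (starRingEnd ℂ) (w - u) * (w - u) = ((‖w - u‖ ^ 2 : ℝ) : ℂ) := by
      rw [mul_comm, Complex.mul_conj, Complex.normSq_eq_norm_sq]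
    have hn' : ((‖w - u‖ ^ 2 : ℝ) : ℂ) ≠ 0 := by exact_mod_cast hn
    rw [Complex.ofReal_div, ← h2, div_mul_eq_mul_div, eq_div_iff hn', ← h3]
    ring
  rcases eq_endpoint_of_norm_chord hu hw hv (t := ((starRingEnd ℂ) (w - u) * (v - u)).re /
    ‖w - u‖ ^ 2) (by rw [← h1]; ring) with h | h
  · exact huv h
  · exact hvw h

theorem eventually_mul_le {c : ℝ} (k : ℝ) (hc : 0 < c) : ∀ᶠ δ in 𝓝[>] (0 : ℝ), k * δ ≤ c := by
  have : Filter.Tendsto (fun δ : ℝ => k * δ) (𝓝[>] 0) (𝓝 0) := by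
    have h : Filter.Tendsto (fun δ : ℝ => k * δ) (𝓝 0) (𝓝 (k * 0)) :=
      (by fun_prop : Continuous fun δ : ℝ => k * δ).tendsto 0
    rw [mul_zero] at h
    exact h.mono_left nhdsWithin_le_nhds
  exact (this.eventually (gt_mem_nhds hc)).mono fun _ h => h.le

theorem norm_sub_le_two {u v : ℂ} (hu : ‖u‖ = 1) (hv : ‖v‖ = 1) : ‖v - u‖ ≤ 2 := by
  have := norm_sub_le v u
  linarith

namespace Drawing

variable {V : Type*} {G : SimpleGraph V} (D : Drawing G)

theorem norm_pos (v : V) : ‖(D.pos v : ℂ)‖ = 1 := Circle.norm_coe _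

theorem pos_ne {u v : V} (h : u ≠ v) : (D.pos u : ℂ) ≠ D.pos v := fun h1 =>
  h (D.pos_injective (Circle.coe_injective h1))

/-- The trefoils and the bands of the drawing are well separated at scale `δ`. -/
structure Separated (δ : ℝ) : Prop where
  pos : 0 < δ
  edge_good : ∀ u v, G.Adj u v → EdgeGoodAt (D.pos u) (D.pos v) (D.height u v) δ (-D.pos u)
  vertex_far : ∀ u v, u ≠ v → 14 * δ ≤ ‖(D.pos u : ℂ) - D.pos v‖
  band_far : ∀ u v w, G.Adj u v → w ≠ u → w ≠ v →
    ∀ x ∈ band (D.pos u) (D.pos v) (D.height u v) δ, 7 * δ ≤ ‖x.1 - D.pos w‖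
  band_disjoint : ∀ u v u' v', G.Adj u v → G.Adj u' v' → s(u, v) ≠ s(u', v') →
    Disjoint (band (D.pos u) (D.pos v) (D.height u v) δ)
      (band (D.pos u') (D.pos v') (D.height u' v') δ)

theorem eventually_edge_good {u v : V} (huv : u ≠ v) : ∀ᶠ δ in 𝓝[>] (0 : ℝ),
    EdgeGoodAt (D.pos u) (D.pos v) (D.height u v) δ (-D.pos u) := by
  have hL : 0 < ‖(D.pos v : ℂ) - D.pos u‖ := norm_pos_iff.2 (sub_ne_zero.2 (D.pos_ne huv.symm))
  obtain ⟨η, hη, h1⟩ := Metric.eventually_nhds_iff.1 (D.height_eq_zero u v)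
  obtain ⟨η', hη', h2⟩ := Metric.eventually_nhds_iff.1 (D.height_eq_zero v u)
  filter_upwards [self_mem_nhdsWithin, eventually_mul_le 1 (by norm_num : (0 : ℝ) < 1 / 10),
    eventually_mul_le 20 hL, eventually_mul_le 14 (mul_pos hη hL),
    eventually_mul_le 14 (mul_pos hη' hL)] with δ hδ k1 k2 k3 k4
  have hδ0 : 0 < δ := hδ
  refine ⟨⟨hδ, by linarith, k2, norm_sub_le_two (D.norm_pos u) (D.norm_pos v),
    D.height_continuous u v, fun t ht => h1 ?_, fun t ht => ?_⟩, by rw [norm_neg, D.norm_pos], ?_⟩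
  · rw [Real.dist_eq, sub_zero]
    exact lt_of_mul_lt_mul_right (a := ‖(D.pos v : ℂ) - D.pos u‖) (by linarith) hL.le
  · rw [D.height_symm v u]
    refine h2 ?_
    rw [Real.dist_eq, sub_zero]
    exact lt_of_mul_lt_mul_right (a := ‖(D.pos v : ℂ) - D.pos u‖) (by linarith) hL.le
  -- The trefoil at `u` faces the centre, and the inner product of `-u` with `v - u` is `1 - Re (ū
  -- v) ≥ 0`: every edge leaves on this side.
  · have h3 : (starRingEnd ℂ) (-(D.pos u : ℂ)) * (D.pos v - D.pos u) =
        1 - (starRingEnd ℂ) (D.pos u : ℂ) * D.pos v := by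
      have h4 : (starRingEnd ℂ) (D.pos u : ℂ) * D.pos u = 1 := by
        rw [mul_comm, Complex.mul_conj, Complex.normSq_eq_norm_sq, D.norm_pos]
        simp
      rw [map_neg]
      linear_combination h4
    rw [h3, Complex.sub_re, Complex.one_re, sub_nonneg]
    refine (Complex.re_le_norm _).trans ?_
    rw [norm_mul, RCLike.norm_conj, D.norm_pos, D.norm_pos, one_mul]

/-- The arc of an edge in space. -/
noncomputable def arc (u v : V) (t : ℝ) : Space :=
  (D.pos u + t * (D.pos v - D.pos u), D.height u v t)

theorem continuous_arc (u v : V) : Continuous (D.arc u v) := by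
  have := D.height_continuous u v
  unfold arc
  fun_prop

theorem exists_arc_of_mem_band {u v : V} {δ : ℝ} (hδ : 0 < δ) (hδ1 : δ ≤ 1) {x : Space}
    (hx : x ∈ band (D.pos u) (D.pos v) (D.height u v) δ) :
    ∃ t ∈ Set.Icc (0 : ℝ) 1, ‖x.1 - (D.arc u v t).1‖ ≤ 2 * δ ∧ ‖x - D.arc u v t‖ ≤ 2 * δ := by
  obtain ⟨t, ε, ζ, h1, h2, h3, h4, rfl⟩ := hx
  have h5 := norm_sub_le_two (D.norm_pos u) (D.norm_pos v)
  have h6 : ‖(ε : ℂ) * δ ^ 2 * Complex.I * (D.pos v - D.pos u)‖ ≤ 2 * δ := by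
    simp only [norm_mul, norm_pow, Complex.norm_I, Complex.norm_real, Real.norm_eq_abs,
      abs_of_pos hδ, mul_one]
    calc |ε| * δ ^ 2 * ‖(D.pos v : ℂ) - D.pos u‖ ≤ 1 * δ ^ 2 * 2 := by gcongr
      _ ≤ _ := by nlinarith
  refine ⟨t, ⟨by linarith, by linarith⟩, ?_, ?_⟩
  · simp only [arc]
    rwa [add_sub_cancel_left]
  · rw [Prod.norm_def]
    refine max_le ?_ ?_
    · simp only [arc, Prod.fst_sub]
      rwa [add_sub_cancel_left]
    · simp only [arc, Prod.snd_sub]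
      rw [add_sub_cancel_left, norm_mul, Real.norm_of_nonneg hδ.le, Real.norm_eq_abs]
      nlinarith

/-- The compact chord misses the vertex `w`; a distance of `9 δ` from the chord leaves `7 δ` from
the band. -/
theorem eventually_band_far {u v w : V} (hu : w ≠ u) (hv : w ≠ v) : ∀ᶠ δ in 𝓝[>] (0 : ℝ),
    ∀ x ∈ band (D.pos u) (D.pos v) (D.height u v) δ, 7 * δ ≤ ‖x.1 - D.pos w‖ := by
  have hc : Continuous fun t => ‖(D.arc u v t).1 - D.pos w‖ :=
    ((continuous_fst.comp (D.continuous_arc u v)).sub continuous_const).norm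
  obtain ⟨t₀, -, ht₀⟩ := isCompact_Icc.exists_isMinOn (Set.nonempty_Icc.2 (zero_le_one (α := ℝ)))
    hc.continuousOn
  have hm : 0 < ‖(D.arc u v t₀).1 - D.pos w‖ := by
    rw [norm_pos_iff, sub_ne_zero]
    intro h
    rcases eq_endpoint_of_norm_chord (D.norm_pos u) (D.norm_pos v) (D.norm_pos w) h with h | h
    · exact D.pos_ne hu h
    · exact D.pos_ne hv h
  filter_upwards [self_mem_nhdsWithin, eventually_mul_le 1 one_pos, eventually_mul_le 9 hm]
    with δ hδ k1 k2 x hx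
  obtain ⟨t, ht, h1, -⟩ := D.exists_arc_of_mem_band hδ (by linarith) hx
  have h2 := ht₀ ht
  simp only [Set.mem_ofPred_eq] at h2
  have h3 := norm_sub_le_norm_sub_add_norm_sub (D.arc u v t).1 x.1 (D.pos w)
  rw [norm_sub_rev _ x.1] at h3
  linarith

theorem height_swap (u v : V) : D.height v u = fun t => D.height u v (1 - t) :=
  funext fun t => D.height_symm u v t

theorem band_swap (u v : V) (δ : ℝ) :
    band (D.pos v) (D.pos u) (D.height v u) δ = band (D.pos u) (D.pos v) (D.height u v) δ := by
  rw [D.height_swap, band_symm]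

/-- The widths are of order `δ²`, but the bands start at distance of order `δ` from the vertex, and
the chords have different directions. Projecting a common point across the second chord gives `t
|Im| ≤ 8 δ²`, while `t ≥ δ / 2` and `|Im| ≥ 17 δ`. -/
theorem eventually_band_disjoint_of_common {u v v' : V} (huv : u ≠ v) (huv' : u ≠ v')
    (hvv' : v ≠ v') : ∀ᶠ δ in 𝓝[>] (0 : ℝ),
    Disjoint (band (D.pos u) (D.pos v) (D.height u v) δ)
      (band (D.pos u) (D.pos v') (D.height u v') δ) := by
  have him := im_conj_mul_ne_zero (D.norm_pos u) (D.norm_pos v) (D.norm_pos v')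
    (D.pos_ne huv.symm) (D.pos_ne huv'.symm) (D.pos_ne hvv')
  filter_upwards [self_mem_nhdsWithin, eventually_mul_le 17 (abs_pos.2 him)] with δ hδ k2
  have hδ0 : 0 < δ := hδ
  rw [Set.disjoint_left]
  rintro _ ⟨t, ε, ζ, h1, -, h3, -, rfl⟩ ⟨t', ε', ζ', -, -, h3', -, heq⟩
  have heq1 := (Prod.ext_iff.1 heq).1
  simp only [add_assoc, add_right_inj] at heq1
  have hz := norm_sub_le_two (D.norm_pos u) (D.norm_pos v)
  have hz' := norm_sub_le_two (D.norm_pos u) (D.norm_pos v')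
  set z := (D.pos v : ℂ) - D.pos u
  set z' := (D.pos v' : ℂ) - D.pos u
  have key : t * ((starRingEnd ℂ) z' * z).im + ε * δ ^ 2 * ((starRingEnd ℂ) z' * z).re =
      ε' * δ ^ 2 * ‖z'‖ ^ 2 := by
    have h5 : ((t : ℂ) + (ε * δ ^ 2 : ℝ) * Complex.I) * ((starRingEnd ℂ) z' * z) =
        ((t' : ℂ) + (ε' * δ ^ 2 : ℝ) * Complex.I) * (‖z'‖ ^ 2 : ℝ) := by
      have h6 : (starRingEnd ℂ) z' * z' = ((‖z'‖ ^ 2 : ℝ) : ℂ) := by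
        rw [mul_comm, Complex.mul_conj, Complex.normSq_eq_norm_sq]
      rw [← h6]
      push_cast
      linear_combination (starRingEnd ℂ) z' * heq1
    have h7 := congrArg Complex.im h5
    rw [Complex.mul_im, Complex.im_mul_ofReal] at h7
    simp only [Complex.add_re, Complex.add_im, Complex.ofReal_re, Complex.ofReal_im,
      Complex.re_ofReal_mul, Complex.im_ofReal_mul, Complex.I_re, Complex.I_im] at h7
    linarith
  have hre : |((starRingEnd ℂ) z' * z).re| ≤ 4 := by
    refine (Complex.abs_re_le_norm _).trans ?_
    rw [norm_mul, RCLike.norm_conj]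
    nlinarith [norm_nonneg z, norm_nonneg z']
  have hbound : t * |((starRingEnd ℂ) z' * z).im| ≤ 8 * δ ^ 2 := by
    have h8 : t * ((starRingEnd ℂ) z' * z).im =
        ε' * δ ^ 2 * ‖z'‖ ^ 2 - ε * δ ^ 2 * ((starRingEnd ℂ) z' * z).re := by linarith
    have ht0 : 0 ≤ t := by linarith
    rw [← abs_of_nonneg ht0, ← abs_mul, h8]
    refine (abs_sub _ _).trans ?_
    rw [abs_mul, abs_mul, abs_mul, abs_mul, abs_of_nonneg (sq_nonneg δ),
      abs_of_nonneg (sq_nonneg ‖z'‖)]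
    have h9 : |ε'| * δ ^ 2 * ‖z'‖ ^ 2 ≤ 1 * δ ^ 2 * 4 := by
      gcongr
      nlinarith [norm_nonneg z']
    have h10 : |ε| * δ ^ 2 * |((starRingEnd ℂ) z' * z).re| ≤ 1 * δ ^ 2 * 4 := by gcongr
    linarith
  have h11 : δ / 2 * (17 * δ) ≤ t * |((starRingEnd ℂ) z' * z).im| :=
    mul_le_mul h1 k2 (by positivity) (by linarith)
  nlinarith [sq_nonneg δ, mul_pos hδ0 hδ0]

/-- Over a crossing the heights differ, and chords without common endpoint do not meet on the
circle. So the two compact arcs have positive distance, and each band lies within `2 δ` of its arc.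
-/
theorem eventually_band_disjoint_of_ne {u v u' v' : V} (h : G.Adj u v) (h' : G.Adj u' v')
    (h1 : u ≠ u') (h2 : u ≠ v') (h3 : v ≠ u') (h4 : v ≠ v') : ∀ᶠ δ in 𝓝[>] (0 : ℝ),
    Disjoint (band (D.pos u) (D.pos v) (D.height u v) δ)
      (band (D.pos u') (D.pos v') (D.height u' v') δ) := by
  have hc : Continuous fun x : ℝ × ℝ => ‖D.arc u v x.1 - D.arc u' v' x.2‖ :=
    (((D.continuous_arc u v).comp continuous_fst).sub
      ((D.continuous_arc u' v').comp continuous_snd)).norm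
  obtain ⟨⟨t₀, t₀'⟩, ⟨ht₀, ht₀'⟩, hmin⟩ := (isCompact_Icc.prod isCompact_Icc).exists_isMinOn
    ((Set.nonempty_Icc.2 (zero_le_one (α := ℝ))).prod (Set.nonempty_Icc.2 (zero_le_one (α := ℝ))))
    hc.continuousOn
  have hsym : s(u, v) ≠ s(u', v') := by
    rw [Ne, Sym2.eq_iff]
    tauto
  have hm : 0 < ‖D.arc u v t₀ - D.arc u' v' t₀'‖ := by
    rw [norm_pos_iff, sub_ne_zero]
    intro heq
    obtain ⟨e1, e2⟩ := Prod.ext_iff.1 heq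
    simp only [arc] at e1 e2
    have hend : ∀ {a b : V} {s : ℝ}, s ∈ Set.Icc (0 : ℝ) 1 → s ∉ Set.Ioo (0 : ℝ) 1 →
        ((D.pos a : ℂ) + s * (D.pos b - D.pos a) = D.pos a ∨
          (D.pos a : ℂ) + s * (D.pos b - D.pos a) = D.pos b) := by
      rintro a b s ⟨hs0, hs1⟩ hs
      rcases hs0.eq_or_lt with rfl | hs0
      · left; simp
      · right
        obtain rfl : s = 1 := le_antisymm hs1 (not_lt.1 fun h => hs ⟨hs0, h⟩)
        push_cast; ring
    by_cases i1 : t₀ ∈ Set.Ioo (0 : ℝ) 1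
    · by_cases i2 : t₀' ∈ Set.Ioo (0 : ℝ) 1
      · exact D.height_ne u v u' v' h h' hsym t₀ i1 t₀' i2 e1 e2
      · rcases hend (a := u') (b := v') ht₀' i2 with e3 | e3 <;> rw [e3] at e1 <;>
          rcases eq_endpoint_of_norm_chord (D.norm_pos u) (D.norm_pos v) (D.norm_pos _) e1
            with e4 | e4
        · exact D.pos_ne h1 e4.symm
        · exact D.pos_ne h3 e4.symm
        · exact D.pos_ne h2 e4.symm
        · exact D.pos_ne h4 e4.symm
    · rcases hend (a := u) (b := v) ht₀ i1 with e3 | e3 <;> rw [e3] at e1 <;>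
        rcases eq_endpoint_of_norm_chord (D.norm_pos u') (D.norm_pos v') (D.norm_pos _) e1.symm
          with e4 | e4
      · exact D.pos_ne h1 e4
      · exact D.pos_ne h2 e4
      · exact D.pos_ne h3 e4
      · exact D.pos_ne h4 e4
  filter_upwards [self_mem_nhdsWithin, eventually_mul_le 1 one_pos, eventually_mul_le 5 hm]
    with δ hδ k1 k2
  have hδ0 : 0 < δ := hδ
  rw [Set.disjoint_left]
  intro x hx hx'
  obtain ⟨t, ht, -, j1⟩ := D.exists_arc_of_mem_band hδ (by linarith) hx
  obtain ⟨t', ht', -, j2⟩ := D.exists_arc_of_mem_band hδ (by linarith) hx'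
  have j3 := hmin (Set.mk_mem_prod ht ht')
  simp only [Set.mem_ofPred_eq] at j3
  have j4 := norm_sub_le_norm_sub_add_norm_sub (D.arc u v t) x (D.arc u' v' t')
  rw [norm_sub_rev _ x] at j4
  linarith

theorem eventually_separated [Finite V] : ∀ᶠ δ in 𝓝[>] (0 : ℝ), D.Separated δ := by
  have e1 : ∀ᶠ δ in 𝓝[>] (0 : ℝ), ∀ u v, G.Adj u v →
      EdgeGoodAt (D.pos u) (D.pos v) (D.height u v) δ (-D.pos u) := by
    simp only [Filter.eventually_all]
    exact fun u v h => D.eventually_edge_good h.ne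
  have e2 : ∀ᶠ δ in 𝓝[>] (0 : ℝ), ∀ u v, u ≠ v → 14 * δ ≤ ‖(D.pos u : ℂ) - D.pos v‖ := by
    simp only [Filter.eventually_all]
    exact fun u v h => eventually_mul_le 14 (norm_pos_iff.2 (sub_ne_zero.2 (D.pos_ne h)))
  have e3 : ∀ᶠ δ in 𝓝[>] (0 : ℝ), ∀ u v w, G.Adj u v → w ≠ u → w ≠ v →
      ∀ x ∈ band (D.pos u) (D.pos v) (D.height u v) δ, 7 * δ ≤ ‖x.1 - D.pos w‖ := by
    simp only [Filter.eventually_all (ι := V)]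
    refine fun u v w => ?_
    by_cases h : w ≠ u ∧ w ≠ v
    · exact (D.eventually_band_far h.1 h.2).mono fun δ hδ _ _ _ => hδ
    · exact Filter.Eventually.of_forall fun δ _ hu hv => absurd ⟨hu, hv⟩ h
  have e4 : ∀ᶠ δ in 𝓝[>] (0 : ℝ), ∀ u v u' v', G.Adj u v → G.Adj u' v' → s(u, v) ≠ s(u', v') →
      Disjoint (band (D.pos u) (D.pos v) (D.height u v) δ)
        (band (D.pos u') (D.pos v') (D.height u' v') δ) := by
    simp only [Filter.eventually_all]
    intro u v u' v' h h' hne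
    by_cases h1 : u = u'
    · subst h1
      exact D.eventually_band_disjoint_of_common h.ne h'.ne fun h2 => hne (by rw [h2])
    by_cases h2 : u = v'
    · subst h2
      simp only [D.band_swap u u']
      exact D.eventually_band_disjoint_of_common h.ne h'.ne' fun h2 =>
        hne (by rw [h2, Sym2.eq_swap])
    by_cases h3 : v = u'
    · subst h3
      simp only [D.band_swap v u]
      exact D.eventually_band_disjoint_of_common h.ne' h'.ne h2
    by_cases h4 : v = v'
    · subst h4
      simp only [D.band_swap v u, D.band_swap v u']
      exact D.eventually_band_disjoint_of_common h.ne' h'.ne' h1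
    exact D.eventually_band_disjoint_of_ne h h' h1 h2 h3 h4
  filter_upwards [self_mem_nhdsWithin, e1, e2, e3, e4] with δ h0 h1 h2 h3 h4
  exact ⟨h0, h1, h2, h3, h4⟩

end Drawing

/-! ### A linking invariant -/

/-- The contraction of `C` to a point, composed with `f`, is lifted through the covering `exp`,
starting from a constant logarithm. -/
theorem exists_log_of_convex {E : Type*} [NormedAddCommGroup E] [NormedSpace ℝ E] {C : Set E}
    (hC : Convex ℝ C) {f : E → ℂ} (hf : ContinuousOn f C) (h0 : ∀ x ∈ C, f x ≠ 0) :
    ∃ g : E → ℂ, ContinuousOn g C ∧ ∀ x ∈ C, Complex.exp (g x) = f x := by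
  classical
  rcases C.eq_empty_or_nonempty with rfl | ⟨x₀, hx₀⟩
  · exact ⟨f, hf, fun x hx => hx.elim⟩
  have hmem : ∀ (t : unitInterval) (a : C), x₀ + (t : ℝ) • ((a : E) - x₀) ∈ C := fun t a =>
    hC.add_smul_sub_mem hx₀ a.2 t.2
  let H : C(unitInterval × C, {z : ℂ // z ≠ 0}) :=
    ⟨fun x => ⟨f (x₀ + (x.1 : ℝ) • ((x.2 : E) - x₀)), h0 _ (hmem x.1 x.2)⟩, by
      refine Continuous.subtype_mk ?_ _
      have h1 : Continuous fun x : unitInterval × C =>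
          (⟨x₀ + (x.1 : ℝ) • ((x.2 : E) - x₀), hmem x.1 x.2⟩ : C) :=
        Continuous.subtype_mk (by fun_prop) _
      exact (continuousOn_iff_continuous_domRestrict.1 hf).comp h1⟩
  let F : C(C, ℂ) := ContinuousMap.const C (Complex.log (f x₀))
  have hH0 : ∀ a, H (0, a) = ⟨Complex.exp (F a), Complex.exp_ne_zero _⟩ := by
    intro a
    refine Subtype.ext ?_
    simp only [H, F, ContinuousMap.coe_mk, ContinuousMap.const_apply]
    rw [Complex.exp_log (h0 _ hx₀)]
    simp
  let G := Complex.isCoveringMap_exp.liftHomotopy H F hH0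
  have hG : ∀ x : C, Complex.exp (G (1, x)) = f x := by
    intro x
    have h1 := congrFun (Complex.isCoveringMap_exp.liftHomotopy_lifts H F hH0) (1, x)
    have h2 := congrArg Subtype.val h1
    simp only [Function.comp_apply, H, ContinuousMap.coe_mk] at h2
    rw [show f x = f (x₀ + ((1 : unitInterval) : ℝ) • ((x : E) - x₀)) by simp]
    exact h2
  refine ⟨fun x => if hx : x ∈ C then G (1, ⟨x, hx⟩) else 0, ?_, fun x hx => ?_⟩
  · rw [continuousOn_iff_continuous_domRestrict]
    convert G.continuous.comp (Continuous.prodMk_right (1 : unitInterval)) using 1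
    ext x
    simp [x.2]
  · simp only [dif_pos hx]
    exact hG ⟨x, hx⟩

/-- Some continuous function without zeros outside `B` has no continuous logarithm on `A`. -/
def Linked (A B : Set Space) : Prop :=
  ∃ f : Space → ℂ, ContinuousOn f Bᶜ ∧ (∀ x ∉ B, f x ≠ 0) ∧
    ¬∃ g : Space → ℂ, ContinuousOn g A ∧ ∀ x ∈ A, Complex.exp (g x) = f x

theorem Linked.image {A B : Set Space} (h : Linked A B) (H : Space ≃ₜ Space) :
    Linked (H '' A) (H '' B) := by
  obtain ⟨f, h1, h2, h3⟩ := h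
  have hmem : ∀ {x : Space} {C : Set Space}, x ∉ H '' C → H.symm x ∉ C := by
    intro x C hx hxC
    exact hx ⟨_, hxC, by simp⟩
  refine ⟨f ∘ H.symm, h1.comp H.symm.continuous.continuousOn fun x hx => hmem hx,
    fun x hx => h2 _ (hmem hx), ?_⟩
  rintro ⟨g, hg1, hg2⟩
  refine h3 ⟨g ∘ H, hg1.comp H.continuous.continuousOn fun x hx => Set.mem_image_of_mem _ hx,
    fun x hx => ?_⟩
  simpa using hg2 _ (Set.mem_image_of_mem H hx)

theorem linked_image_iff {A B : Set Space} (H : Space ≃ₜ Space) :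
    Linked (H '' A) (H '' B) ↔ Linked A B := by
  refine ⟨fun h => ?_, fun h => h.image H⟩
  have := h.image H.symm
  simpa [Set.image_image] using this

theorem not_linked_of_convex {A B C : Set Space} (hC : Convex ℝ C) (hA : A ⊆ C)
    (hB : Disjoint C B) : ¬Linked A B := by
  rintro ⟨f, h1, h2, h3⟩
  obtain ⟨g, hg1, hg2⟩ := exists_log_of_convex hC (h1.mono fun x hx =>
    Set.disjoint_left.1 hB hx) fun x hx => h2 x (Set.disjoint_left.1 hB hx)
  exact h3 ⟨g, hg1.mono hA, fun x hx => hg2 x (hA hx)⟩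

theorem not_linked_of_parametrization {E : Type*} [NormedAddCommGroup E] [NormedSpace ℝ E]
    {A B : Set Space} {C : Set E} (hC : Convex ℝ C) {φ : E → Space} (hφ : ContinuousOn φ C)
    {ψ : Space → E} (hψ : ContinuousOn ψ A) (hψC : Set.MapsTo ψ A C) (hφψ : ∀ x ∈ A, φ (ψ x) = x)
    (hB : ∀ x ∈ C, φ x ∉ B) : ¬Linked A B := by
  rintro ⟨f, h1, h2, h3⟩
  obtain ⟨g, hg1, hg2⟩ := exists_log_of_convex hC (f := f ∘ φ) (h1.comp hφ hB)
    fun x hx => h2 _ (hB x hx)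
  refine h3 ⟨g ∘ ψ, hg1.comp hψ hψC, fun x hx => ?_⟩
  simp only [Function.comp_apply]
  rw [hg2 _ (hψC hx), Function.comp_apply, hφψ x hx]

/-- The open cylinder of radius `7 δ` over `p` is convex, contains the trefoil and misses `B`. -/
theorem not_linked_of_cylinder {p d : ℂ} {δ : ℝ} (hd : ‖d‖ = 1) (hδ : 0 < δ) {B : Set Space}
    (hB : ∀ x ∈ B, 7 * δ ≤ ‖x.1 - p‖) : ¬Linked (trefoil p d δ) B := by
  refine not_linked_of_convex (C := Prod.fst ⁻¹' Metric.ball p (7 * δ)) ?_ (fun x hx => ?_) ?_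
  · exact (convex_ball p (7 * δ)).is_linear_preimage ⟨fun _ _ => rfl, fun _ _ => rfl⟩
  · rw [Set.mem_preimage, mem_ball_iff_norm]
    exact norm_lt_of_mem_trefoil hd hδ hx
  · rw [Set.disjoint_left]
    intro x hx hxB
    rw [Set.mem_preimage, mem_ball_iff_norm] at hx
    linarith [hB x hxB]

/-- The band need not be convex, but it is the image of a box under a map with continuous inverse,
and logarithms exist on the box. -/
theorem EdgeGood.not_linked {p q : ℂ} {h : ℝ → ℝ} {δ : ℝ} (H : EdgeGood p q h δ) (a b : ℤˣ)
    {B : Set Space} (hB : Disjoint (band p q h δ) B) : ¬Linked (claspingUnknot p q h a b δ) B := by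
  have hδ := H.pos
  have hcont := H.cont
  have hδ' : (δ : ℂ) ≠ 0 := by exact_mod_cast hδ.ne'
  have hL : q - p ≠ 0 := norm_pos_iff.1 H.length_pos
  let φ : ℝ × ℝ × ℝ → Space := fun y =>
    (p + y.1 * (q - p) + y.2.1 * δ ^ 2 * Complex.I * (q - p), h y.1 + δ * y.2.2)
  let ψ : Space → ℝ × ℝ × ℝ := fun x => (((x.1 - p) / (q - p)).re,
    ((x.1 - p) / (q - p)).im / δ ^ 2, (x.2 - h ((x.1 - p) / (q - p)).re) / δ)
  have hψφ : ∀ y, ψ (φ y) = y := by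
    intro y
    have h1 : ((φ y).1 - p) / (q - p) = ⟨y.1, y.2.1 * δ ^ 2⟩ := by
      simp only [φ, Complex.mk_eq_add_mul_I]
      push_cast
      field_simp
      ring
    simp only [ψ, h1]
    refine Prod.ext rfl (Prod.ext ?_ ?_)
    · simp only []
      field_simp
    · simp only [φ, add_sub_cancel_left]
      field_simp
  have hsub := claspingUnknot_subset_band (p := p) (q := q) (h := h) (a := a) (b := b) hδ
    (by linarith [H.le_tenth])
  have hband : ∀ x ∈ band p q h δ, ∃ y : ℝ × ℝ × ℝ, y ∈ Set.Icc (δ / 2) (1 - δ / 2) ×ˢ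
      Set.Icc (-1 : ℝ) 1 ×ˢ Set.Icc (-2 : ℝ) 2 ∧ φ y = x := by
    rintro _ ⟨t, ε, ζ, h1, h2, h3, h4, rfl⟩
    exact ⟨(t, ε, ζ), ⟨⟨h1, h2⟩, abs_le.1 h3, abs_le.1 h4⟩, rfl⟩
  refine not_linked_of_parametrization (φ := φ) (ψ := ψ) ((convex_Icc (δ / 2) (1 - δ / 2)).prod
    ((convex_Icc (-1 : ℝ) 1).prod (convex_Icc (-2 : ℝ) 2))) ?_ ?_ ?_ ?_ ?_
  · exact Continuous.continuousOn (by fun_prop)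
  · exact Continuous.continuousOn (by fun_prop)
  · intro x hx
    obtain ⟨y, hy, rfl⟩ := hband x (hsub hx)
    rwa [hψφ]
  · intro x hx
    obtain ⟨y, hy, rfl⟩ := hband x (hsub hx)
    rw [hψφ]
  · rintro y ⟨h1, h2, h3⟩ hyB
    exact Set.disjoint_left.1 hB ⟨y.1, y.2.1, y.2.2, h1.1, h1.2, abs_le.2 h2, abs_le.2 h3, rfl⟩ hyB

/-- A continuous logarithm cannot exist along a curve which crosses the negative real axis once if
the complement of the crossing is connected. -/
theorem false_of_log_crossing {S : Set Space} {s : Space} (hs : s ∈ S)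
    (hconn : IsPreconnected (S \ {s})) {f g : Space → ℂ} (hf : ContinuousOn f S)
    (hg : ContinuousOn g S) (hexp : ∀ x ∈ S, Complex.exp (g x) = f x)
    (hslit : ∀ x ∈ S \ {s}, f x ∈ Complex.slitPlane) {γ : ℝ → Space} (hγ : Continuous γ)
    (hγ0 : γ 0 = s) {η : ℝ} (hη : 0 < η) (hγS : ∀ t, |t| < η → γ t ∈ S)
    (hfγ : ∀ t, |t| < η → f (γ t) = ⟨-1, t⟩) : False := by
  -- Off the crossing, `G` takes values in `2πiℤ` and is therefore constant on the connected
  -- remainder. At the crossing `g` is continuous while the principal logarithm jumps by `2πi`, a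
  -- contradiction.
  let G : Space → ℂ := fun x => g x - Complex.log (f x)
  have hγs : ∀ t, |t| < η → t ≠ 0 → γ t ∈ S \ {s} := by
    intro t ht ht0
    refine ⟨hγS t ht, fun h => ht0 ?_⟩
    have h1 := hfγ t ht
    rw [Set.mem_singleton_iff.1 h, ← hγ0, hfγ 0 (by simpa using hη)] at h1
    exact (Complex.ext_iff.1 h1).2.symm
  have hGc : ContinuousOn G (S \ {s}) :=
    (hg.mono Set.sdiff_subset).sub ((hf.mono Set.sdiff_subset).clog hslit)
  have hint : ∀ x ∈ S \ {s}, ∃ n : ℤ, G x = n * (2 * Real.pi * Complex.I) := by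
    intro x hx
    have h1 : Complex.exp (G x) = 1 := by
      simp only [G]
      rw [Complex.exp_sub, hexp x hx.1, Complex.exp_log (Complex.slitPlane_ne_zero (hslit x hx)),
        div_self (Complex.slitPlane_ne_zero (hslit x hx))]
    exact Complex.exp_eq_one_iff.1 h1
  let N : Space → ℝ := fun x => (G x).im / (2 * Real.pi)
  have hNc : ContinuousOn N (S \ {s}) := (Complex.continuous_im.comp_continuousOn hGc).div_const _
  have hNint : ∀ x ∈ S \ {s}, ∃ n : ℤ, N x = n := by
    intro x hx
    obtain ⟨n, hn⟩ := hint x hx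
    refine ⟨n, ?_⟩
    simp only [N, hn]
    have := Real.pi_pos.ne'
    simp
  have hNconst : ∀ x ∈ S \ {s}, ∀ y ∈ S \ {s}, N x = N y := by
    intro x hx y hy
    have himg : IsPreconnected (N '' (S \ {s})) := hconn.image _ hNc
    have hsub : N '' (S \ {s}) ⊆ Set.range ((↑) : ℤ → ℝ) := by
      rintro _ ⟨z, hz, rfl⟩
      obtain ⟨n, hn⟩ := hNint z hz
      exact ⟨n, hn.symm⟩
    have hcount : (Set.range ((↑) : ℤ → ℝ)).Countable := Set.countable_range _
    exact (hcount.mono hsub).isTotallyDisconnected _ subset_rfl himg (Set.mem_image_of_mem _ hx)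
      (Set.mem_image_of_mem _ hy)
  have hlim : ∀ {l : Filter ℝ}, l ≤ 𝓝[≠] 0 → ∀ a : ℝ,
      Filter.Tendsto (fun t : ℝ => (Complex.log ⟨-1, t⟩).im) l (𝓝 a) →
      Filter.Tendsto (fun t => N (γ t)) l (𝓝 (((g s).im - a) / (2 * Real.pi))) := by
    intro l hl a ha
    have h0 : ∀ᶠ t in 𝓝 (0 : ℝ), |t| < η :=
      continuous_abs.continuousAt.eventually (gt_mem_nhds (by simpa using hη))
    have hγS' : Filter.Tendsto γ l (𝓝[S] s) := by
      refine tendsto_nhdsWithin_iff.2 ⟨?_, ?_⟩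
      · exact hγ0 ▸ (hγ.tendsto 0).mono_left (hl.trans nhdsWithin_le_nhds)
      · filter_upwards [hl (nhdsWithin_le_nhds h0)] with t ht
        exact hγS t ht
    have h1 : Filter.Tendsto (fun t => (g (γ t)).im) l (𝓝 (g s).im) :=
      (Complex.continuous_im.tendsto _).comp ((hg s hs).tendsto.comp hγS')
    refine ((h1.sub ha).div_const (2 * Real.pi)).congr' ?_
    filter_upwards [hl (nhdsWithin_le_nhds h0)] with t ht
    simp only [N, G, Complex.sub_im, hfγ t ht]
  have hmk : Continuous fun t : ℝ => (⟨-1, t⟩ : ℂ) := by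
    simp only [Complex.mk_eq_add_mul_I]
    fun_prop
  have hmk0 : (⟨-1, 0⟩ : ℂ) = -1 := Complex.ext (by simp) (by simp)
  have hpos : Filter.Tendsto (fun t : ℝ => (Complex.log ⟨-1, t⟩).im) (𝓝[>] 0) (𝓝 Real.pi) := by
    have h1 := (Complex.tendsto_log_nhdsWithin_im_nonneg_of_re_neg_of_im_zero (z := -1) (by simp)
      (by simp))
    have h2 : Filter.Tendsto (fun t : ℝ => (⟨-1, t⟩ : ℂ)) (𝓝[>] 0)
        (𝓝[{z : ℂ | 0 ≤ z.im}] (-1)) := by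
      refine tendsto_nhdsWithin_iff.2 ⟨hmk0 ▸ (hmk.tendsto 0).mono_left nhdsWithin_le_nhds, ?_⟩
      filter_upwards [self_mem_nhdsWithin] with t ht
      exact le_of_lt ht
    have h3 := (Complex.continuous_im.tendsto _).comp (h1.comp h2)
    rwa [Complex.add_im, Complex.ofReal_im, zero_add, Complex.im_ofReal_mul, Complex.I_im,
      mul_one] at h3
  have hneg : Filter.Tendsto (fun t : ℝ => (Complex.log ⟨-1, t⟩).im) (𝓝[<] 0) (𝓝 (-Real.pi)) := by
    have h1 := Complex.tendsto_log_nhdsWithin_im_neg_of_re_neg_of_im_zero (z := -1) (by simp)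
      (by simp)
    have h2 : Filter.Tendsto (fun t : ℝ => (⟨-1, t⟩ : ℂ)) (𝓝[<] 0)
        (𝓝[{z : ℂ | z.im < 0}] (-1)) := by
      refine tendsto_nhdsWithin_iff.2 ⟨hmk0 ▸ (hmk.tendsto 0).mono_left nhdsWithin_le_nhds, ?_⟩
      filter_upwards [self_mem_nhdsWithin] with t ht
      exact ht
    have h3 := (Complex.continuous_im.tendsto _).comp (h1.comp h2)
    rwa [Complex.sub_im, Complex.ofReal_im, zero_sub, Complex.im_ofReal_mul, Complex.I_im,
      mul_one] at h3
  have hc : ∃ c : ℝ, ∀ x ∈ S \ {s}, N x = c := by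
    refine ⟨N (γ (η / 2)), fun x hx => hNconst x hx _ (hγs _ ?_ (by positivity))⟩
    rw [abs_of_pos (by positivity)]
    linarith
  obtain ⟨c, hc⟩ := hc
  have hev : ∀ᶠ t in 𝓝[≠] (0 : ℝ), N (γ t) = c := by
    have h0 : ∀ᶠ t in 𝓝 (0 : ℝ), |t| < η :=
      continuous_abs.continuousAt.eventually (gt_mem_nhds (by simpa using hη))
    filter_upwards [nhdsWithin_le_nhds h0, self_mem_nhdsWithin] with t ht ht0
    exact hc _ (hγs t ht ht0)
  have hgt : 𝓝[>] (0 : ℝ) ≤ 𝓝[≠] 0 := nhdsWithin_mono _ fun t ht => ne_of_gt ht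
  have hlt : 𝓝[<] (0 : ℝ) ≤ 𝓝[≠] 0 := nhdsWithin_mono _ fun t ht => ne_of_lt ht
  have e1 := tendsto_nhds_unique (tendsto_const_nhds.congr' ((hev.filter_mono hgt).mono
    fun t ht => ht.symm)) (hlim hgt _ hpos)
  have e2 := tendsto_nhds_unique (tendsto_const_nhds.congr' ((hev.filter_mono hlt).mono
    fun t ht => ht.symm)) (hlim hlt _ hneg)
  have hpi := Real.pi_pos
  rw [e1] at e2
  field_simp at e2
  linarith

/-- In the chart, `φ` vanishes exactly on the model unknot and is a negative real exactly on the
interior of the plate. The trefoil pierces the plate once, at its centre, so it crosses the cut of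
the logarithm once. -/
theorem EdgeGoodAt.linked {p q d : ℂ} {h : ℝ → ℝ} {δ : ℝ} (H : EdgeGoodAt p q h δ d) (a b : ℤˣ) :
    Linked (trefoil p d δ) (claspingUnknot p q h a b δ) := by
  set F := H.chart a b 1 one_pos with hF
  let φ : ℝ × ℝ × ℝ → ℂ := fun x => ⟨max |x.1| |x.2.1| - 1, x.2.2⟩
  have hφ : Continuous φ := by
    simp only [φ, Complex.mk_eq_add_mul_I]
    fun_prop
  have hφ0 : ∀ x, φ x = 0 → x ∈ modelUnknot := by
    intro x hx
    have h1 := (Complex.ext_iff.1 hx).1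
    have h2 := (Complex.ext_iff.1 hx).2
    simp only [φ, Complex.zero_re, Complex.zero_im] at h1 h2
    have h3 : max |x.1| |x.2.1| = 1 := by linarith
    refine ⟨h3 ▸ le_max_left _ _, h3 ▸ le_max_right _ _, ?_, h2⟩
    rcases max_choice |x.1| |x.2.1| with h4 | h4
    · left; rw [← h4, h3]
    · right; rw [← h4, h3]
  have hf : Continuous fun y => φ (F.symm y) := hφ.comp F.symm.continuous
  have hmemF : ∀ x : ℝ × ℝ × ℝ, |x.1| ≤ 11 / 10 → |x.2.1| ≤ 11 / 10 → |x.2.2| ≤ 1 →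
      (F x ∈ trefoil p d δ ↔ x.1 = 0 ∧ x.2.1 = 0) := by
    intro x h1 h2 h3
    rw [hF, H.chart_apply, vertexChart_mem_trefoil_iff,
      H.edgeChart_mem_thinTrefoil_iff a b 1 one_pos h1 h2 (by rwa [one_mul])]
  have hsite : F 0 = vertexChart p d δ H.dir_ne_zero H.pos.ne' (edgeAngle p q d) (2, 0) := by
    have h1 := (H.chart_eventually_start a b 1 one_pos).self_of_nhds
    have h2 : signFlip 1 (edgeGerm ‖q - p‖ a b δ 1 0) = (2, 0) := by
      rw [signFlip_apply]
      ext1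
      · apply Complex.ext <;> simp [edgeGerm]
      · simp [edgeGerm]
    have h3 := (vertexChart_eventually (p := p) (d := d) (hd := H.dir_ne_zero) (hδ := H.pos.ne')
      (β := edgeAngle p q d)).self_of_nhds
    rw [h3, ← h2]
    exact h1
  refine ⟨fun y => φ (F.symm y), hf.continuousOn, fun y hy hy0 => hy ?_, ?_⟩
  · have := (H.chart_mem_claspingUnknot_iff a b 1 one_pos (F.symm y)).2 (hφ0 _ hy0)
    rwa [← hF, Homeomorph.apply_symm_apply] at this
  rintro ⟨g, hg, hexp⟩
  refine false_of_log_crossing (s := F 0)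
    ((hmemF 0 (by norm_num) (by norm_num) (by norm_num)).2 (by simp)) ?_ hf.continuousOn hg hexp ?_
    (γ := fun t => F (0, 0, t)) (F.continuous.comp (by fun_prop)) rfl
    one_pos (fun t ht => ?_) (fun t ht => ?_)
  · rw [hsite]
    exact isPreconnected_trefoil_diff p d δ H.dir_ne_zero H.pos.ne' (edgeAngle p q d)
  · rintro y ⟨hy, hys⟩
    obtain ⟨x, rfl⟩ := F.surjective y
    simp only [Homeomorph.symm_apply_apply]
    rw [Complex.mem_slitPlane_iff]
    by_contra! hcon
    simp only [φ] at hcon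
    obtain ⟨h1, h2⟩ := hcon
    have h3 : |x.1| ≤ 1 := (le_max_left _ _).trans (by linarith)
    have h4 : |x.2.1| ≤ 1 := (le_max_right |x.1| _).trans (by linarith)
    obtain ⟨h5, h6⟩ := (hmemF x (by linarith) (by linarith) (by rw [h2]; simp)).1 hy
    refine hys ?_
    rw [Set.mem_singleton_iff]
    congr 1
    exact Prod.ext h5 (Prod.ext h6 h2)
  · exact (hmemF _ (by norm_num) (by norm_num) ht.le).2 ⟨rfl, rfl⟩
  · simp [φ]

/-! ### Existence of drawings -/

/-- Two different common points would put both chords on one line, which meets the circle only in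
`u` and `v`. -/
theorem chord_crossing_unique {u v u' v' : ℂ} (hu : ‖u‖ = 1) (hv : ‖v‖ = 1) (hu' : ‖u'‖ = 1)
    (hv' : ‖v'‖ = 1) (hne : ¬((u' = u ∨ u' = v) ∧ (v' = u ∨ v' = v)))
    {t t' s s' : ℝ} (ht : u + t * (v - u) = u' + t' * (v' - u'))
    (hs : u + s * (v - u) = u' + s' * (v' - u')) : u + t * (v - u) = u + s * (v - u) := by
  by_cases hts : t' = s'
  · rw [ht, hs, hts]
  exfalso
  have hts' : ((t' - s' : ℝ) : ℂ) ≠ 0 := by exact_mod_cast sub_ne_zero.2 hts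
  have h1 : v' - u' = (((t - s) / (t' - s') : ℝ) : ℂ) * (v - u) := by
    have h2 : ((t' - s' : ℝ) : ℂ) * (v' - u') = ((t - s : ℝ) : ℂ) * (v - u) := by
      push_cast
      linear_combination hs - ht
    rw [Complex.ofReal_div, div_mul_eq_mul_div, eq_div_iff hts', ← h2]
    ring
  set r := (t - s) / (t' - s')
  refine hne ⟨eq_endpoint_of_norm_chord hu hv hu' (t := t - t' * r) ?_,
    eq_endpoint_of_norm_chord hu hv hv' (t := t + (1 - t') * r) ?_⟩
  · push_cast
    linear_combination ht + t' * h1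
  · push_cast
    linear_combination ht - (1 - t') * h1

theorem exists_drawing {V : Type*} [Finite V] (G : SimpleGraph V) : Nonempty (Drawing G) := by
  have hinf : Infinite Circle := by
    have : Infinite (Set.Ioc (-Real.pi) Real.pi) :=
      (Set.Ioc_infinite (by linarith [Real.pi_pos])).to_subtype
    exact Circle.argEquiv.symm.infinite_iff.1 this
  obtain ⟨e⟩ : Nonempty (V ↪ Circle) :=
    ⟨(Finite.equivFin V).toEmbedding.trans (Fin.valEmbedding.trans (Infinite.natEmbedding Circle))⟩
  have : Finite (Sym2 V) := Quot.finite _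
  obtain ⟨code, hcode⟩ := exists_injective_nat (Sym2 V)
  let P : V → V → ℝ → ℂ := fun u v t => e u + t * ((e v : ℂ) - e u)
  have hn : ∀ v, ‖(e v : ℂ)‖ = 1 := fun v => Circle.norm_coe _
  have hinj : ∀ {u v}, (e u : ℂ) = e v → u = v := fun h => e.injective (Circle.coe_injective h)
  -- There are finitely many pairs of chords, each pair crosses at most once, and strictly inside
  -- the circle; so one `ε` keeps all crossings away from the circle.
  have hε : ∀ᶠ ε in 𝓝[>] (0 : ℝ), ∀ u v u' v', G.Adj u v → G.Adj u' v' → s(u, v) ≠ s(u', v') →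
      ∀ t ∈ Set.Ioo (0 : ℝ) 1, ∀ t' ∈ Set.Ioo (0 : ℝ) 1, P u v t = P u' v' t' →
        ‖P u v t‖ < 1 - ε := by
    simp only [Filter.eventually_all (ι := V)]
    intro u v u' v'
    by_cases hex : G.Adj u v ∧ G.Adj u' v' ∧ s(u, v) ≠ s(u', v') ∧ ∃ t ∈ Set.Ioo (0 : ℝ) 1, ∃ t',
        P u v t = P u' v' t'
    · obtain ⟨huv, huv', hne, t, ht, t', htt'⟩ := hex
      have hlt : ‖P u v t‖ < 1 := by
        have h1 := norm_sq_chord (hn u) (hn v) t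
        have h2 : 0 < ‖(e v : ℂ) - e u‖ :=
          norm_pos_iff.2 (sub_ne_zero.2 fun h => huv.ne' (hinj h))
        have h3 : 0 < t * (1 - t) * ‖(e v : ℂ) - e u‖ ^ 2 :=
          mul_pos (mul_pos ht.1 (by linarith [ht.2])) (by positivity)
        refine lt_of_pow_lt_pow_left₀ 2 zero_le_one ?_
        rw [one_pow]
        exact h1.trans_lt (by linarith)
      filter_upwards [eventually_mul_le 2 (sub_pos.2 hlt), self_mem_nhdsWithin] with ε h1 h2 _ _ _
        s hs s' hs' hss'
      have h3 : P u v s = P u v t := by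
        refine chord_crossing_unique (hn u) (hn v) (hn u') (hn v') ?_
          hss' htt'
        rintro ⟨h3, h4⟩
        have h3' : u' = u ∨ u' = v := h3.imp hinj hinj
        have h4' : v' = u ∨ v' = v := h4.imp hinj hinj
        have h5 := huv'.ne
        rw [Ne, Sym2.eq_iff] at hne
        rcases h3' with rfl | rfl <;> rcases h4' with rfl | rfl <;> tauto
      rw [h3]
      have h2' : 0 < ε := h2
      linarith
    · exact Filter.Eventually.of_forall fun ε h h' hne t ht t' ht' heq =>
        absurd ⟨h, h', hne, t, ht, t', heq⟩ hex
  obtain ⟨ε, hε, hε0⟩ := (hε.and self_mem_nhdsWithin).exists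
  have hε0' : 0 < ε := hε0
  have hP : ∀ u v t, P v u t = P u v (1 - t) := by
    intro u v t
    simp only [P]
    push_cast
    ring
  have hPc : ∀ u v, Continuous (P u v) := fun u v => by fun_prop
  exact ⟨{
    pos := e
    pos_injective := e.injective
    -- The second factor depends only on the point of the plane, vanishes near the circle and is
    -- positive at every crossing. There the injective numbering of the edges makes the heights
    -- differ.
    height := fun u v t => (code s(u, v) + 1 : ℝ) * max 0 (1 - ε - ‖P u v t‖)
    height_continuous := fun u v => by
      have := hPc u v
      fun_prop
    height_symm := fun u v t => by
      rw [hP, Sym2.eq_swap]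
    height_eq_zero := fun u v => by
      have h1 : Filter.Tendsto (fun t => ‖P u v t‖) (𝓝 0) (𝓝 1) := by
        convert (hPc u v).norm.tendsto 0 using 2
        simp [P, hn]
      filter_upwards [h1.eventually (lt_mem_nhds (by linarith : 1 - ε < 1))] with t ht
      rw [max_eq_left (by linarith), mul_zero]
    height_ne := fun u v u' v' h h' hne t ht t' ht' heq => by
      have h1 := hε u v u' v' h h' hne t ht t' ht' heq
      have h2 : P u' v' t' = P u v t := heq.symm
      simp only [h2]
      rw [max_eq_right (by linarith)]
      intro h3
      have h4 := mul_right_cancel₀ (ne_of_gt (by linarith : 0 < 1 - ε - ‖P u v t‖)) h3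
      refine hne (hcode ?_)
      exact_mod_cast add_right_cancel h4
    clasp := fun _ _ => 1 }⟩

/-! ### Linked pairs of components -/

theorem not_linked_trefoil_trefoil {p p' d d' : ℂ} {δ : ℝ} (hd : ‖d‖ = 1) (hd' : ‖d'‖ = 1)
    (hδ : 0 < δ) (h : 14 * δ ≤ ‖p - p'‖) : ¬Linked (trefoil p d δ) (trefoil p' d' δ) := by
  refine not_linked_of_cylinder hd hδ fun x hx => ?_
  have h1 := norm_lt_of_mem_trefoil hd' hδ hx
  have h2 := norm_sub_le_norm_sub_add_norm_sub p x.1 p'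
  rw [norm_sub_rev p x.1] at h2
  linarith

theorem EdgeGood.not_linked_trefoil {p q r d : ℂ} {h : ℝ → ℝ} {δ : ℝ} (H : EdgeGood p q h δ)
    (a b : ℤˣ) (hd : ‖d‖ = 1) (hfar : ∀ x ∈ band p q h δ, 7 * δ ≤ ‖x.1 - r‖) :
    ¬(Linked (trefoil r d δ) (claspingUnknot p q h a b δ) ∨
      Linked (claspingUnknot p q h a b δ) (trefoil r d δ)) := by
  rintro (h1 | h1)
  · exact not_linked_of_cylinder hd H.pos (fun x hx => hfar x
      (claspingUnknot_subset_band H.pos (by linarith [H.le_tenth]) hx)) h1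
  · refine H.not_linked a b (Set.disjoint_left.2 fun x hx hx' => ?_) h1
    exact (norm_lt_of_mem_trefoil hd H.pos hx').not_ge (hfar x hx)

theorem EdgeGood.not_linked_claspingUnknot {p q p' q' : ℂ} {h h' : ℝ → ℝ} {δ : ℝ}
    (H : EdgeGood p q h δ) (a b a' b' : ℤˣ) (hdisj : Disjoint (band p q h δ) (band p' q' h' δ)) :
    ¬Linked (claspingUnknot p q h a b δ) (claspingUnknot p' q' h' a' b' δ) :=
  H.not_linked a b (hdisj.mono_right
    (claspingUnknot_subset_band H.pos (by linarith [H.le_tenth])))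

namespace ChainData

variable {c c' : ChainData} {n : ℕ}

/-- The components of the chain in their order along it. -/
noncomputable def comp (c : ChainData) (j : ℕ) : Set Space :=
  if Even j then c.vertex (j / 2) else c.edge (j / 2)

theorem comp_even (c : ChainData) (i : ℕ) : c.comp (2 * i) = c.vertex i := by
  rw [comp, if_pos (even_two_mul i), Nat.mul_div_cancel_left _ two_pos]

theorem comp_odd (c : ChainData) (i : ℕ) : c.comp (2 * i + 1) = c.edge i := by
  rw [comp, if_neg (Nat.not_even_two_mul_add_one i)]
  congr 1
  omega

theorem Good.exists_isotopy_comp (H : c.Good n) (H' : c'.Good n) (hn : 1 ≤ n) :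
    ∃ G, IsotopicToId G ∧ ∀ j < 2 * n - 1, G '' c.comp j = c'.comp j := by
  obtain ⟨-, -, G, hG, h, -⟩ := H.exists_isotopy H' (n - 1) (by omega)
  refine ⟨G, hG, fun j hj => ?_⟩
  obtain ⟨i, rfl | rfl⟩ := Nat.even_or_odd' j
  · rw [comp_even, comp_even]
    exact h (Sum.inl ⟨i, by omega⟩)
  · rw [comp_odd, comp_odd]
    exact h (Sum.inr ⟨i, by omega⟩)

theorem Good.not_linked_vertex_edge (H : c.Good n) {i j : ℕ} (hi : i < n) (hj : j + 1 < n)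
    (h1 : i ≠ j) (h2 : i ≠ j + 1) :
    ¬(Linked (c.vertex i) (c.edge j) ∨ Linked (c.edge j) (c.vertex i)) :=
  (H.edge_good j hj).not_linked_trefoil _ _ (H.norm_dir i hi) (H.band_far j i hj hi h1 h2)

theorem Good.linked_vertex_edge (H : c.Good n) {i : ℕ} (hi : i + 1 < n) :
    Linked (c.vertex i) (c.edge i) :=
  (H.edge_good i hi).linked _ _

theorem Good.linked_vertex_edge' (H : c.Good n) {i : ℕ} (hi : i + 1 < n) :
    Linked (c.vertex (i + 1)) (c.edge i) := by
  rw [H.edge_eq hi]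
  exact (H.edge_good_symm i hi).linked _ _

/-- The relation is symmetrised because the definition of `Linked` treats its two sides differently
and linking is shown only for a trefoil relative to an unknot. -/
theorem Good.linked_comp_iff (H : c.Good n) {i j : ℕ} (hi : i < 2 * n - 1) (hj : j < 2 * n - 1)
    (hij : i ≠ j) : (Linked (c.comp i) (c.comp j) ∨ Linked (c.comp j) (c.comp i)) ↔
      j = i + 1 ∨ i = j + 1 := by
  have key : ∀ k l, k < n → l + 1 < n →
      ((Linked (c.vertex k) (c.edge l) ∨ Linked (c.edge l) (c.vertex k)) ↔
        k = l ∨ k = l + 1) := by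
    intro k l hk hl
    constructor
    · intro h
      by_contra! h'
      exact H.not_linked_vertex_edge hk hl h'.1 h'.2 h
    · rintro (rfl | rfl)
      · exact Or.inl (H.linked_vertex_edge hl)
      · exact Or.inl (H.linked_vertex_edge' hl)
  obtain ⟨k, rfl | rfl⟩ := Nat.even_or_odd' i <;> obtain ⟨l, rfl | rfl⟩ := Nat.even_or_odd' j <;>
    simp only [comp_even, comp_odd]
  · refine iff_of_false ?_ (by omega)
    rintro (h | h)
    · exact not_linked_trefoil_trefoil (H.norm_dir k (by omega)) (H.norm_dir l (by omega)) H.pos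
        (H.vertex_far k l (by omega) (by omega) (by omega)) h
    · exact not_linked_trefoil_trefoil (H.norm_dir l (by omega)) (H.norm_dir k (by omega)) H.pos
        (H.vertex_far l k (by omega) (by omega) (by omega)) h
  · rw [key k l (by omega) (by omega)]
    omega
  · rw [or_comm, key l k (by omega) (by omega)]
    omega
  · refine iff_of_false ?_ (by omega)
    rintro (h | h)
    · exact (H.edge_good k (by omega)).not_linked_claspingUnknot _ _ _ _
        (H.band_disjoint k l (by omega) (by omega) (by omega)) h
    · exact (H.edge_good l (by omega)).not_linked_claspingUnknot _ _ _ _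
        (H.band_disjoint l k (by omega) (by omega) (by omega)) h

/-- The standard string of trefoils. -/
noncomputable def string : ChainData where
  p i := 2 * i
  d _ := Complex.I
  h _ _ := 0
  a _ := 1
  b _ := 1
  δ := 1 / 10

theorem stringOfTrefoils_apply (m : ℕ) (j : Fin m) : stringOfTrefoils m j = string.comp j := by
  obtain ⟨i, hi | hi⟩ := Nat.even_or_odd' (j : ℕ)
  · rw [stringOfTrefoils, if_pos (hi ▸ even_two_mul i), hi, comp_even]
    simp [vertex, string]
  · rw [stringOfTrefoils, if_neg (hi ▸ Nat.not_even_two_mul_add_one i), hi, comp_odd]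
    simp only [edge, string]
    push_cast
    congr 1 <;> ring

theorem abs_le_of_mem_string_band {i : ℕ} {x : Space}
    (hx : x ∈ band (string.p i) (string.p (i + 1)) (string.h i) string.δ) :
    |x.1.re - (2 * i + 1)| ≤ 9 / 10 := by
  obtain ⟨t, ε, ζ, h1, h2, -, -, rfl⟩ := hx
  have h3 : (string.p i + t * (string.p (i + 1) - string.p i) + ε * string.δ ^ 2 * Complex.I *
      (string.p (i + 1) - string.p i) : ℂ) = ((2 * i + 2 * t : ℝ) : ℂ) +
        ((ε * (1 / 10) ^ 2 * 2 : ℝ) : ℂ) * Complex.I := by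
    simp only [string]
    push_cast
    ring
  simp only [h3, Complex.add_re, Complex.ofReal_re, Complex.re_ofReal_mul, Complex.I_re, mul_zero,
    add_zero]
  simp only [string] at h1 h2
  rw [abs_le]
  constructor <;> linarith

theorem string_good (n : ℕ) : string.Good n := by
  have hpδ : (0 : ℝ) < string.δ := by norm_num [string]
  have hd : ‖(Complex.I : ℂ)‖ = 1 := Complex.norm_I
  have hsub : ∀ i, string.p (i + 1) - string.p i = 2 := fun i => by simp [string]; ring
  have hsub' : ∀ i, string.p i - string.p (i + 1) = -2 := fun i => by simp [string]; ring
  have hnat : ∀ i j : ℕ, i ≠ j → (1 : ℝ) ≤ |(i : ℝ) - j| := by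
    intro i j hij
    have : (1 : ℤ) ≤ |(i : ℤ) - j| := Int.one_le_abs (by omega)
    exact_mod_cast this
  -- For edges of length `2` the size `1 / 10` is the extreme case: `δ ≤ 1 / 10` and `20 δ ≤ L` are
  -- both equalities.
  have hgood : ∀ i, EdgeGood (string.p i) (string.p (i + 1)) (string.h i) string.δ := fun i => by
    refine ⟨hpδ, ?_, ?_, ?_, continuous_const, fun _ _ => rfl, fun _ _ => rfl⟩
    · exact le_rfl
    · rw [hsub]; norm_num [string]
    · rw [hsub]; norm_num
  refine ⟨hpδ, fun _ _ => hd, fun i _ => ⟨hgood i, hd, ?_⟩, fun i _ => ⟨(hgood i).symm, hd, ?_⟩,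
    fun i j _ _ hij => ?_, fun i j _ _ h1 h2 x hx => ?_, fun i j _ _ hij => ?_⟩
  · rw [hsub]; simp [string]
  · rw [hsub']; simp [string]
  · have h1 := hnat i j hij
    have h2 : string.p i - string.p j = ((2 * ((i : ℝ) - j) : ℝ) : ℂ) := by
      simp only [string]; push_cast; ring
    rw [h2, Complex.norm_real, Real.norm_eq_abs, abs_mul, abs_two]
    norm_num [string]
    linarith
  · have h3 := abs_le_of_mem_string_band hx
    have h4 : |x.1.re - 2 * j| ≤ ‖x.1 - string.p j‖ := by
      convert Complex.abs_re_le_norm (x.1 - string.p j) using 2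
      simp [string]
    refine le_trans ?_ h4
    norm_num [string]
    rw [abs_le] at h3
    rcases lt_or_gt_of_ne h1 with h | h
    · have : (j : ℝ) + 1 ≤ i := by exact_mod_cast h
      exact le_trans (by linarith) (le_abs_self _)
    · have : (i : ℝ) + 2 ≤ j := by exact_mod_cast (by omega : i + 2 ≤ j)
      exact le_trans (by linarith) (neg_le_abs _)
  · rw [Set.disjoint_left]
    intro x hx hx'
    have h1 := abs_le.1 (abs_le_of_mem_string_band hx)
    have h2 := abs_le.1 (abs_le_of_mem_string_band hx')
    have h3 := hnat i j hij
    rcases le_abs'.1 h3 with h | h <;> linarith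

end ChainData

namespace Drawing

variable {V : Type*} {G : SimpleGraph V} {D : Drawing G} {δ : ℝ}

theorem claspingUnknot_swap (D : Drawing G) (u v : V) (hδ : δ ≤ 1) :
    claspingUnknot (D.pos v) (D.pos u) (D.height v u) (D.clasp v u) (D.clasp u v) δ =
      claspingUnknot (D.pos u) (D.pos v) (D.height u v) (D.clasp u v) (D.clasp v u) δ := by
  rw [D.height_swap, claspingUnknot_symm _ _ _ _ _ _ hδ]

theorem link_inr (D : Drawing G) (hδ : δ ≤ 1) {u v : V} (huv : s(u, v) ∈ G.edgeSet) :
    D.link δ (Sum.inr ⟨s(u, v), huv⟩) =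
      claspingUnknot (D.pos u) (D.pos v) (D.height u v) (D.clasp u v) (D.clasp v u) δ := by
  ext x
  simp only [link, Set.mem_iUnion]
  constructor
  · rintro ⟨u', v', h, hx⟩
    rcases Sym2.eq_iff.1 h with ⟨rfl, rfl⟩ | ⟨rfl, rfl⟩
    · exact hx
    · rwa [D.claspingUnknot_swap _ _ hδ] at hx
  · exact fun hx => ⟨u, v, rfl, hx⟩

theorem norm_neg_pos (D : Drawing G) (v : V) : ‖-(D.pos v : ℂ)‖ = 1 := by
  rw [norm_neg, D.norm_pos]

theorem Separated.le_one (H : D.Separated δ) {u v : V} (huv : G.Adj u v) : δ ≤ 1 := by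
  linarith [(H.edge_good u v huv).le_tenth]

theorem Separated.linked_vertex_edge_iff (H : D.Separated δ) (w : V) (e : G.edgeSet) :
    (Linked (D.link δ (Sum.inl w)) (D.link δ (Sum.inr e)) ∨
      Linked (D.link δ (Sum.inr e)) (D.link δ (Sum.inl w))) ↔ w ∈ (e : Sym2 V) := by
  obtain ⟨e, he⟩ := e
  constructor
  · intro h
    induction e with | _ u v
    by_contra hw
    rw [Sym2.mem_iff, not_or] at hw
    rw [D.link_inr (H.le_one he)] at h
    exact (H.edge_good u v he).not_linked_trefoil _ _ (D.norm_neg_pos w)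
      (H.band_far u v w he hw.1 hw.2) h
  · intro hw
    obtain ⟨v, rfl⟩ := Sym2.mem_iff_exists.1 hw
    rw [D.link_inr (H.le_one he)]
    exact Or.inl ((H.edge_good w v he).linked _ _)

theorem Separated.not_linked_vertex_vertex (H : D.Separated δ) {u v : V} (huv : u ≠ v) :
    ¬Linked (D.link δ (Sum.inl u)) (D.link δ (Sum.inl v)) :=
  not_linked_trefoil_trefoil (D.norm_neg_pos u) (D.norm_neg_pos v) H.pos (H.vertex_far u v huv)

theorem Separated.not_linked_edge_edge (H : D.Separated δ) {e e' : G.edgeSet} (hee' : e ≠ e') :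
    ¬Linked (D.link δ (Sum.inr e)) (D.link δ (Sum.inr e')) := by
  obtain ⟨e, he⟩ := e
  obtain ⟨e', he'⟩ := e'
  induction e with | _ u v
  induction e' with | _ u' v'
  rw [D.link_inr (H.le_one he), D.link_inr (H.le_one he)]
  exact (H.edge_good u v he).not_linked_claspingUnknot _ _ _ _
    (H.band_disjoint u v u' v' he he' fun h => hee' (Subtype.ext h))

end Drawing

/-! ### Paths among the vertices and edges of a graph -/

/-- One of `x` and `y` is a vertex and the other is an edge that ends there. -/
def SimpleGraph.Incident {V : Type*} (G : SimpleGraph V) : V ⊕ G.edgeSet → V ⊕ G.edgeSet → Prop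
  | Sum.inl v, Sum.inr e => v ∈ (e : Sym2 V)
  | Sum.inr e, Sum.inl v => v ∈ (e : Sym2 V)
  | _, _ => False

theorem Drawing.Separated.linked_iff {V : Type*} {G : SimpleGraph V} {D : Drawing G} {δ : ℝ}
    (H : D.Separated δ) {x y : V ⊕ G.edgeSet} (hxy : x ≠ y) :
    (Linked (D.link δ x) (D.link δ y) ∨ Linked (D.link δ y) (D.link δ x)) ↔ G.Incident x y := by
  rcases x with u | e <;> rcases y with v | e'
  · refine iff_of_false ?_ id
    rintro (h | h)
    · exact H.not_linked_vertex_vertex (fun h => hxy (congrArg _ h)) h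
    · exact H.not_linked_vertex_vertex (fun h => hxy (congrArg _ h.symm)) h
  · exact H.linked_vertex_edge_iff u e'
  · rw [or_comm]
    exact H.linked_vertex_edge_iff v e
  · refine iff_of_false ?_ id
    rintro (h | h)
    · exact H.not_linked_edge_edge (fun h => hxy (congrArg _ h)) h
    · exact H.not_linked_edge_edge (fun h => hxy (congrArg _ h.symm)) h

/-- An induced path with `2 * n - 1` nodes in the incidence graph of `G` gives a path with `n`
vertices in `G`. -/
theorem SimpleGraph.exists_path_of_incident {V : Type*} {G : SimpleGraph V} {n : ℕ} (hn : 1 ≤ n)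
    {c : ℕ → V ⊕ G.edgeSet} (hc : Set.InjOn c (Set.Iio (2 * n - 1)))
    (hinc : ∀ i < 2 * n - 1, ∀ j < 2 * n - 1, i ≠ j →
      (G.Incident (c i) (c j) ↔ j = i + 1 ∨ i = j + 1)) :
    ∃ v : ℕ → V, Set.InjOn v (Set.Iio n) ∧ ∀ i, i + 1 < n → G.Adj (v i) (v (i + 1)) := by
  have hnext : ∀ i, i + 1 < 2 * n - 1 → G.Incident (c i) (c (i + 1)) := fun i hi =>
    (hinc i (by omega) (i + 1) hi (by omega)).2 (Or.inl rfl)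
  have hinl : ∀ {i v}, i + 1 < 2 * n - 1 → c i = Sum.inl v →
      ∃ e : G.edgeSet, c (i + 1) = Sum.inr e ∧ v ∈ (e : Sym2 V) := by
    intro i v hi hv
    have h := hnext i hi
    rw [hv] at h
    rcases hx : c (i + 1) with w | e
    · rw [hx] at h; exact h.elim
    · rw [hx] at h; exact ⟨e, rfl, h⟩
  have hinr : ∀ {i} {e : G.edgeSet}, i + 1 < 2 * n - 1 → c i = Sum.inr e →
      ∃ v, c (i + 1) = Sum.inl v ∧ v ∈ (e : Sym2 V) := by
    intro i e hi he
    have h := hnext i hi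
    rw [he] at h
    rcases hx : c (i + 1) with v | e'
    · rw [hx] at h; exact ⟨v, rfl, h⟩
    · rw [hx] at h; exact h.elim
  have hadj : ∀ {e : G.edgeSet} {u v : V}, u ∈ (e : Sym2 V) → v ∈ (e : Sym2 V) → u ≠ v →
      G.Adj u v := by
    intro e u v hu hv huv
    have h := e.2
    rwa [(Sym2.mem_and_mem_iff huv).1 ⟨hu, hv⟩] at h
  rcases h0 : c 0 with v₀ | e₀
  · have hv : ∀ i < n, ∃ v, c (2 * i) = Sum.inl v := by
      intro i hi
      induction i with
      | zero => exact ⟨v₀, h0⟩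
      | succ i ih =>
        obtain ⟨v, hv⟩ := ih (by omega)
        obtain ⟨e, he, -⟩ := hinl (by omega) hv
        obtain ⟨w, hw, -⟩ := hinr (by omega) he
        exact ⟨w, hw⟩
    have : Nonempty V := ⟨v₀⟩
    choose! v hv using hv
    have hinj : Set.InjOn v (Set.Iio n) := by
      intro i hi j hj hij
      rw [Set.mem_Iio] at hi hj
      have := hc (show 2 * i < 2 * n - 1 by omega) (show 2 * j < 2 * n - 1 by omega)
        (by rw [hv i hi, hv j hj, hij])
      omega
    refine ⟨v, hinj, fun i hi => ?_⟩
    obtain ⟨e, he, h1⟩ := hinl (by omega) (hv i (by omega))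
    obtain ⟨w, hw, h2⟩ := hinr (by omega) he
    obtain rfl : v (i + 1) = w := Sum.inl_injective ((hv (i + 1) hi).symm.trans hw)
    exact hadj h1 h2 fun h => by
      have := hinj (show i < n by omega) hi h
      omega
  · have he : ∀ i < n, ∃ e, c (2 * i) = Sum.inr e := by
      intro i hi
      induction i with
      | zero => exact ⟨e₀, h0⟩
      | succ i ih =>
        obtain ⟨e, he⟩ := ih (by omega)
        obtain ⟨v, hv, -⟩ := hinr (by omega) he
        obtain ⟨e', he', -⟩ := hinl (by omega) hv
        exact ⟨e', he'⟩
    have hu : ∀ i, i + 1 < n → ∃ u, c (2 * i + 1) = Sum.inl u := by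
      intro i hi
      obtain ⟨e, he⟩ := he i (by omega)
      obtain ⟨v, hv, -⟩ := hinr (by omega) he
      exact ⟨v, hv⟩
    -- A path that starts with an edge contains only `n - 1` vertices; the free end of its first
    -- edge supplies the missing one.
    obtain ⟨w, hw, hw'⟩ : ∃ w ∈ (e₀ : Sym2 V), 1 < n → c 1 ≠ Sum.inl w := by
      obtain ⟨⟨a, b⟩, hab⟩ := e₀
      by_cases h : c 1 = Sum.inl a
      · refine ⟨b, Sym2.mem_mk_right a b, fun _ h' => ?_⟩
        exact G.ne_of_adj hab (Sum.inl_injective (h.symm.trans h'))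
      · exact ⟨a, Sym2.mem_mk_left a b, fun _ => h⟩
    have : Nonempty V := ⟨w⟩
    choose! u hu using hu
    -- The path is induced: its first edge is incident to no vertex of the path other than the
    -- second node.
    have hwu : ∀ i, i + 1 < n → w ≠ u i := by
      rintro i hi rfl
      have h1 : G.Incident (c 0) (c (2 * i + 1)) := by
        rw [h0, hu i hi]
        exact hw
      rcases (hinc 0 (by omega) (2 * i + 1) (by omega) (by omega)).1 h1 with h2 | h2
      · obtain rfl : i = 0 := by omega
        exact hw' (by omega) (hu 0 hi)
      · omega
    let v : ℕ → V := fun i => Nat.casesOn i w u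
    have hinj : Set.InjOn v (Set.Iio n) := by
      rintro (_ | i) hi (_ | j) hj hij
      · rfl
      · exact absurd hij (hwu j hj)
      · exact absurd hij.symm (hwu i hi)
      · rw [Set.mem_Iio] at hi hj
        have hij : u i = u j := hij
        have := hc (show 2 * i + 1 < 2 * n - 1 by omega) (show 2 * j + 1 < 2 * n - 1 by omega)
          (by rw [hu i hi, hu j hj, hij])
        omega
    refine ⟨v, hinj, ?_⟩
    rintro (_ | i) hi
    · obtain ⟨x, hx, h1⟩ := hinr (by omega) h0
      obtain rfl : u 0 = x := Sum.inl_injective ((hu 0 hi).symm.trans hx)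
      exact hadj hw h1 (hwu 0 hi)
    · obtain ⟨e, he, h1⟩ := hinl (by omega) (hu i (by omega))
      obtain ⟨x, hx, h2⟩ := hinr (by omega) he
      obtain rfl : u (i + 1) = x := Sum.inl_injective ((hu (i + 1) hi).symm.trans hx)
      exact hadj h1 h2 fun h => by
        have := hinj (show i + 1 < n by omega) hi h
        omega

theorem Graph.hasHamiltonianPath_iff {α β : Type*} (Γ : Graph α β) {n : ℕ} (hn : 1 ≤ n)
    (hΓ : Γ.vertexSet.ncard = n) : Γ.HasHamiltonianPath ↔ ∃ v : ℕ → Γ.vertexSet,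
      Set.InjOn v (Set.Iio n) ∧ ∀ i, i + 1 < n → Γ.simplification.Adj (v i) (v (i + 1)) := by
  classical
  -- `ncard` is `0` on infinite sets, so `1 ≤ n` forces finiteness.
  have hfin : Γ.vertexSet.Finite := Set.finite_of_ncard_pos (by omega)
  constructor
  · rintro ⟨p, -, hnodup, hmem, hchain⟩
    have hlen : p.length = n := by
      rw [← List.toFinset_card_of_nodup hnodup, ← hΓ, ← Set.ncard_coe_finset]
      congr 1
      ext x
      simp [hmem]
    have hv : ∀ i < n, ∃ v : Γ.vertexSet, p[i]? = some v.1 := by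
      intro i hi
      exact ⟨⟨p[i]'(by omega), (hmem _).1 (List.getElem_mem _)⟩, List.getElem?_eq_getElem _⟩
    have : Nonempty Γ.vertexSet := ⟨(hv 0 (by omega)).choose⟩
    choose! v hv using hv
    have hinj : Set.InjOn v (Set.Iio n) := by
      intro i hi j hj hij
      rw [Set.mem_Iio] at hi hj
      refine (hnodup.getElem_inj_iff (hi := by omega) (hj := by omega)).1 ?_
      apply Option.some_injective
      rw [← List.getElem?_eq_getElem, ← List.getElem?_eq_getElem, hv i hi, hv j hj, hij]
    refine ⟨v, hinj, fun i hi => ⟨fun h => ?_, ?_⟩⟩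
    · have := hinj (show i < n by omega) hi h
      omega
    · have h1 := List.isChain_iff_getElem.1 hchain i (by omega)
      have h2 : p[i]'(by omega) = v i := by
        apply Option.some_injective
        rw [← List.getElem?_eq_getElem, hv i (by omega)]
      have h3 : p[i + 1]'(by omega) = v (i + 1) := by
        apply Option.some_injective
        rw [← List.getElem?_eq_getElem, hv (i + 1) hi]
      rwa [h2, h3] at h1
  · rintro ⟨v, hinj, hadj⟩
    have hinj' : Set.InjOn (fun i => (v i : α)) (Set.Iio n) := fun i hi j hj hij =>
      hinj hi hj (Subtype.ext hij)
    -- By counting, `n` distinct vertices exhaust the vertex set.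
    have himg : (fun i => (v i : α)) '' Set.Iio n = Γ.vertexSet := by
      refine Set.eq_of_subset_of_ncard_le ?_ ?_ hfin
      · rintro _ ⟨i, -, rfl⟩
        exact (v i).2
      · rw [hinj'.ncard_image, hΓ]
        simp
    refine ⟨(List.range n).map fun i => (v i : α), ?_, ?_, fun x => ?_, ?_⟩
    · simp; omega
    · refine List.Nodup.map_on (fun i hi j hj h => hinj' ?_ ?_ h) List.nodup_range
      · exact List.mem_range.1 hi
      · exact List.mem_range.1 hj
    · rw [← Set.ext_iff.1 himg x]
      simp
    · rw [List.isChain_iff_getElem]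
      intro i hi
      simp only [List.length_map, List.length_range] at hi
      simpa using (hadj i hi).2

namespace Drawing

variable {V : Type*} {G : SimpleGraph V} {D : Drawing G} {δ : ℝ}

/-- The chain of trefoils and unknots along a path. -/
noncomputable def chain (D : Drawing G) (δ : ℝ) (v : ℕ → V) : ChainData where
  p i := D.pos (v i)
  d i := -D.pos (v i)
  h i := D.height (v i) (v (i + 1))
  a i := D.clasp (v i) (v (i + 1))
  b i := D.clasp (v (i + 1)) (v i)
  δ := δ

theorem sym2_injOn_of_injOn {v : ℕ → V} {n : ℕ} (hv : Set.InjOn v (Set.Iio n)) {i j : ℕ}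
    (hi : i + 1 < n) (hj : j + 1 < n) (h : s(v i, v (i + 1)) = s(v j, v (j + 1))) : i = j := by
  have hi' : i < n := by omega
  have hj' : j < n := by omega
  rcases Sym2.eq_iff.1 h with ⟨h1, -⟩ | ⟨h1, h2⟩
  · exact hv hi' hj' h1
  · have e1 := hv hi' hj h1
    have e2 := hv hi hj' h2
    omega

theorem Separated.chain_good (H : D.Separated δ) {v : ℕ → V} {n : ℕ}
    (hv : Set.InjOn v (Set.Iio n)) (hadj : ∀ i, i + 1 < n → G.Adj (v i) (v (i + 1))) :
    (D.chain δ v).Good n where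
  pos := H.pos
  norm_dir i _ := D.norm_neg_pos (v i)
  edge_good i hi := H.edge_good _ _ (hadj i hi)
  edge_good_symm i hi := by
    have h := H.edge_good _ _ (hadj i hi).symm
    rw [D.height_swap] at h
    exact h
  vertex_far i j hi hj hij := H.vertex_far _ _ (hv.ne hi hj hij)
  band_far i j hi hj h1 h2 := H.band_far _ _ _ (hadj i hi)
    (hv.ne hj (show i < n by omega) h1) (hv.ne hj hi h2)
  band_disjoint i j hi hj hij := H.band_disjoint _ _ _ _ (hadj i hi) (hadj j hj) fun h =>
    hij (sym2_injOn_of_injOn hv hi hj h)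

theorem Separated.containsAsSublink_of_path (H : D.Separated δ) {v : ℕ → V} {n : ℕ} (hn : 1 ≤ n)
    (hv : Set.InjOn v (Set.Iio n)) (hadj : ∀ i, i + 1 < n → G.Adj (v i) (v (i + 1))) :
    ContainsAsSublink (D.link δ) (stringOfTrefoils (2 * n - 1)) := by
  have hk : ∀ j : Fin (2 * n - 1), ∃ k : V ⊕ G.edgeSet, D.link δ k = (D.chain δ v).comp j ∧
      (∀ i, (j : ℕ) = 2 * i → k = Sum.inl (v i)) ∧
      ∀ i, (j : ℕ) = 2 * i + 1 → ∃ h, k = Sum.inr ⟨s(v i, v (i + 1)), h⟩ := by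
    rintro ⟨j, hj⟩
    obtain ⟨i, rfl | rfl⟩ := Nat.even_or_odd' j
    · refine ⟨Sum.inl (v i), ?_, fun i' h => ?_, fun i' h => ?_⟩
      · rw [ChainData.comp_even]
        rfl
      · obtain rfl : i = i' := by simpa using h
        rfl
      · simp only at h
        omega
    · have h1 : s(v i, v (i + 1)) ∈ G.edgeSet := hadj i (by omega)
      refine ⟨Sum.inr ⟨s(v i, v (i + 1)), h1⟩, ?_, fun i' h => ?_, fun i' h => ?_⟩
      · rw [ChainData.comp_odd, D.link_inr (H.le_one h1)]
        rfl
      · simp only at h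
        omega
      · obtain rfl : i = i' := by simpa using h
        exact ⟨h1, rfl⟩
  choose k hk1 hk2 hk3 using hk
  have hinj : Function.Injective k := by
    intro j j' h
    obtain ⟨i, hi | hi⟩ := Nat.even_or_odd' (j : ℕ) <;>
      obtain ⟨i', hi' | hi'⟩ := Nat.even_or_odd' (j' : ℕ)
    · rw [hk2 j i hi, hk2 j' i' hi', Sum.inl.injEq] at h
      have := hv (show i < n by omega) (show i' < n by omega) h
      exact Fin.ext (by omega)
    · obtain ⟨_, h'⟩ := hk3 j' i' hi'
      rw [hk2 j i hi, h'] at h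
      cases h
    · obtain ⟨_, h'⟩ := hk3 j i hi
      rw [hk2 j' i' hi', h'] at h
      cases h
    · obtain ⟨_, h1⟩ := hk3 j i hi
      obtain ⟨_, h2⟩ := hk3 j' i' hi'
      rw [h1, h2, Sum.inr.injEq, Subtype.mk.injEq] at h
      have := sym2_injOn_of_injOn hv (by omega) (by omega) h
      exact Fin.ext (by omega)
  obtain ⟨F, ⟨I, hI, hI0, rfl⟩, hF⟩ :=
    (H.chain_good hv hadj).exists_isotopy_comp (ChainData.string_good n) hn
  refine ⟨Set.range k, I, hI, hI0, (Equiv.ofInjective k hinj).symm, ?_⟩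
  rintro ⟨_, j, rfl⟩
  rw [Equiv.ofInjective_symm_apply, ChainData.stringOfTrefoils_apply]
  exact (congrArg _ (hk1 j)).trans (hF j j.2)

/-- Only the final homeomorphism of the isotopy matters: it preserves `Linked`, which is incidence
among the components of the drawing and adjacency along the string. -/
theorem Separated.exists_path_of_containsAsSublink (H : D.Separated δ) {n : ℕ} (hn : 1 ≤ n)
    (h : ContainsAsSublink (D.link δ) (stringOfTrefoils (2 * n - 1))) :
    ∃ v : ℕ → V, Set.InjOn v (Set.Iio n) ∧ ∀ i, i + 1 < n → G.Adj (v i) (v (i + 1)) := by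
  obtain ⟨S, I, -, -, σ, hσ⟩ := h
  have hne : 0 < 2 * n - 1 := by omega
  let c : ℕ → V ⊕ G.edgeSet := fun j =>
    if hj : j < 2 * n - 1 then σ.symm ⟨j, hj⟩ else σ.symm ⟨0, hne⟩
  have hcj : ∀ j (hj : j < 2 * n - 1), c j = σ.symm ⟨j, hj⟩ := fun j hj => dif_pos hj
  have himg : ∀ j < 2 * n - 1, I 1 '' D.link δ (c j) = ChainData.string.comp j := by
    intro j hj
    have h1 := hσ (σ.symm ⟨j, hj⟩)
    rw [Equiv.apply_symm_apply, ChainData.stringOfTrefoils_apply] at h1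
    rw [hcj j hj]
    exact h1
  have hinj : Set.InjOn c (Set.Iio (2 * n - 1)) := by
    intro i hi j hj hij
    rw [hcj i hi, hcj j hj] at hij
    exact Fin.mk.inj_iff.1 (σ.symm.injective (Subtype.ext hij))
  refine SimpleGraph.exists_path_of_incident hn hinj fun i hi j hj hij => ?_
  rw [← H.linked_iff (hinj.ne hi hj hij), ← linked_image_iff (I 1),
    ← linked_image_iff (A := D.link δ (c j)) (I 1), himg i hi, himg j hj,
    (ChainData.string_good n).linked_comp_iff hi hj hij]

end Drawing

theorem proposition4p1 {α β : Type*} (Γ : Graph α β) (n : ℕ) (hn : 1 ≤ n)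
    (hΓ : Γ.vertexSet.ncard = n) :
    Nonempty (Drawing Γ.simplification) ∧
    ∀ D : Drawing Γ.simplification, ∀ᶠ δ in 𝓝[>] (0 : ℝ),
      (Γ.HasHamiltonianPath ↔
        ContainsAsSublink (D.link δ) (stringOfTrefoils (2 * n - 1))) := by
  have : Finite Γ.vertexSet := (Set.finite_of_ncard_pos (by omega)).to_subtype
  refine ⟨exists_drawing _, fun D => D.eventually_separated.mono fun δ H => ?_⟩
  rw [Γ.hasHamiltonianPath_iff hn hΓ]
  exact ⟨fun ⟨v, hv, hadj⟩ => H.containsAsSublink_of_path hn hv hadj,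
    H.exists_path_of_containsAsSublink hn⟩
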